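/- Let $d\ge 1$. A modulus of continuity is a nondecreasing subadditive function $\omega:[0,\infty)\to[0,\infty)$ with $\omega(0)=0$; put $\|\omega\|_{\mathrm{Dini}}:=\int_0^1\omega(t)\,\frac{dt}{t}$. A bounded linear operator $T$ on $L^2(\mathbb{R}^d)$ is an $\omega$-Calderón–Zygmund operator with kernel $K$ and size constant $C_K$ if, for every $f\in L^2(\mathbb{R}^d)$, $Tf(x)=\int_{\mathbb{R}^d}K(x,y)f(y)\,dy$ for almost every $x\notin\operatorname{supp}f$, if $|K(x,y)|\le C_K|x-y|^{-d}$ for all $x\ne y$, and if $$|K(x,y)-K(x',y)|+|K(y,x)-K(y,x')|\le \omega\Big(\frac{|x-x'|}{|x-y|}\Big)\frac{1}{|x-y|^d}\qquad\text{whenever } |x-y|>2|x-x'|>0 .$$ Its maximal truncation is $$T_\sharp f(x):=\sup_{\varepsilon>0}\Big|\int_{|x-y|>\varepsilon}K(x,y)f(y)\,dy\Big| .$$ For $\alpha\in\{0,1,2\}^d$ let $\mathscr{D}^\alpha:=\{2^{-k}([0,1)^d+m+(-1)^k\tfrac13\alpha): k\in\mathbb{Z},\ m\in\mathbb{Z}^d\}$.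 A collection $\mathscr{S}\subseteq\mathscr{D}^\alpha$ is sparse if $\big|\bigcup_{Q'\in\mathscr{S},\,Q'\subsetneq Q}Q'\big|\le\frac12|Q|$ for every $Q\in\mathscr{S}$, and $\mathcal{A}_{\mathscr{S}}f:=\sum_{Q\in\mathscr{S}}1_Q\,\frac{1}{|Q|}\int_Q|f|$. **Theorem 2.5.** There is a constant $c_d<\infty$ depending only on the dimension $d$ such that the following holds. Let $T$ be an $\omega$-Calderón–Zygmund operator on $L^2(\mathbb{R}^d)$ with kernel $K$ and size constant $C_K$, where $\|\omega\|_{\mathrm{Dini}}<\infty$, and let $f\in L^1(\mathbb{R}^d)$ be compactly supported. Then there are sparse collections $\mathscr{S}^\alpha\subseteq\mathscr{D}^\alpha$, $\alpha\in\{0,1,2\}^d$, such that $$T_\sharp f(x)\le c_d\big(\|T\|_{L^2\to L^2}+C_K+\|\omega\|_{\mathrm{Dini}}\big)\sum_{\alpha\in\{0,1,2\}^d}\mathcal{A}_{\mathscr{S}^\alpha}f(x)\qquad\text{for almost every }x\in\mathbb{R}^d .$$ -/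

import Mathlib

open MeasureTheory Set
open scoped ENNReal NNReal

noncomputable section

/-- The space `ℝ^d` with its Euclidean norm and Lebesgue measure. -/
abbrev Rd (d : ℕ) : Type := EuclideanSpace ℝ (Fin d)

/-- The (essential, closed) support of a function defined up to null sets: `x` is outside the
support iff the function vanishes almost everywhere in some ball centred at `x`. -/
def essSupport {d : ℕ} (f : Rd d → ℂ) : Set (Rd d) :=
  {x | ∀ r : ℝ, 0 < r → ¬ ∀ᵐ y ∂(volume : Measure (Rd d)), y ∈ Metric.ball x r → f y = 0}

/-- A modulus of continuity `ω : [0, ∞) → [0, ∞)`: increasing (in the weak sense), subadditive,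
and `ω 0 = 0`. Only the values of `ω` on `[0, ∞)` matter. -/
structure IsModulusOfContinuity (ω : ℝ → ℝ) : Prop where
  nonneg : ∀ t, 0 ≤ t → 0 ≤ ω t
  mono : ∀ s t, 0 ≤ s → s ≤ t → ω s ≤ ω t
  subadd : ∀ s t, 0 ≤ s → 0 ≤ t → ω (s + t) ≤ ω s + ω t
  zero : ω 0 = 0

/-- The Dini norm `∫₀¹ ω(t) dt / t`, with values in `[0, ∞]`. -/
def diniNorm (ω : ℝ → ℝ) : ℝ≥0∞ :=
  ∫⁻ t in Ioo (0 : ℝ) 1, ENNReal.ofReal (ω t / t)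

/-- `T` is an `ω`-Calderón–Zygmund operator with kernel `K` and size constant `CK`. -/
structure IsCalderonZygmund {d : ℕ} (ω : ℝ → ℝ) (CK : ℝ) (K : Rd d → Rd d → ℂ)
    (T : Lp ℂ 2 (volume : Measure (Rd d)) →L[ℂ] Lp ℂ 2 (volume : Measure (Rd d))) : Prop where
  modulus : IsModulusOfContinuity ω
  /-- Off the support of `f`, the operator is given by integration against the kernel. -/
  repr : ∀ f : Lp ℂ 2 (volume : Measure (Rd d)), ∀ᵐ x ∂(volume : Measure (Rd d)),
    x ∉ essSupport (f : Rd d → ℂ) → (T f : Rd d → ℂ) x = ∫ y, K x y * f y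
  size : ∀ x y, x ≠ y → ‖K x y‖ ≤ CK / ‖x - y‖ ^ d
  smooth : ∀ x x' y, 0 < 2 * ‖x - x'‖ → 2 * ‖x - x'‖ < ‖x - y‖ →
    ‖K x y - K x' y‖ + ‖K y x - K y x'‖ ≤ ω (‖x - x'‖ / ‖x - y‖) * (1 / ‖x - y‖ ^ d)

/-- The truncation `T_ε f (x) = ∫_{|x - y| > ε} K(x, y) f(y) dy`. -/
def truncation {d : ℕ} (K : Rd d → Rd d → ℂ) (ε : ℝ) (f : Rd d → ℂ) (x : Rd d) : ℂ :=
  ∫ y in {y | ε < ‖x - y‖}, K x y * f y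

/-- The maximal truncation `T_♯ f (x) = sup_{ε > 0} |T_ε f (x)|`, with values in `[0, ∞]`. -/
def maximalTruncation {d : ℕ} (K : Rd d → Rd d → ℂ) (f : Rd d → ℂ) (x : Rd d) : ℝ≥0∞ :=
  ⨆ (ε : ℝ) (_ : 0 < ε), ‖truncation K ε f x‖ₑ

/-- The half-open cube `2^{-k} ([0,1)^d + m + (-1)^k α / 3)`. -/
def dyadicCube {d : ℕ} (α : Fin d → Fin 3) (k : ℤ) (m : Fin d → ℤ) : Set (Rd d) :=
  {x | ∀ i, (2 : ℝ) ^ (-k) * ((m i : ℝ) + (-1 : ℝ) ^ k * (((α i : ℕ) : ℝ) / 3)) ≤ x i ∧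
    x i < (2 : ℝ) ^ (-k) * (1 + ((m i : ℝ) + (-1 : ℝ) ^ k * (((α i : ℕ) : ℝ) / 3)))}

/-- The adjacent dyadic system `𝒟^α`, for `α ∈ {0,1,2}^d`. -/
def dyadicSystem {d : ℕ} (α : Fin d → Fin 3) : Set (Set (Rd d)) :=
  {Q | ∃ (k : ℤ) (m : Fin d → ℤ), Q = dyadicCube α k m}

/-- The sparseness condition: the members of `S` strictly contained in a member `Q` cover at most
half of `Q`. -/
def IsSparse {d : ℕ} (S : Set (Set (Rd d))) : Prop :=
  ∀ Q ∈ S, volume (⋃ Q' ∈ {Q' | Q' ∈ S ∧ Q' ⊂ Q}, Q') ≤ (1 / 2 : ℝ≥0∞) * volume Q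

/-- The operator `𝒜_S f (x) = ∑_{Q ∈ S} 1_Q(x) ⟨|f|⟩_Q`, with values in `[0, ∞]`. -/
def sparseOperator {d : ℕ} (S : Set (Set (Rd d))) (f : Rd d → ℂ) (x : Rd d) : ℝ≥0∞ :=
  ∑' Q : S, (Q : Set (Rd d)).indicator
    (fun _ => (volume (Q : Set (Rd d)))⁻¹ * ∫⁻ y in (Q : Set (Rd d)), ‖f y‖ₑ) x

end

/-! The core is a stopping-time argument on one cube. Let A be the sum of the three constants. The
maximal truncation is of weak type (1,1) with constant a multiple of A: bounded functions are
handled by Cotlar's inequality and the L² bound for T, general ones by a Calderón–Zygmund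
decomposition (`exists_mul_volume_maximalTruncation_le`). For a cube P let f_P be f restricted to a
neighbourhood of P, and ⟨f⟩_P its mass divided by |P|. Let E_P be the open set where T_♯ f_P exceeds
a large multiple of A⟨f⟩_P, or the maximal function of f_P a large multiple of ⟨f⟩_P; then |E_P| ≤
|P|/2. The stopping children of P are the maximal dyadic Q ⊂ P inside E_P. The dyadic parent of such
a Q contains a point z outside E_P, and kernel regularity carries the bounds at z over to x in Q
(`maximalTruncation_away_le`), so that T_♯ f_P(x) ≤ cA⟨f⟩_P + T_♯ f_Q(x). Almost every x lies in
finitely many selected cubes, so iteration terminates and gives `exists_isSparse_localize_le`.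

The resulting means are over neighbourhoods of cubes. By the one-third trick each neighbourhood lies
in a comparable cube of a grid with shifts 0 and 1 only. The covering cubes form a Carleson family,
not necessarily a sparse one; a second stopping argument thins it at bounded cost
(`exists_isSparse_sparseOperator_le`).

This settles x in one cube Q₀ around the support of f. Outside Q₀ the size condition bounds T_♯ f(x)
by a multiple of C_K |x|^(-d) ‖f‖₁, hence by the mean of |f| over a cube containing both x and the
support. The grid with all shifts 2 has been kept free for these cubes: the origin stays away from
the faces of its cubes at every scale, so they exhaust the space. -/

noncomputable section

/-! ### Adjacent dyadic grids -/

/-- The offset of the grid `α` in direction `i` at generation `k`, in units of the side length. -/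
def gridShift {d : ℕ} (α : Fin d → Fin 3) (k : ℤ) (i : Fin d) : ℝ :=
  (-1 : ℝ) ^ k * (((α i : ℕ) : ℝ) / 3)

/-- The position of the cube of generation `k` of the grid `α` containing `x`. -/
def gridIndex {d : ℕ} (α : Fin d → Fin 3) (k : ℤ) (x : Rd d) (i : Fin d) : ℤ :=
  ⌊(2 : ℝ) ^ k * x i - gridShift α k i⌋

/-- The cube of generation `k` of the grid `α` containing `x`. -/
def cubeAt {d : ℕ} (α : Fin d → Fin 3) (k : ℤ) (x : Rd d) : Set (Rd d) :=
  dyadicCube α k (gridIndex α k x)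

variable {d : ℕ} {α : Fin d → Fin 3} {k l : ℤ} {m n : Fin d → ℤ} {x y : Rd d}

/-- The cubes of one generation are the fibres of a floor map; questions about membership and
inclusion thereby become arithmetic of integer indices. -/
theorem mem_dyadicCube_iff : x ∈ dyadicCube α k m ↔ gridIndex α k x = m := by
  have h2 : (0 : ℝ) < 2 ^ k := by positivity
  have e : (2 : ℝ) ^ (-k) = (2 ^ k)⁻¹ := by rw [zpow_neg]
  rw [funext_iff]
  change (∀ i, _ ∧ _) ↔ _
  refine forall_congr' fun i => ?_
  rw [gridIndex, Int.floor_eq_iff, e, inv_mul_le_iff₀ h2, lt_inv_mul_iff₀ h2]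
  simp only [gridShift]
  constructor <;> rintro ⟨h, h'⟩ <;> constructor <;> linarith

theorem mem_cubeAt_iff : y ∈ cubeAt α k x ↔ gridIndex α k y = gridIndex α k x :=
  mem_dyadicCube_iff

theorem mem_cubeAt_self : x ∈ cubeAt α k x := mem_cubeAt_iff.2 rfl

theorem cubeAt_mem_dyadicSystem : cubeAt α k x ∈ dyadicSystem α := ⟨k, _, rfl⟩

theorem dyadicCube_eq_cubeAt (hx : x ∈ dyadicCube α k m) : dyadicCube α k m = cubeAt α k x := by
  rw [cubeAt, mem_dyadicCube_iff.1 hx]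

theorem exists_eq_cubeAt {Q : Set (Rd d)} (hQ : Q ∈ dyadicSystem α) (hx : x ∈ Q) :
    ∃ k, Q = cubeAt α k x := by
  obtain ⟨k, m, rfl⟩ := hQ
  exact ⟨k, dyadicCube_eq_cubeAt hx⟩

/-- Nestedness of the grid. Since the sign of the shift alternates, the coordinate at generation k+1
is twice the one at generation k plus the integer ±α; hence the coarse index is a function of the
fine one. -/
theorem gridIndex_succ_eq_imp (h : gridIndex α (k + 1) x = gridIndex α (k + 1) y) :
    gridIndex α k x = gridIndex α k y := by
  funext i
  have hi := congrFun h i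
  have key : ∀ z : Rd d, gridIndex α k z i =
      (gridIndex α (k + 1) z i - (-1) ^ k.natAbs * ((α i : ℕ) : ℤ)) / 2 := by
    intro z
    have h1 : (-1 : ℝ) ^ k = (((-1) ^ k.natAbs : ℤ) : ℝ) := by
      obtain ⟨n, rfl | rfl⟩ := Int.eq_nat_or_neg k
      · simp
      · simp only [zpow_neg, zpow_natCast, ← inv_pow, Int.natAbs_neg, Int.natAbs_natCast]
        norm_num
    have h2 : (2 : ℝ) ^ (k + 1) = 2 * 2 ^ k := by
      rw [zpow_add₀ (by norm_num)]; ring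
    have h3 : (-1 : ℝ) ^ (k + 1) = - (-1) ^ k := by
      rw [zpow_add₀ (by norm_num)]; simp
    have h4 : (2 : ℝ) ^ (k + 1) * z i - gridShift α (k + 1) i =
        2 * (2 ^ k * z i - gridShift α k i) + (((-1) ^ k.natAbs * ((α i : ℕ) : ℤ) : ℤ) : ℝ) := by
      rw [gridShift, gridShift, h2, h3, h1]; push_cast; ring
    rw [gridIndex, gridIndex, h4, Int.floor_add_intCast, add_sub_cancel_right]
    set u := (2 : ℝ) ^ k * z i - gridShift α k i
    have hu := Int.floor_le u
    have hu' := Int.lt_floor_add_one u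
    have a1 : 2 * ⌊u⌋ ≤ ⌊2 * u⌋ := by
      rw [Int.le_floor]; push_cast; linarith
    have a2 : ⌊2 * u⌋ < 2 * ⌊u⌋ + 2 := by
      rw [Int.floor_lt]; push_cast; linarith
    omega
  rw [key, key, hi]

theorem gridIndex_eq_of_le (hkl : k ≤ l) (h : gridIndex α l x = gridIndex α l y) :
    gridIndex α k x = gridIndex α k y := by
  obtain ⟨n, rfl⟩ := Int.le.dest hkl
  induction n with
  | zero => simpa using h
  | succ n ih =>
    refine ih (by omega) (gridIndex_succ_eq_imp ?_)
    have : k + (n : ℤ) + 1 = k + ((n + 1 : ℕ) : ℤ) := by push_cast; ring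
    rw [this]; exact h

theorem cubeAt_anti (hkl : k ≤ l) : cubeAt α l x ⊆ cubeAt α k x := fun _ hy =>
  mem_cubeAt_iff.2 (gridIndex_eq_of_le hkl (mem_cubeAt_iff.1 hy))

theorem dyadicSystem_nested {P Q : Set (Rd d)} (hP : P ∈ dyadicSystem α)
    (hQ : Q ∈ dyadicSystem α) : P ⊆ Q ∨ Q ⊆ P ∨ Disjoint P Q := by
  by_cases h : Disjoint P Q
  · exact Or.inr (Or.inr h)
  obtain ⟨x, hxP, hxQ⟩ := Set.not_disjoint_iff.1 h
  obtain ⟨k, rfl⟩ := exists_eq_cubeAt hP hxP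
  obtain ⟨l, rfl⟩ := exists_eq_cubeAt hQ hxQ
  rcases le_total k l with h | h
  · exact Or.inr (Or.inl (cubeAt_anti h))
  · exact Or.inl (cubeAt_anti h)

theorem dyadicCube_nonempty : (dyadicCube α k m).Nonempty := by
  have h2 : (2 : ℝ) ^ k ≠ 0 := by positivity
  refine ⟨WithLp.toLp 2 fun i => (2 ^ k)⁻¹ * (m i + gridShift α k i), mem_dyadicCube_iff.2 ?_⟩
  funext i
  simp [gridIndex, mul_inv_cancel_left₀ h2]

theorem nonempty_of_mem_dyadicSystem {Q : Set (Rd d)} (hQ : Q ∈ dyadicSystem α) : Q.Nonempty := by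
  obtain ⟨k, m, rfl⟩ := hQ
  exact dyadicCube_nonempty

theorem dyadicCube_eq_preimage : dyadicCube α k m = (@WithLp.ofLp 2 (Fin d → ℝ)) ⁻¹'
    (Set.pi univ fun i => Ico ((2 : ℝ) ^ (-k) * (m i + gridShift α k i))
      ((2 : ℝ) ^ (-k) * (1 + (m i + gridShift α k i)))) := by
  ext x
  simp only [Set.mem_preimage, Set.mem_pi, Set.mem_univ, forall_true_left, Set.mem_Ico]
  rfl

theorem measurableSet_dyadicCube : MeasurableSet (dyadicCube α k m) := by
  rw [dyadicCube_eq_preimage]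
  exact (PiLp.volume_preserving_ofLp (Fin d)).measurable
    (MeasurableSet.univ_pi fun i => measurableSet_Ico)

theorem measurableSet_of_mem_dyadicSystem {Q : Set (Rd d)} (hQ : Q ∈ dyadicSystem α) :
    MeasurableSet Q := by
  obtain ⟨k, m, rfl⟩ := hQ
  exact measurableSet_dyadicCube

theorem volume_dyadicCube : volume (dyadicCube α k m) = ENNReal.ofReal (((2 : ℝ) ^ (-k)) ^ d) := by
  rw [dyadicCube_eq_preimage, (PiLp.volume_preserving_ofLp (Fin d)).measure_preimage
    (MeasurableSet.univ_pi fun i => measurableSet_Ico).nullMeasurableSet, Real.volume_pi_Ico]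
  have : ∀ i : Fin d, (2 : ℝ) ^ (-k) * (1 + (m i + gridShift α k i)) -
      (2 : ℝ) ^ (-k) * (m i + gridShift α k i) = 2 ^ (-k) := fun i => by ring
  simp only [this, Finset.prod_const, Finset.card_univ, Fintype.card_fin]
  rw [ENNReal.ofReal_pow (by positivity)]

theorem volume_cubeAt : volume (cubeAt α k x) = ENNReal.ofReal (((2 : ℝ) ^ (-k)) ^ d) :=
  volume_dyadicCube

theorem volume_pos_of_mem_dyadicSystem {Q : Set (Rd d)} (hQ : Q ∈ dyadicSystem α) :
    volume Q ≠ 0 := by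
  obtain ⟨k, m, rfl⟩ := hQ
  rw [volume_dyadicCube]
  simp only [ne_eq, ENNReal.ofReal_eq_zero, not_le]
  positivity

theorem volume_ne_top_of_mem_dyadicSystem {Q : Set (Rd d)} (hQ : Q ∈ dyadicSystem α) :
    volume Q ≠ ∞ := by
  obtain ⟨k, m, rfl⟩ := hQ
  rw [volume_dyadicCube]
  exact ENNReal.ofReal_ne_top

theorem volume_cubeAt_le_iff (hd : 0 < d) :
    volume (cubeAt α k x) ≤ volume (cubeAt α l y) ↔ l ≤ k := by
  rw [volume_cubeAt, volume_cubeAt, ENNReal.ofReal_le_ofReal_iff (by positivity),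
    pow_le_pow_iff_left₀ (by positivity) (by positivity) hd.ne',
    zpow_le_zpow_iff_right₀ (by norm_num)]
  omega

theorem cubeAt_subset_iff (hd : 0 < d) : cubeAt α l x ⊆ cubeAt α k x ↔ k ≤ l :=
  ⟨fun h => (volume_cubeAt_le_iff hd).1 (measure_mono h), cubeAt_anti⟩

theorem eq_of_mem_of_volume_eq (hd : 0 < d) {P Q : Set (Rd d)} (hP : P ∈ dyadicSystem α)
    (hQ : Q ∈ dyadicSystem α) (hxP : x ∈ P) (hxQ : x ∈ Q) (h : volume P = volume Q) : P = Q := by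
  obtain ⟨k, rfl⟩ := exists_eq_cubeAt hP hxP
  obtain ⟨l, rfl⟩ := exists_eq_cubeAt hQ hxQ
  rw [le_antisymm ((volume_cubeAt_le_iff hd).1 h.ge) ((volume_cubeAt_le_iff hd).1 h.le)]

theorem countable_dyadicSystem (α : Fin d → Fin 3) : (dyadicSystem α).Countable := by
  have : dyadicSystem α = Set.range fun p : ℤ × (Fin d → ℤ) => dyadicCube α p.1 p.2 := by
    ext Q
    constructor
    · rintro ⟨k, m, rfl⟩; exact ⟨(k, m), rfl⟩
    · rintro ⟨p, rfl⟩; exact ⟨p.1, p.2, rfl⟩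
  rw [this]
  exact Set.countable_range _

/-- Only finitely many members of a grid of bounded size contain a given member. -/
theorem finite_setOf_superset (hd : 0 < d) {Q : Set (Rd d)} (hQ : Q ∈ dyadicSystem α)
    (C : ℝ≥0∞) (hC : C ≠ ∞) :
    {R | R ∈ dyadicSystem α ∧ Q ⊆ R ∧ volume R ≤ C}.Finite := by
  obtain ⟨x, hx⟩ := nonempty_of_mem_dyadicSystem hQ
  obtain ⟨k, rfl⟩ := exists_eq_cubeAt hQ hx
  obtain ⟨N, hN⟩ := pow_unbounded_of_one_lt C.toReal (one_lt_two : (1 : ℝ) < 2)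
  refine ((Set.finite_Icc (-(N : ℤ)) k).image fun l => cubeAt α l x).subset ?_
  rintro R ⟨hR, hQR, hRC⟩
  obtain ⟨l, rfl⟩ := exists_eq_cubeAt hR (hQR hx)
  refine ⟨l, ⟨?_, (cubeAt_subset_iff hd).1 hQR⟩, rfl⟩
  by_contra! hl
  rw [volume_cubeAt] at hRC
  have h1 := (ENNReal.ofReal_le_iff_le_toReal hC).1 hRC
  have h2 : (2 : ℝ) ^ N ≤ 2 ^ (-l) := by
    rw [← zpow_natCast]; exact zpow_le_zpow_right₀ (by norm_num) (by omega)
  -- For sides at least 1 and d ≥ 1 the side is at most the volume, so the volume bound limits the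
  -- generation.
  have h3 : (2 : ℝ) ^ (-l) ≤ (2 ^ (-l)) ^ d :=
    le_self_pow₀ (le_trans (one_le_pow₀ (by norm_num)) h2) hd.ne'
  linarith

theorem norm_sub_le_of_coord {r : ℝ} (hr : 0 ≤ r) {x y : Rd d} (h : ∀ i, |x i - y i| ≤ r) :
    ‖x - y‖ ≤ d * r := by
  rw [EuclideanSpace.norm_eq]
  apply Real.sqrt_le_iff.2 ⟨by positivity, ?_⟩
  calc ∑ i, ‖(x - y) i‖ ^ 2 ≤ ∑ _i : Fin d, r ^ 2 := by
        refine Finset.sum_le_sum fun i _ => ?_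
        have := h i
        rw [Real.norm_eq_abs]
        exact pow_le_pow_left₀ (abs_nonneg _) this 2
    _ = d * r ^ 2 := by simp
    _ ≤ (d * r) ^ 2 := by
        rw [mul_pow]
        refine mul_le_mul_of_nonneg_right ?_ (by positivity)
        rcases Nat.eq_zero_or_pos d with h | h
        · simp [h]
        · exact le_self_pow₀ (by exact_mod_cast h) (by norm_num)

theorem norm_sub_le_of_mem_cubeAt (h : y ∈ cubeAt α k x) : ‖x - y‖ ≤ d * 2 ^ (-k) := by
  refine norm_sub_le_of_coord (by positivity) fun i => ?_
  have hx := (mem_cubeAt_self (α := α) (k := k) (x := x)) i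
  have hy := h i
  rw [abs_le]
  constructor <;> linarith [hx.1, hx.2, hy.1, hy.2]

/-- Small enough cubes around a point of an open set are contained in it. -/
theorem exists_cubeAt_subset {U : Set (Rd d)} (hU : IsOpen U) (hx : x ∈ U) (α : Fin d → Fin 3)
    (k₀ : ℤ) : ∃ k, k₀ ≤ k ∧ cubeAt α k x ⊆ U := by
  obtain ⟨ε, hε, hb⟩ := Metric.isOpen_iff.1 hU x hx
  obtain ⟨N, hN⟩ := pow_unbounded_of_one_lt (d / ε) (one_lt_two : (1 : ℝ) < 2)
  refine ⟨max k₀ N, le_max_left _ _, fun y hy => hb ?_⟩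
  rw [Metric.mem_ball, dist_comm, dist_eq_norm]
  have h1 := norm_sub_le_of_mem_cubeAt (cubeAt_anti (le_max_right _ _) hy)
  rw [zpow_neg, zpow_natCast, ← div_eq_mul_inv] at h1
  refine h1.trans_lt ?_
  rw [div_lt_iff₀ (by positivity)]
  rw [div_lt_iff₀ hε] at hN
  linarith

/-- The cube of a grid containing `x` contains every point whose coordinates are close to those
of `x`, provided these stay away from the faces. -/
theorem mem_cubeAt_of_coord (h : ∀ i, (gridIndex α k x i : ℝ) ≤ 2 ^ k * y i - gridShift α k i ∧
    2 ^ k * y i - gridShift α k i < gridIndex α k x i + 1) : y ∈ cubeAt α k x := by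
  rw [mem_cubeAt_iff]
  funext i
  rw [gridIndex, Int.floor_eq_iff]
  exact h i

theorem abs_coord_le_norm (x : Rd d) (i : Fin d) : |x i| ≤ ‖x‖ := by
  rw [← Real.norm_eq_abs]
  exact PiLp.norm_apply_le x i

theorem neg_one_zpow_eq (k : ℤ) : (-1 : ℝ) ^ k = 1 ∨ (-1 : ℝ) ^ k = -1 := by
  rcases Int.even_or_odd k with h | h
  · exact Or.inl h.neg_one_zpow
  · exact Or.inr h.neg_one_zpow

/-- Every small ball is contained in a cube of comparable size of one of the grids whose shifts
are `0` or `1`. -/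
theorem exists_cubeAt_superset_closedBall (k : ℤ) (x : Rd d) {r : ℝ} (hr : r * 2 ^ k < 1 / 6) :
    ∃ α : Fin d → Fin 3, (∀ i, α i ≠ 2) ∧ Metric.closedBall x r ⊆ cubeAt α k x := by
  have h2 : (0 : ℝ) < 2 ^ k := by positivity
  have key : ∀ i : Fin d, ∃ a : Fin 3, a ≠ 2 ∧ ∀ t : ℝ, |t - x i| ≤ r →
      (⌊(2 : ℝ) ^ k * x i - (-1 : ℝ) ^ k * (((a : ℕ) : ℝ) / 3)⌋ : ℝ) ≤
        2 ^ k * t - (-1 : ℝ) ^ k * (((a : ℕ) : ℝ) / 3) ∧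
      2 ^ k * t - (-1 : ℝ) ^ k * (((a : ℕ) : ℝ) / 3) <
        ⌊(2 : ℝ) ^ k * x i - (-1 : ℝ) ^ k * (((a : ℕ) : ℝ) / 3)⌋ + 1 := by
    intro i
    have hs : ∀ t : ℝ, |t - x i| ≤ r → |2 ^ k * t - 2 ^ k * x i| < 1 / 6 := by
      intro t ht
      rw [← mul_sub, abs_mul, abs_of_pos h2]
      nlinarith [abs_nonneg (t - x i)]
    generalize hu : (2 : ℝ) ^ k * x i = u at hs
    have f1 := Int.floor_le u
    have f2 := Int.lt_floor_add_one u
    -- One-third trick, coordinate by coordinate: if u is at least 1/6 away from the integers no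
    -- shift is needed; otherwise moving by 1/3 in either direction brings it at least 1/6 away.
    by_cases h0 : (⌊u⌋ : ℝ) + 1 / 6 ≤ u ∧ u ≤ ⌊u⌋ + 5 / 6
    · refine ⟨0, by decide, fun t ht => ?_⟩
      have := abs_lt.1 (hs t ht)
      simp only [Fin.val_zero, Nat.cast_zero, zero_div, mul_zero, sub_zero]
      constructor <;> linarith [this.1, this.2, h0.1, h0.2]
    · refine ⟨1, by decide, fun t ht => ?_⟩
      have ht' := abs_lt.1 (hs t ht)
      simp only [Fin.val_one, Nat.cast_one]
      rw [not_and_or, not_le, not_le] at h0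
      have fl : ∀ (v : ℝ) (z : ℤ), (z : ℝ) ≤ v - 1 / 6 → v + 1 / 6 ≤ z + 1 →
          ∀ s, |s - v| < 1 / 6 → (⌊v⌋ : ℝ) ≤ s ∧ s < ⌊v⌋ + 1 := by
        intro v z h1 h2 s hsv
        have : ⌊v⌋ = z := Int.floor_eq_iff.2 ⟨by linarith, by linarith⟩
        rw [this]
        have := abs_lt.1 hsv
        constructor <;> linarith [this.1, this.2]
      have hts : ∀ c : ℝ, |2 ^ k * t - c - (u - c)| < 1 / 6 := by
        intro c
        rw [sub_sub_sub_cancel_right]; exact hs t ht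
      rcases neg_one_zpow_eq k with e | e <;> rw [e] <;> rcases h0 with h0 | h0
      · exact fl _ (⌊u⌋ - 1) (by push_cast; linarith) (by push_cast; linarith) _ (hts _)
      · exact fl _ ⌊u⌋ (by linarith) (by linarith) _ (hts _)
      · exact fl _ ⌊u⌋ (by linarith) (by linarith) _ (hts _)
      · exact fl _ (⌊u⌋ + 1) (by push_cast; linarith) (by push_cast; linarith) _ (hts _)
  choose a ha hat using key
  refine ⟨a, ha, fun y hy => mem_cubeAt_of_coord fun i => hat i (y i) ?_⟩
  rw [Metric.mem_closedBall, dist_eq_norm] at hy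
  exact (abs_coord_le_norm (y - x) i).trans hy

/-- In the grid with all shifts equal to `2`, the cubes around the origin contain large balls. -/
theorem closedBall_subset_cubeAt_zero (k : ℤ) {r : ℝ} (hr : r * 2 ^ k < 1 / 3) :
    Metric.closedBall (0 : Rd d) r ⊆ cubeAt (fun _ => 2) k 0 := by
  have h2 : (0 : ℝ) < 2 ^ k := by positivity
  intro y hy
  rw [mem_closedBall_zero_iff] at hy
  refine mem_cubeAt_of_coord fun i => ?_
  have h1 : |2 ^ k * y i| < 1 / 3 := by
    rw [abs_mul, abs_of_pos h2]
    nlinarith [abs_coord_le_norm y i]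
  have h3 := abs_lt.1 h1
  simp only [gridIndex, gridShift, PiLp.zero_apply, mul_zero, zero_sub]
  have e2 : ((2 : Fin 3) : ℕ) = 2 := rfl
  rw [e2]
  -- In units of the side length the origin sits at 1/3 or at 2/3 of its cube, according to the
  -- parity of k, hence always at distance 1/3 from the nearest face.
  rcases neg_one_zpow_eq k with e | e <;> rw [e]
  · have : ⌊-(1 * (((2 : ℕ) : ℝ) / 3))⌋ = -1 := by
      rw [Int.floor_eq_iff]; norm_num
    rw [this]; push_cast
    constructor <;> linarith [h3.1, h3.2]
  · have : ⌊-(-1 * (((2 : ℕ) : ℝ) / 3))⌋ = 0 := by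
      rw [Int.floor_eq_iff]; norm_num
    rw [this]; push_cast
    constructor <;> linarith [h3.1, h3.2]

end

noncomputable section

/-! ### Stopping families -/

/-- The stopping family generated by a relation `bad` in a collection `S`: the maximal members of
`S`, and, with each selected `P`, the maximal `Q ⊂ P` in `S` with `bad P Q`. -/
inductive Selected {X : Type*} (S : Set (Set X)) (bad : Set X → Set X → Prop) : Set X → Prop
  | top (Q : Set X) : Q ∈ S → (∀ R ∈ S, ¬ Q ⊂ R) → Selected S bad Q
  | step (P Q : Set X) : Selected S bad P → Q ∈ S → Q ⊂ P → bad P Q →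
      (∀ R ∈ S, Q ⊂ R → R ⊂ P → ¬ bad P R) → Selected S bad Q

/-- A nested collection of nonempty sets each of which has finitely many supersets in it. -/
structure IsForest {X : Type*} (S : Set (Set X)) : Prop where
  nested : ∀ P ∈ S, ∀ Q ∈ S, P ⊆ Q ∨ Q ⊆ P ∨ Disjoint P Q
  nonempty : ∀ Q ∈ S, Q.Nonempty
  finite : ∀ Q ∈ S, {R | R ∈ S ∧ Q ⊆ R}.Finite

section Forest

variable {X : Type*} {S : Set (Set X)} {bad : Set X → Set X → Prop} {P Q R : Set X}

theorem Selected.mem (h : Selected S bad Q) : Q ∈ S := by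
  cases h <;> assumption

theorem IsForest.comparable (hS : IsForest S) (hP : P ∈ S) (hR : R ∈ S) {x : X} (hxP : x ∈ P)
    (hxR : x ∈ R) : P ⊆ R ∨ R ⊆ P := by
  rcases hS.nested P hP R hR with h | h | h
  · exact Or.inl h
  · exact Or.inr h
  · exact absurd hxR (Set.disjoint_left.1 h hxP)

theorem IsForest.ncard_lt (hS : IsForest S) (hQ : Q ∈ S) (h : Q ⊂ P) :
    {R | R ∈ S ∧ P ⊆ R}.ncard < {R | R ∈ S ∧ Q ⊆ R}.ncard := by
  refine Set.ncard_lt_ncard ⟨fun R hR => ⟨hR.1, h.subset.trans hR.2⟩, fun hsub => ?_⟩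
    (hS.finite Q hQ)
  exact h.2 (hsub ⟨hQ, subset_rfl⟩).2

/-- Any member of a subfamily lies in a maximal member of the subfamily. -/
theorem IsForest.exists_maximal (hS : IsForest S) {U : Set (Set X)} (hU : U ⊆ S) (hQ : Q ∈ U) :
    ∃ P ∈ U, Q ⊆ P ∧ ∀ R ∈ U, ¬ P ⊂ R := by
  have hfin : {R | R ∈ U ∧ Q ⊆ R}.Finite :=
    (hS.finite Q (hU hQ)).subset fun R hR => ⟨hU hR.1, hR.2⟩
  obtain ⟨P, hP⟩ := hfin.exists_maximal ⟨Q, hQ, subset_rfl⟩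
  refine ⟨P, hP.prop.1, hP.prop.2, fun R hR hPR => ?_⟩
  exact hPR.2 (hP.le_of_ge ⟨hR, hP.prop.2.trans hPR.subset⟩ hPR.subset)

/-- A selected set strictly inside a selected set `P` is inside a stopping child of `P`. -/
theorem IsForest.selected_subset (hS : IsForest S) (hP : Selected S bad P)
    (hQ : Selected S bad Q) (hQP : Q ⊂ P) :
    ∃ R ∈ S, Q ⊆ R ∧ R ⊂ P ∧ bad P R := by
  suffices H : ∀ n : ℕ, ∀ Q P, {R | R ∈ S ∧ Q ⊆ R}.ncard = n → Selected S bad P →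
      Selected S bad Q → Q ⊂ P → ∃ R ∈ S, Q ⊆ R ∧ R ⊂ P ∧ bad P R ∧
        ∀ R' ∈ S, R ⊂ R' → R' ⊂ P → ¬ bad P R' by
    obtain ⟨R, h1, h2, h3, h4, -⟩ := H _ Q P rfl hP hQ hQP
    exact ⟨R, h1, h2, h3, h4⟩
  intro n
  induction n using Nat.strong_induction_on with
  | _ n ih =>
    intro Q P hn hP hQ hQP
    cases hQ with
    | top _ hQS hmax => exact absurd hQP (hmax P hP.mem)
    | step P' _ hP' hQS hQP' hbad hmax =>
      obtain ⟨x, hx⟩ := hS.nonempty Q hQS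
      by_cases hPP : P' = P
      · subst hPP
        exact ⟨Q, hQS, subset_rfl, hQP', hbad, hmax⟩
      -- The induction is on the number of supersets of the smaller set. If P were strictly inside
      -- the stopping parent P' of Q, a bad set of P' would contain P and so strictly contain Q,
      -- against the maximality of Q. If P' is strictly inside P, the set found for P' also serves
      -- Q.
      rcases hS.comparable hP.mem hP'.mem (hQP.subset hx) (hQP'.subset hx) with h | h
      · have hss : P ⊂ P' := h.ssubset_of_ne (Ne.symm hPP)
        obtain ⟨R, hRS, hPR, hRP', hbR, -⟩ :=
          ih _ (hn ▸ hS.ncard_lt hQS hQP) P P' rfl hP' hP hss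
        exact absurd hbR (hmax R hRS (hQP.trans_subset hPR) hRP')
      · have hss : P' ⊂ P := h.ssubset_of_ne hPP
        obtain ⟨R, hRS, hPR, hRP', hbR⟩ :=
          ih _ (hn ▸ hS.ncard_lt hQS hQP') P' P rfl hP hP' hss
        exact ⟨R, hRS, hQP'.subset.trans hPR, hRP', hbR⟩

/-- A bad subset of a selected set lies in a selected stopping child. -/
theorem IsForest.exists_selected_child (hS : IsForest S) (hP : Selected S bad P)
    (hR : R ∈ S) (hRP : R ⊂ P) (hbad : bad P R) :
    ∃ Q, Selected S bad Q ∧ R ⊆ Q ∧ Q ⊂ P ∧ bad P Q ∧ ∀ R' ∈ S, Q ⊂ R' → R' ⊂ P → ¬ bad P R' := by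
  obtain ⟨Q, hQ, hRQ, hmax⟩ := hS.exists_maximal (U := {Q | Q ∈ S ∧ Q ⊂ P ∧ bad P Q})
    (fun Q hQ => hQ.1) ⟨hR, hRP, hbad⟩
  have hm : ∀ R' ∈ S, Q ⊂ R' → R' ⊂ P → ¬ bad P R' :=
    fun R' hR' h1 h2 h3 => hmax R' ⟨hR', h2, h3⟩ h1
  exact ⟨Q, Selected.step P Q hP hQ.1 hQ.2.1 hQ.2.2 hm, hRQ, hQ.2.1, hQ.2.2, hm⟩

/-- The smallest selected set containing a given member of the collection. -/
theorem IsForest.exists_selected_parent (hS : IsForest S) (bad : Set X → Set X → Prop)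
    (hR : R ∈ S) : ∃ P, Selected S bad P ∧ R ⊆ P ∧ (R ⊂ P → ¬ bad P R) := by
  have hfin : {P | Selected S bad P ∧ R ⊆ P}.Finite :=
    (hS.finite R hR).subset fun P hP => ⟨hP.1.mem, hP.2⟩
  have hne : {P | Selected S bad P ∧ R ⊆ P}.Nonempty := by
    obtain ⟨P, hP, hRP, hmax⟩ := hS.exists_maximal subset_rfl hR
    exact ⟨P, Selected.top P hP hmax, hRP⟩
  obtain ⟨P, hP⟩ := hfin.exists_minimal hne
  refine ⟨P, hP.prop.1, hP.prop.2, fun hRP hbad => ?_⟩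
  obtain ⟨Q, hQ, hRQ, hQP, -⟩ := hS.exists_selected_child hP.prop.1 hR hRP hbad
  exact hQP.2 (hP.le_of_le ⟨hQ, hRQ⟩ hQP.subset)

end Forest

/-! ### Sparse and Carleson collections of dyadic cubes -/

variable {d : ℕ} {α : Fin d → Fin 3} {S : Set (Set (Rd d))}

theorem isForest_of_volume_le (hd : 0 < d) (hS : S ⊆ dyadicSystem α) {C : ℝ≥0∞} (hC : C ≠ ∞)
    (h : ∀ Q ∈ S, volume Q ≤ C) : IsForest S where
  nested _ hP _ hQ := dyadicSystem_nested (hS hP) (hS hQ)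
  nonempty _ hQ := nonempty_of_mem_dyadicSystem (hS hQ)
  finite _ hQ := (finite_setOf_superset hd (hS hQ) C hC).subset
    fun R hR => ⟨hS hR.1, hR.2, h R hR.1⟩

/-- Every selected set strictly inside P, of whatever later generation, lies in a set that is bad
for P. One estimate for the union of the bad sets of P is therefore enough. -/
theorem isSparse_selected (hS : IsForest S) {bad : Set (Rd d) → Set (Rd d) → Prop}
    (h : ∀ P, Selected S bad P →
      volume (⋃ Q ∈ {Q | Q ∈ S ∧ Q ⊂ P ∧ bad P Q}, Q) ≤ (1 / 2 : ℝ≥0∞) * volume P) :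
    IsSparse {Q | Selected S bad Q} := by
  intro P hP
  refine (measure_mono ?_).trans (h P hP)
  refine Set.iUnion₂_subset fun Q hQ => ?_
  obtain ⟨R, hR, hQR, hRP, hbad⟩ := hS.selected_subset hP hQ.1 hQ.2
  exact hQR.trans (Set.subset_biUnion_of_mem (u := fun Q => Q)
    (show R ∈ {Q | Q ∈ S ∧ Q ⊂ P ∧ bad P Q} from ⟨hR, hRP, hbad⟩))

/-- A sparse collection satisfies the Carleson packing condition. -/
theorem IsSparse.tsum_volume_le (hS : S ⊆ dyadicSystem α) (hsp : IsSparse S) (P : Set (Rd d)) :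
    ∑' Q : {Q | Q ∈ S ∧ Q ⊆ P}, volume (Q : Set (Rd d)) ≤ 2 * volume P := by
  have hcount : S.Countable := (countable_dyadicSystem α).mono hS
  -- Removing the smaller members from Q leaves at least half of Q, and the remainders are pairwise
  -- disjoint.
  set E : Set (Rd d) → Set (Rd d) := fun Q => Q \ ⋃ Q' ∈ {Q' | Q' ∈ S ∧ Q' ⊂ Q}, Q' with hE
  have hUm : ∀ Q, MeasurableSet (⋃ Q' ∈ {Q' | Q' ∈ S ∧ Q' ⊂ Q}, Q') := fun Q =>
    MeasurableSet.biUnion (hcount.mono fun _ h => h.1)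
      fun Q' h => measurableSet_of_mem_dyadicSystem (hS h.1)
  have hEm : ∀ Q ∈ S, MeasurableSet (E Q) := fun Q hQ =>
    (measurableSet_of_mem_dyadicSystem (hS hQ)).diff (hUm Q)
  have hvol : ∀ Q ∈ S, volume Q ≤ 2 * volume (E Q) := by
    intro Q hQ
    have h1 := hsp Q hQ
    have h2 : volume Q ≤ volume (⋃ Q' ∈ {Q' | Q' ∈ S ∧ Q' ⊂ Q}, Q') + volume (E Q) :=
      (measure_mono (by rw [hE]; simp)).trans (measure_union_le _ _)
    have h3 : volume Q ≤ 1 / 2 * volume Q + volume (E Q) :=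
      h2.trans (add_le_add_left h1 _)
    have hfin := volume_ne_top_of_mem_dyadicSystem (hS hQ)
    have h4 : 2 * volume Q ≤ volume Q + 2 * volume (E Q) := by
      calc 2 * volume Q ≤ 2 * (1 / 2 * volume Q + volume (E Q)) := by gcongr
        _ = _ := by
          rw [mul_add, ← mul_assoc, one_div, ENNReal.mul_inv_cancel (by simp) (by simp), one_mul]
    rw [two_mul] at h4
    exact (ENNReal.add_le_add_iff_left hfin).1 h4
  have hdisj : ∀ Q ∈ S, ∀ R ∈ S, Q ≠ R → Disjoint (E Q) (E R) := by
    have aux : ∀ Q ∈ S, ∀ R ∈ S, Q ⊂ R → Disjoint (E Q) (E R) := by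
      intro Q hQ R hR h
      refine Set.disjoint_left.2 fun x hxQ hxR => hxR.2 ?_
      exact Set.mem_biUnion (show Q ∈ {Q' | Q' ∈ S ∧ Q' ⊂ R} from ⟨hQ, h⟩) hxQ.1
    intro Q hQ R hR hne
    rcases dyadicSystem_nested (hS hQ) (hS hR) with h | h | h
    · exact aux Q hQ R hR (h.ssubset_of_ne hne)
    · exact (aux R hR Q hQ (h.ssubset_of_ne hne.symm)).symm
    · exact h.mono sdiff_subset sdiff_subset
  have : Countable {Q | Q ∈ S ∧ Q ⊆ P} := (hcount.mono fun _ h => h.1).to_subtype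
  calc ∑' Q : {Q | Q ∈ S ∧ Q ⊆ P}, volume (Q : Set (Rd d))
      ≤ ∑' Q : {Q | Q ∈ S ∧ Q ⊆ P}, 2 * volume (E Q) :=
        ENNReal.tsum_le_tsum fun Q => hvol Q Q.2.1
    _ = 2 * volume (⋃ Q : {Q | Q ∈ S ∧ Q ⊆ P}, E Q) := by
        rw [ENNReal.tsum_mul_left, measure_iUnion]
        · intro Q R hne
          exact hdisj Q Q.2.1 R R.2.1 (fun h => hne (Subtype.ext h))
        · exact fun Q => hEm Q Q.2.1
    _ ≤ 2 * volume P := by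
        gcongr
        exact Set.iUnion_subset fun Q => sdiff_subset.trans Q.2.2

/-- A lower bound for the averages over the members of a family of cubes passes to the union. -/
theorem IsForest.mul_volume_biUnion_le (hF : IsForest S) (hS : S ⊆ dyadicSystem α)
    {U : Set (Set (Rd d))} (hU : U ⊆ S) (c : ℝ≥0∞) (g : Rd d → ℝ≥0∞)
    (h : ∀ Q ∈ U, c * volume Q ≤ ∫⁻ y in Q, g y) :
    c * volume (⋃ Q ∈ U, Q) ≤ ∫⁻ y in ⋃ Q ∈ U, Q, g y := by
  set V := {Q | Q ∈ U ∧ ∀ R ∈ U, ¬ Q ⊂ R}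
  have hVU : ⋃ Q ∈ U, Q = ⋃ Q ∈ V, Q := by
    refine subset_antisymm (Set.iUnion₂_subset fun Q hQ => ?_)
      (Set.biUnion_subset_biUnion_left fun Q hQ => hQ.1)
    obtain ⟨P, hP, hQP, hmax⟩ := hF.exists_maximal hU hQ
    exact hQP.trans (Set.subset_biUnion_of_mem (u := fun Q => Q) (show P ∈ V from ⟨hP, hmax⟩))
  have hVS : V ⊆ S := fun Q hQ => hU hQ.1
  have hcount : V.Countable := (countable_dyadicSystem α).mono (hVS.trans hS)
  have hdisj : V.PairwiseDisjoint fun Q => Q := by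
    intro Q hQ R hR hne
    rcases hF.nested Q (hVS hQ) R (hVS hR) with h | h | h
    · exact absurd (h.ssubset_of_ne hne) (hQ.2 R hR.1)
    · exact absurd (h.ssubset_of_ne hne.symm) (hR.2 Q hQ.1)
    · exact h
  have hm : ∀ Q ∈ V, MeasurableSet Q := fun Q hQ =>
    measurableSet_of_mem_dyadicSystem (hS (hVS hQ))
  rw [hVU, measure_biUnion hcount hdisj hm, lintegral_biUnion hcount hm hdisj,
    ← ENNReal.tsum_mul_left]
  exact ENNReal.tsum_le_tsum fun Q => h Q Q.2.1

/-- Mean value of the modulus of `f` over `Q`. -/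
def meanNorm (f : Rd d → ℂ) (Q : Set (Rd d)) : ℝ≥0∞ :=
  (volume Q)⁻¹ * ∫⁻ y in Q, ‖f y‖ₑ

theorem meanNorm_mul_volume {Q : Set (Rd d)} (hQ : Q ∈ dyadicSystem α) (f : Rd d → ℂ) :
    meanNorm f Q * volume Q = ∫⁻ y in Q, ‖f y‖ₑ := by
  rw [meanNorm, mul_comm, ← mul_assoc, ENNReal.mul_inv_cancel (volume_pos_of_mem_dyadicSystem hQ)
    (volume_ne_top_of_mem_dyadicSystem hQ), one_mul]

theorem meanNorm_ne_top {Q : Set (Rd d)} (hQ : Q ∈ dyadicSystem α) {f : Rd d → ℂ}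
    (hf : Integrable f) : meanNorm f Q ≠ ∞ := by
  refine ENNReal.mul_ne_top (ENNReal.inv_ne_top.2 (volume_pos_of_mem_dyadicSystem hQ)) ?_
  exact ((setLIntegral_le_lintegral _ _).trans_lt hf.2).ne

/-- Chebyshev's inequality over the maximal stopping cubes. The factor 4 gives 1/4 rather than 1/2,
which leaves room for a second stopping condition. -/
theorem volume_mean_stopping_le (hF : IsForest S) (hS : S ⊆ dyadicSystem α) {f : Rd d → ℂ}
    (hf : Integrable f) {P : Set (Rd d)} (hP : P ∈ S) :
    volume (⋃ Q ∈ {Q | Q ∈ S ∧ Q ⊂ P ∧ 4 * meanNorm f P < meanNorm f Q}, Q) ≤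
      (1 / 4 : ℝ≥0∞) * volume P := by
  set U := {Q | Q ∈ S ∧ Q ⊂ P ∧ 4 * meanNorm f P < meanNorm f Q}
  have hsub : ⋃ Q ∈ U, Q ⊆ P := Set.iUnion₂_subset fun Q hQ => hQ.2.1.subset
  have h1 : 4 * meanNorm f P * volume (⋃ Q ∈ U, Q) ≤ meanNorm f P * volume P := by
    rw [meanNorm_mul_volume (hS hP)]
    refine (hF.mul_volume_biUnion_le hS (fun Q hQ => hQ.1) _ (fun y => ‖f y‖ₑ) ?_).trans
      (lintegral_mono_set hsub)
    intro Q hQ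
    rw [← meanNorm_mul_volume (hS hQ.1)]
    gcongr
    exact hQ.2.2.le
  -- A zero mean cannot be cancelled, but then all means inside P vanish and the strict inequality
  -- selects nothing.
  by_cases h0 : meanNorm f P = 0
  · have hU : U = ∅ := by
      refine Set.eq_empty_of_forall_notMem fun Q hQ => ?_
      have hz : ∫⁻ y in Q, ‖f y‖ₑ = 0 := by
        refine le_antisymm ((lintegral_mono_set hQ.2.1.subset).trans ?_) bot_le
        rw [← meanNorm_mul_volume (hS hP), h0, zero_mul]
      have hzero : meanNorm f Q = 0 := by rw [meanNorm, hz, mul_zero]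
      exact not_lt_bot (hzero ▸ hQ.2.2)
    rw [hU]; simp
  · have hfin := meanNorm_ne_top (hS hP) hf
    rw [mul_comm 4, mul_assoc, ENNReal.mul_le_mul_iff_right h0 hfin] at h1
    calc volume (⋃ Q ∈ U, Q) = 1 / 4 * (4 * volume (⋃ Q ∈ U, Q)) := by
          rw [← mul_assoc, one_div, ENNReal.inv_mul_cancel (by simp) (by simp), one_mul]
      _ ≤ _ := by gcongr

/-- On a cube with N members between it and P (both ends included) the counting function of the
members below P is at least N, while the Carleson condition bounds its integral by C|P|. Markov's
inequality concludes. -/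
theorem volume_count_stopping_le (hF : IsForest S) (hS : S ⊆ dyadicSystem α) {N : ℕ} {C : ℝ≥0∞}
    (hN0 : 0 < N) (hN : 4 * C ≤ N) {P : Set (Rd d)}
    (hC : ∑' Q : {Q | Q ∈ S ∧ Q ⊆ P}, volume (Q : Set (Rd d)) ≤ C * volume P) :
    volume (⋃ Q ∈ {Q | Q ∈ S ∧ Q ⊂ P ∧ N ≤ {R | R ∈ S ∧ Q ⊆ R ∧ R ⊆ P}.ncard}, Q) ≤
      (1 / 4 : ℝ≥0∞) * volume P := by
  set I := {Q | Q ∈ S ∧ Q ⊆ P}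
  have : Countable I := ((countable_dyadicSystem α).mono fun _ h => hS h.1).to_subtype
  have hIm : ∀ R : I, MeasurableSet (R : Set (Rd d)) := fun R =>
    measurableSet_of_mem_dyadicSystem (hS R.2.1)
  set F : Rd d → ℝ≥0∞ := fun x => ∑' R : I, (R : Set (Rd d)).indicator 1 x
  have hFm : Measurable F :=
    Measurable.tsum fun R => measurable_one.indicator (hIm R)
  have hint : ∫⁻ x, F x ≤ C * volume P := by
    rw [lintegral_tsum fun R => (measurable_one.indicator (hIm R)).aemeasurable]
    refine le_trans (le_of_eq ?_) hC
    congr 1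
    funext R
    rw [lintegral_indicator_one (hIm R)]
  have hsub : (⋃ Q ∈ {Q | Q ∈ S ∧ Q ⊂ P ∧ N ≤ {R | R ∈ S ∧ Q ⊆ R ∧ R ⊆ P}.ncard}, Q) ⊆
      {x | (N : ℝ≥0∞) ≤ F x} := by
    refine Set.iUnion₂_subset fun Q hQ x hx => ?_
    obtain ⟨hQS, hQP, hQN⟩ := hQ
    have hfin : {R | R ∈ S ∧ Q ⊆ R ∧ R ⊆ P}.Finite :=
      (hF.finite Q hQS).subset fun R hR => ⟨hR.1, hR.2.1⟩
    rw [Set.ncard_eq_toFinset_card _ hfin] at hQN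
    classical
    set t : Finset I := hfin.toFinset.subtype (fun R => R ∈ I)
    have ht : t.card = hfin.toFinset.card := by
      rw [Finset.card_subtype, Finset.filter_true_of_mem]
      intro R hR
      have := hfin.mem_toFinset.1 hR
      exact ⟨this.1, this.2.2⟩
    calc (N : ℝ≥0∞) ≤ (t.card : ℝ≥0∞) := by rw [ht]; exact_mod_cast hQN
      _ = ∑ R ∈ t, (R : Set (Rd d)).indicator 1 x := by
          rw [Finset.card_eq_sum_ones, Nat.cast_sum]
          refine Finset.sum_congr rfl fun R hR => ?_
          have := hfin.mem_toFinset.1 (Finset.mem_subtype.1 hR)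
          rw [Set.indicator_of_mem (this.2.1 hx)]
          simp
      _ ≤ F x := ENNReal.sum_le_tsum t
  have hmark := (mul_meas_ge_le_lintegral hFm (N : ℝ≥0∞)).trans hint
  have hN0' : (N : ℝ≥0∞) ≠ 0 := by exact_mod_cast hN0.ne'
  refine (measure_mono hsub).trans ?_
  rw [← ENNReal.mul_le_mul_iff_right hN0' (ENNReal.natCast_ne_top N)]
  refine hmark.trans ?_
  rw [← mul_assoc]
  gcongr
  calc C = 4 * C * (1 / 4) := by
        rw [mul_comm 4 C, mul_assoc, one_div, ENNReal.mul_inv_cancel (by simp) (by simp), mul_one]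
    _ ≤ N * (1 / 4) := by gcongr

theorem sparseOperator_eq (S : Set (Set (Rd d))) (f : Rd d → ℂ) (x : Rd d) :
    sparseOperator S f x = ∑' Q : S, (Q : Set (Rd d)).indicator (fun _ => meanNorm f Q) x := rfl

/-- The sparse operator of a Carleson collection is dominated by that of a sparse subcollection. -/
theorem exists_isSparse_sparseOperator_le (hd : 0 < d) {C : ℝ≥0∞} (hC : C ≠ ∞) :
    ∃ N : ℕ, ∀ (α : Fin d → Fin 3) (S : Set (Set (Rd d))), S ⊆ dyadicSystem α → IsForest S →
      (∀ P ∈ S, ∑' Q : {Q | Q ∈ S ∧ Q ⊆ P}, volume (Q : Set (Rd d)) ≤ C * volume P) →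
      ∀ f : Rd d → ℂ, Integrable f → ∃ S' ⊆ S, IsSparse S' ∧
        ∀ x, sparseOperator S f x ≤ N * sparseOperator S' f x := by
  obtain ⟨N₀, hN₀⟩ := exists_nat_gt (4 * C).toReal
  have hN : 4 * C ≤ (N₀ + 1 : ℕ) := by
    rw [← ENNReal.ofReal_toReal (ENNReal.mul_ne_top (by simp) hC), ← ENNReal.ofReal_natCast]
    refine ENNReal.ofReal_le_ofReal ?_
    push_cast; linarith
  set N := N₀ + 1
  have hN0 : 0 < N := Nat.succ_pos _
  refine ⟨N * 4, fun α S hS hF hCar f hf => ?_⟩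
  -- A new cube is selected when the mean has more than quadrupled or when N members have been
  -- passed. Between selections the means are thus controlled and there are few cubes through any
  -- point.
  set bad : Set (Rd d) → Set (Rd d) → Prop := fun P Q => 4 * meanNorm f P < meanNorm f Q ∨
    N ≤ {R | R ∈ S ∧ Q ⊆ R ∧ R ⊆ P}.ncard with hbad
  set S' := {Q | Selected S bad Q} with hS'
  refine ⟨S', fun Q hQ => Selected.mem hQ, isSparse_selected hF fun P hP => ?_, fun x => ?_⟩
  · have hsub : (⋃ Q ∈ {Q | Q ∈ S ∧ Q ⊂ P ∧ bad P Q}, Q) ⊆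
        (⋃ Q ∈ {Q | Q ∈ S ∧ Q ⊂ P ∧ 4 * meanNorm f P < meanNorm f Q}, Q) ∪
        (⋃ Q ∈ {Q | Q ∈ S ∧ Q ⊂ P ∧ N ≤ {R | R ∈ S ∧ Q ⊆ R ∧ R ⊆ P}.ncard}, Q) := by
      refine Set.iUnion₂_subset fun Q hQ => ?_
      rcases hQ.2.2 with h | h
      · exact (Set.subset_biUnion_of_mem (u := fun Q => Q) (show Q ∈ {Q | Q ∈ S ∧ Q ⊂ P ∧
          4 * meanNorm f P < meanNorm f Q} from ⟨hQ.1, hQ.2.1, h⟩)).trans Set.subset_union_left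
      · exact (Set.subset_biUnion_of_mem (u := fun Q => Q) (show Q ∈ {Q | Q ∈ S ∧ Q ⊂ P ∧
          N ≤ {R | R ∈ S ∧ Q ⊆ R ∧ R ⊆ P}.ncard} from ⟨hQ.1, hQ.2.1, h⟩)).trans
          Set.subset_union_right
    refine (measure_mono hsub).trans ((measure_union_le _ _).trans ?_)
    refine (add_le_add (volume_mean_stopping_le hF hS hf hP.mem)
      (volume_count_stopping_le hF hS hN0 hN (hCar P hP.mem))).trans (le_of_eq ?_)
    rw [← add_mul]
    congr 1
    rw [← ENNReal.toReal_eq_toReal_iff' (by simp) (by simp), ENNReal.toReal_add (by simp) (by simp)]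
    norm_num
  · have hpar : ∀ R : S, ∃ P : S', (R : Set (Rd d)) ⊆ P ∧
        ((R : Set (Rd d)) ⊂ P → ¬ bad P R) := fun R => by
      obtain ⟨P, hP, h⟩ := hF.exists_selected_parent bad R.2
      exact ⟨⟨P, hP⟩, h⟩
    -- The sum over S is grouped by the smallest selected cube above each member.
    choose π hπ hπ' using hpar
    rw [sparseOperator_eq, sparseOperator_eq, ← ENNReal.tsum_mul_left,
      ← ENNReal.tsum_fiberwise _ π]
    refine ENNReal.tsum_le_tsum fun P => ?_
    rw [ENNReal.tsum_eq_iSup_sum]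
    refine iSup_le fun s => ?_
    classical
    set t := s.filter fun R : π ⁻¹' {P} => x ∈ R.1.1 with ht
    have hst : ∑ R ∈ s, R.1.1.indicator (fun _ => meanNorm f R.1.1) x =
        ∑ R ∈ t, meanNorm f R.1.1 := by
      rw [ht, Finset.sum_filter]
      refine Finset.sum_congr rfl fun R _ => ?_
      rw [Set.indicator_apply]
    rw [hst]
    rcases t.eq_empty_or_nonempty with h0 | hne
    · rw [h0]; simp
    have hRP : ∀ R ∈ t, R.1.1 ⊆ (P : Set (Rd d)) := fun R _ => by
      have := hπ R.1
      rwa [show π R.1 = P from R.2] at this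
    have hRb : ∀ R ∈ t, R.1.1 ⊂ (P : Set (Rd d)) → ¬ bad P R.1.1 :=
      fun R _ => by
        have := hπ' R.1
        rwa [show π R.1 = P from R.2] at this
    have hxR : ∀ R ∈ t, x ∈ R.1.1 := fun R hR => (Finset.mem_filter.1 hR).2
    -- The members of the group through x form a chain. Its smallest element is not bad for P unless
    -- it equals P, which bounds the length of the chain by N.
    obtain ⟨R₀, hR₀, hmin⟩ := t.exists_min_image (fun R : π ⁻¹' {P} => volume (R.1.1 : Set (Rd d))) hne
    have hR₀sub : ∀ R ∈ t, R₀.1.1 ⊆ R.1.1 := by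
      intro R hR
      rcases hF.comparable R₀.1.2 R.1.2 (hxR _ hR₀) (hxR _ hR) with h | h
      · exact h
      · exact (eq_of_mem_of_volume_eq hd (hS R₀.1.2) (hS R.1.2) (hxR _ hR₀) (hxR _ hR)
          (le_antisymm (hmin R hR) (measure_mono h))).subset
    have hcard : t.card ≤ N := by
      have himg : (t.image fun R : π ⁻¹' {P} => R.1.1).card = t.card :=
        Finset.card_image_of_injective _ fun R R' h => Subtype.ext (Subtype.ext h)
      rw [← himg]
      by_cases h : R₀.1.1 = P
      · refine le_trans (Finset.card_le_card (t := {(P : Set (Rd d))}) ?_)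
          (by rw [Finset.card_singleton]; exact hN0)
        intro Q hQ
        obtain ⟨R, hR, rfl⟩ := Finset.mem_image.1 hQ
        exact Finset.mem_singleton.2 ((hRP R hR).antisymm (h ▸ hR₀sub R hR))
      · have hb := hRb R₀ hR₀ ((hRP R₀ hR₀).ssubset_of_ne h)
        have hlt : {R | R ∈ S ∧ R₀.1.1 ⊆ R ∧ R ⊆ P}.ncard < N := by
          by_contra! hcon
          exact hb (Or.inr hcon)
        have hfin : {R | R ∈ S ∧ R₀.1.1 ⊆ R ∧ R ⊆ P}.Finite :=
          (hF.finite _ R₀.1.2).subset fun R hR => ⟨hR.1, hR.2.1⟩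
        refine le_trans ?_ hlt.le
        rw [Set.ncard_eq_toFinset_card _ hfin]
        refine Finset.card_le_card fun Q hQ => ?_
        obtain ⟨R, hR, rfl⟩ := Finset.mem_image.1 hQ
        exact hfin.mem_toFinset.2 ⟨R.1.2, hR₀sub R hR, hRP R hR⟩
    have hle : ∀ R ∈ t, meanNorm f R.1.1 ≤ 4 * meanNorm f P := by
      intro R hR
      by_cases h : R.1.1 = P
      · rw [h]
        exact le_mul_of_one_le_left' (by norm_num)
      · by_contra! hcon
        exact hRb R hR ((hRP R hR).ssubset_of_ne h) (Or.inl hcon)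
    have hxP : x ∈ (P : Set (Rd d)) := hRP R₀ hR₀ (hxR R₀ hR₀)
    rw [Set.indicator_of_mem hxP]
    calc ∑ R ∈ t, meanNorm f R.1.1 ≤ t.card • (4 * meanNorm f P) :=
          Finset.sum_le_card_nsmul _ _ _ hle
      _ ≤ N • (4 * meanNorm f P) := by gcongr
      _ = _ := by rw [nsmul_eq_mul]; push_cast; ring

end

noncomputable section

/-! ### The Hardy–Littlewood maximal function -/

/-- The centred maximal function, normalized by `r ^ d` rather than by the volume of the ball. -/
def maximalFn {d : ℕ} (g : Rd d → ℝ≥0∞) (x : Rd d) : ℝ≥0∞ :=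
  ⨆ (r : ℝ) (_ : 0 < r), (∫⁻ y in Metric.ball x r, g y) / ENNReal.ofReal (r ^ d)

/-- The volume of the unit ball. -/
def unitBallVolume (d : ℕ) : ℝ≥0∞ := volume (Metric.ball (0 : Rd d) 1)

variable {d : ℕ}

theorem unitBallVolume_ne_top : unitBallVolume d ≠ ∞ := measure_ball_lt_top.ne

theorem unitBallVolume_ne_zero : unitBallVolume d ≠ 0 :=
  (Metric.measure_ball_pos _ _ one_pos).ne'

theorem volume_ball_eq (x : Rd d) {r : ℝ} (hr : 0 < r) :
    volume (Metric.ball x r) = ENNReal.ofReal (r ^ d) * unitBallVolume d := by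
  rw [Measure.addHaar_ball_of_pos _ _ hr, finrank_euclideanSpace_fin, unitBallVolume]

theorem setLIntegral_ball_le (g : Rd d → ℝ≥0∞) (x : Rd d) {r : ℝ} (hr : 0 < r) :
    ∫⁻ y in Metric.ball x r, g y ≤ ENNReal.ofReal (r ^ d) * maximalFn g x := by
  have h0 : ENNReal.ofReal (r ^ d) ≠ 0 := by
    simp only [ne_eq, ENNReal.ofReal_eq_zero, not_le]; positivity
  have h : (∫⁻ y in Metric.ball x r, g y) / ENNReal.ofReal (r ^ d) ≤ maximalFn g x :=
    le_iSup₂ (f := fun (r : ℝ) (_ : 0 < r) =>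
      (∫⁻ y in Metric.ball x r, g y) / ENNReal.ofReal (r ^ d)) r hr
  rwa [ENNReal.div_le_iff h0 ENNReal.ofReal_ne_top, mul_comm] at h

theorem setLIntegral_le_maximalFn (g : Rd d → ℝ≥0∞) {x : Rd d} {s : Set (Rd d)} {r : ℝ}
    (hr : 0 < r) (hs : s ⊆ Metric.ball x r) :
    ∫⁻ y in s, g y ≤ ENNReal.ofReal (r ^ d) * maximalFn g x :=
  (lintegral_mono_set hs).trans (setLIntegral_ball_le g x hr)

theorem lt_maximalFn_iff {g : Rd d → ℝ≥0∞} {x : Rd d} {t : ℝ≥0∞} :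
    t < maximalFn g x ↔ ∃ r : ℝ, 0 < r ∧
      t * ENNReal.ofReal (r ^ d) < ∫⁻ y in Metric.ball x r, g y := by
  simp only [maximalFn, lt_iSup_iff, exists_prop]
  refine exists_congr fun r => and_congr_right fun hr => ?_
  have h0 : ENNReal.ofReal (r ^ d) ≠ 0 := by
    simp only [ne_eq, ENNReal.ofReal_eq_zero, not_le]; positivity
  rw [ENNReal.lt_div_iff_mul_lt (Or.inl h0) (Or.inl ENNReal.ofReal_ne_top)]

/-- The strict inequality on a ball leaves room to enlarge its radius slightly, and the enlarged
balls about nearby centres contain the original ball. -/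
theorem isOpen_lt_maximalFn (g : Rd d → ℝ≥0∞) (t : ℝ≥0∞) : IsOpen {x | t < maximalFn g x} := by
  rw [Metric.isOpen_iff]
  intro x hx
  obtain ⟨r, hr, h⟩ := lt_maximalFn_iff.1 hx
  have hlim : Filter.Tendsto (fun s : ℝ => t * ENNReal.ofReal (s ^ d)) (nhds r)
      (nhds (t * ENNReal.ofReal (r ^ d))) := by
    refine ENNReal.Tendsto.const_mul ?_ (Or.inl ?_)
    · exact (ENNReal.continuous_ofReal.comp (continuous_pow d)).tendsto r
    · simp only [ne_eq, ENNReal.ofReal_eq_zero, not_le]; positivity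
  obtain ⟨δ, hδ, hδ'⟩ := Metric.eventually_nhds_iff.1 (hlim.eventually_lt_const h)
  refine ⟨δ / 2, by positivity, fun z hz => lt_maximalFn_iff.2 ⟨r + δ / 2, by positivity, ?_⟩⟩
  refine (hδ' (y := r + δ / 2) ?_).trans_le (lintegral_mono_set (Metric.ball_subset_ball' ?_))
  · rw [Real.dist_eq, add_sub_cancel_left, abs_of_pos (by positivity)]; linarith
  · rw [dist_comm]
    rw [Metric.mem_ball] at hz
    linarith

theorem maximalFn_le_of_ae_le {g : Rd d → ℝ≥0∞} {t : ℝ≥0∞} (h : ∀ᵐ y, g y ≤ t) (x : Rd d) :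
    maximalFn g x ≤ unitBallVolume d * t := by
  refine iSup₂_le fun r hr => ENNReal.div_le_of_le_mul ?_
  calc ∫⁻ y in Metric.ball x r, g y ≤ ∫⁻ _ in Metric.ball x r, t :=
        lintegral_mono_ae (ae_restrict_of_ae h)
    _ = _ := by rw [setLIntegral_const, volume_ball_eq x hr]; ring

/-- The weak (1,1) inequality, by Vitali covering: fourfold enlargements of disjoint balls cover the
level set. -/
theorem exists_mul_volume_maximalFn_le (hd : 0 < d) : ∃ C : ℝ≥0, ∀ (g : Rd d → ℝ≥0∞) (t : ℝ≥0∞),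
    t * volume {x | t < maximalFn g x} ≤ C * ∫⁻ y, g y := by
  refine ⟨(4 ^ d * unitBallVolume d).toNNReal, fun g t => ?_⟩
  have hC : 4 ^ d * unitBallVolume d ≠ ∞ :=
    ENNReal.mul_ne_top (by simp) unitBallVolume_ne_top
  rw [ENNReal.coe_toNNReal hC]
  rcases eq_or_ne t 0 with rfl | ht0
  · simp
  rcases eq_or_ne t ∞ with rfl | htt
  · simp
  rcases eq_or_ne (∫⁻ y, g y) ∞ with hg | hg
  · rw [hg, ENNReal.mul_top (mul_ne_zero (by simp) unitBallVolume_ne_zero)]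
    exact le_top
  set T : Set (Rd d × ℝ) := {p | 0 < p.2 ∧
    t * ENNReal.ofReal (p.2 ^ d) < ∫⁻ y in Metric.ball p.1 p.2, g y} with hT
  -- Vitali's lemma needs bounded radii; they are bounded since t r^d is at most the total mass and
  -- r ≤ r^d for r ≥ 1.
  have hbound : ∀ p ∈ T, p.2 ≤ max 1 ((∫⁻ y, g y) / t).toReal := by
    rintro ⟨x, r⟩ ⟨hr, h⟩
    by_contra! hcon
    obtain ⟨h1, h2⟩ := max_lt_iff.1 hcon
    have h3 : t * ENNReal.ofReal (r ^ d) ≤ ∫⁻ y, g y :=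
      h.le.trans (setLIntegral_le_lintegral _ _)
    rw [mul_comm, ← ENNReal.le_div_iff_mul_le (Or.inl ht0) (Or.inl htt),
      ENNReal.ofReal_le_iff_le_toReal (ENNReal.div_ne_top hg ht0)] at h3
    have h4 : r ≤ r ^ d := le_self_pow₀ h1.le hd.ne'
    linarith
  obtain ⟨u, huT, hdisj, hcov⟩ := Vitali.exists_disjoint_subfamily_covering_enlargement_ball
    T Prod.fst Prod.snd _ hbound 4 (by norm_num)
  have hcount : u.Countable := hdisj.countable_of_isOpen (fun _ _ => Metric.isOpen_ball)
    fun p hp => Metric.nonempty_ball.2 (huT hp).1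
  have : Countable u := hcount.to_subtype
  have hsub : {x | t < maximalFn g x} ⊆ ⋃ p : u, Metric.ball (p : Rd d × ℝ).1 (4 * p.1.2) := by
    intro x hx
    obtain ⟨r, hr, h⟩ := lt_maximalFn_iff.1 hx
    obtain ⟨p, hp, hsub⟩ := hcov (x, r) ⟨hr, h⟩
    exact Set.mem_iUnion.2 ⟨⟨p, hp⟩, hsub (Metric.mem_ball_self hr)⟩
  calc t * volume {x | t < maximalFn g x}
      ≤ t * ∑' p : u, volume (Metric.ball (p : Rd d × ℝ).1 (4 * p.1.2)) := by
        gcongr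
        exact (measure_mono hsub).trans (measure_iUnion_le _)
    _ = 4 ^ d * unitBallVolume d * ∑' p : u, t * ENNReal.ofReal (p.1.2 ^ d) := by
        rw [← ENNReal.tsum_mul_left, ← ENNReal.tsum_mul_left]
        refine tsum_congr fun p => ?_
        have hp := (huT p.2).1
        rw [volume_ball_eq _ (by positivity), mul_pow, ENNReal.ofReal_mul (by positivity),
          ENNReal.ofReal_pow (by norm_num), ENNReal.ofReal_ofNat]
        ring
    _ ≤ 4 ^ d * unitBallVolume d * ∑' p : u, ∫⁻ y in Metric.ball (p : Rd d × ℝ).1 p.1.2, g y := by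
        gcongr with p
        exact (huT p.2).2.le
    _ = 4 ^ d * unitBallVolume d *
          ∫⁻ y in ⋃ p : u, Metric.ball (p : Rd d × ℝ).1 p.1.2, g y := by
        rw [lintegral_iUnion (fun _ => Metric.isOpen_ball.measurableSet)]
        intro p q hne
        exact hdisj p.2 q.2 fun h => hne (Subtype.ext h)
    _ ≤ _ := by gcongr; exact Measure.restrict_le_self

/-- Lebesgue differentiation along closed balls; the factor 2^d comes from placing each of them in
the open ball of twice the radius. -/
theorem exists_ae_le_mul_maximalFn (d : ℕ) : ∃ C : ℝ≥0, ∀ g : Rd d → ℝ≥0∞, AEMeasurable g →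
    ∫⁻ y, g y ≠ ∞ → ∀ᵐ x, g x ≤ C * maximalFn g x := by
  have hC : 2 ^ d / unitBallVolume d ≠ ∞ := ENNReal.div_ne_top (by simp) unitBallVolume_ne_zero
  refine ⟨(2 ^ d / unitBallVolume d).toNNReal, fun g hg hfin => ?_⟩
  rw [ENNReal.coe_toNNReal hC]
  filter_upwards [(Besicovitch.vitaliFamily (volume : Measure (Rd d))).ae_tendsto_lintegral_div hg
    hfin] with x hx
  have hlim := hx.comp (Besicovitch.tendsto_filterAt volume x)
  refine le_of_tendsto hlim ?_
  filter_upwards [self_mem_nhdsWithin] with r hr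
  have hr : (0 : ℝ) < r := hr
  rw [Function.comp_apply]
  have hr0 : ENNReal.ofReal (r ^ d) ≠ 0 := by
    simp only [ne_eq, ENNReal.ofReal_eq_zero, not_le]; positivity
  have hpos : volume (Metric.closedBall x r) ≠ 0 := (Metric.measure_closedBall_pos _ _ hr).ne'
  rw [ENNReal.div_le_iff hpos measure_closedBall_lt_top.ne]
  have h1 : ENNReal.ofReal (r ^ d) * unitBallVolume d ≤ volume (Metric.closedBall x r) := by
    rw [← volume_ball_eq x hr]; exact measure_mono Metric.ball_subset_closedBall
  calc ∫⁻ y in Metric.closedBall x r, g y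
      ≤ ENNReal.ofReal ((2 * r) ^ d) * maximalFn g x :=
        setLIntegral_le_maximalFn g (by positivity)
          (Metric.closedBall_subset_ball (by linarith))
    _ = 2 ^ d / unitBallVolume d * maximalFn g x *
          (ENNReal.ofReal (r ^ d) * unitBallVolume d) := by
        rw [mul_pow, ENNReal.ofReal_mul (by positivity), ENNReal.ofReal_pow (by norm_num),
          ENNReal.ofReal_ofNat]
        rw [show 2 ^ d / unitBallVolume d * maximalFn g x *
          (ENNReal.ofReal (r ^ d) * unitBallVolume d) = (2 ^ d / unitBallVolume d *
          unitBallVolume d) * ENNReal.ofReal (r ^ d) * maximalFn g x by ring,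
          ENNReal.div_mul_cancel unitBallVolume_ne_zero unitBallVolume_ne_top]
    _ ≤ _ := by gcongr

end

noncomputable section

/-! ### Calderón–Zygmund kernels -/

/-- The bound for the oscillation of the kernel at distance `ρ` around `x`, seen from `y`. -/
def modulusWeight {d : ℕ} (ω : ℝ → ℝ) (ρ : ℝ) (x y : Rd d) : ℝ≥0∞ :=
  ENNReal.ofReal (ω (ρ / ‖x - y‖) * (1 / ‖x - y‖ ^ d))

variable {d : ℕ} {ω : ℝ → ℝ} {CK : ℝ} {K : Rd d → Rd d → ℂ}
  {T : Lp ℂ 2 (volume : Measure (Rd d)) →L[ℂ] Lp ℂ 2 (volume : Measure (Rd d))}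

/-- On the interval from 2^(-n-1) to 2^(-n) the integrand is at least ω(2^(-n-1)) / 2^(-n), and the
interval has length half of 2^(-n); hence the factor 2. -/
theorem tsum_modulus_le (hω : IsModulusOfContinuity ω) :
    ∑' n : ℕ, ENNReal.ofReal (ω ((1 / 2) ^ (n + 1))) ≤ 2 * diniNorm ω := by
  set I : ℕ → Set ℝ := fun n => Ioo ((1 / 2 : ℝ) ^ (n + 1)) ((1 / 2) ^ n)
  have hdisj : Pairwise (Function.onFun Disjoint I) := by
    have aux : ∀ m n : ℕ, m < n → Disjoint (I m) (I n) := by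
      intro m n h
      refine Set.disjoint_left.2 fun t ht ht' => ?_
      have : (1 / 2 : ℝ) ^ n ≤ (1 / 2) ^ (m + 1) :=
        pow_le_pow_of_le_one (by norm_num) (by norm_num) h
      linarith [ht.1, ht'.2]
    intro m n h
    rcases lt_or_gt_of_ne h with h | h
    · exact aux m n h
    · exact (aux n m h).symm
  have hsub : ⋃ n, I n ⊆ Ioo 0 1 := by
    refine Set.iUnion_subset fun n t ht => ⟨lt_trans (by positivity) ht.1, ht.2.trans_le ?_⟩
    exact pow_le_one₀ (by norm_num) (by norm_num)
  have hI : ∀ n, ENNReal.ofReal (ω ((1 / 2) ^ (n + 1))) ≤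
      2 * ∫⁻ t in I n, ENNReal.ofReal (ω t / t) := by
    intro n
    have h0 : (0 : ℝ) < (1 / 2) ^ n := by positivity
    have hω0 : 0 ≤ ω ((1 / 2) ^ (n + 1)) := hω.nonneg _ (by positivity)
    calc ENNReal.ofReal (ω ((1 / 2) ^ (n + 1)))
        = 2 * (ENNReal.ofReal (ω ((1 / 2) ^ (n + 1)) / (1 / 2) ^ n) * volume (I n)) := by
          rw [Real.volume_Ioo, ← ENNReal.ofReal_mul (by positivity), ← ENNReal.ofReal_ofNat 2,
            ← ENNReal.ofReal_mul (by norm_num)]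
          congr 1
          rw [pow_succ]
          field_simp
          ring
      _ = 2 * ∫⁻ t in I n, ENNReal.ofReal (ω ((1 / 2) ^ (n + 1)) / (1 / 2) ^ n) := by
          rw [setLIntegral_const]
      _ ≤ _ := by
          gcongr 2 * ?_
          refine setLIntegral_mono' measurableSet_Ioo fun t ht => ENNReal.ofReal_le_ofReal ?_
          have ht0 : 0 < t := lt_trans (by positivity) ht.1
          exact div_le_div₀ (hω.nonneg _ ht0.le) (hω.mono _ _ (by positivity) ht.1.le) ht0 ht.2.le
  calc ∑' n : ℕ, ENNReal.ofReal (ω ((1 / 2) ^ (n + 1)))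
      ≤ ∑' n, 2 * ∫⁻ t in I n, ENNReal.ofReal (ω t / t) := ENNReal.tsum_le_tsum hI
    _ = 2 * ∫⁻ t in ⋃ n, I n, ENNReal.ofReal (ω t / t) := by
        rw [ENNReal.tsum_mul_left, lintegral_iUnion (fun _ => measurableSet_Ioo) hdisj]
    _ ≤ _ := by
        gcongr
        exact lintegral_mono_set hsub

/-- Integration of the oscillation bound of the kernel against a function. -/
theorem setLIntegral_modulusWeight_le (hω : IsModulusOfContinuity ω) (x : Rd d) {ρ : ℝ}
    (hρ : 0 < ρ) (g : Rd d → ℝ≥0∞) :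
    ∫⁻ y in {y | 2 * ρ < ‖x - y‖}, modulusWeight ω ρ x y * g y ≤
      2 * 2 ^ d * diniNorm ω * maximalFn g x := by
  -- Dyadic annuli: on the n-th the modulus is at most ω(2^(-n-1)). The annulus lies in a ball of
  -- twice its inner radius, which costs 2^d.
  set I : ℕ → Set (Rd d) := fun n =>
    {y | 2 ^ (n + 1) * ρ ≤ ‖x - y‖} ∩ {y | ‖x - y‖ < 2 ^ (n + 2) * ρ}
  have hmeas : ∀ n, MeasurableSet (I n) := fun n =>
    (measurableSet_le (by fun_prop) (by fun_prop)).inter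
      (measurableSet_lt (by fun_prop) (by fun_prop))
  have hsub : {y | 2 * ρ < ‖x - y‖} ⊆ ⋃ n, I n := by
    intro y hy
    have hy : 2 * ρ < ‖x - y‖ := hy
    have h1 : 2 ≤ ‖x - y‖ / ρ := by rw [le_div_iff₀ hρ]; exact hy.le
    obtain ⟨n, hn, hn'⟩ := exists_nat_pow_near (by linarith : 1 ≤ ‖x - y‖ / ρ) one_lt_two
    rw [le_div_iff₀ hρ] at hn
    rw [div_lt_iff₀ hρ] at hn'
    cases n with
    | zero =>
      rw [zero_add, pow_one] at hn'
      linarith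
    | succ n => exact Set.mem_iUnion.2 ⟨n, hn, hn'⟩
  have hI : ∀ n, ∫⁻ y in I n, modulusWeight ω ρ x y * g y ≤
      ENNReal.ofReal (ω ((1 / 2) ^ (n + 1))) * (2 ^ d * maximalFn g x) := by
    intro n
    have hω0 : 0 ≤ ω ((1 / 2) ^ (n + 1)) := hω.nonneg _ (by positivity)
    calc ∫⁻ y in I n, modulusWeight ω ρ x y * g y
        ≤ ∫⁻ y in I n, ENNReal.ofReal (ω ((1 / 2) ^ (n + 1)) * (1 / (2 ^ (n + 1) * ρ) ^ d)) *
            g y := by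
          refine setLIntegral_mono' (hmeas n) fun y hy => ?_
          have hy1 : 2 ^ (n + 1) * ρ ≤ ‖x - y‖ := hy.1
          have hpos : 0 < ‖x - y‖ := lt_of_lt_of_le (by positivity) hy1
          rw [modulusWeight]
          gcongr
          refine hω.mono _ _ (by positivity) ?_
          rw [div_le_iff₀ hpos, one_div, inv_pow, inv_mul_eq_div, le_div_iff₀ (by positivity)]
          linarith
      _ = ENNReal.ofReal (ω ((1 / 2) ^ (n + 1)) * (1 / (2 ^ (n + 1) * ρ) ^ d)) *
            ∫⁻ y in I n, g y := lintegral_const_mul' _ _ ENNReal.ofReal_ne_top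
      _ ≤ ENNReal.ofReal (ω ((1 / 2) ^ (n + 1)) * (1 / (2 ^ (n + 1) * ρ) ^ d)) *
            (ENNReal.ofReal ((2 ^ (n + 2) * ρ) ^ d) * maximalFn g x) := by
          gcongr
          refine setLIntegral_le_maximalFn g (by positivity) fun y hy => ?_
          rw [Metric.mem_ball, dist_comm, dist_eq_norm]
          exact hy.2
      _ = _ := by
          rw [← mul_assoc, ← mul_assoc, ← ENNReal.ofReal_mul (by positivity),
            ← ENNReal.ofReal_ofNat 2, ← ENNReal.ofReal_pow (by norm_num),
            ← ENNReal.ofReal_mul hω0]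
          congr 2
          rw [pow_succ 2 (n + 1), mul_right_comm _ 2 ρ, mul_pow _ 2 d]
          field_simp
  calc ∫⁻ y in {y | 2 * ρ < ‖x - y‖}, modulusWeight ω ρ x y * g y
      ≤ ∫⁻ y in ⋃ n, I n, modulusWeight ω ρ x y * g y := lintegral_mono_set hsub
    _ ≤ ∑' n, ∫⁻ y in I n, modulusWeight ω ρ x y * g y := lintegral_iUnion_le _ _
    _ ≤ ∑' n : ℕ, ENNReal.ofReal (ω ((1 / 2) ^ (n + 1))) * (2 ^ d * maximalFn g x) :=
        ENNReal.tsum_le_tsum hI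
    _ ≤ 2 * diniNorm ω * (2 ^ d * maximalFn g x) := by
        rw [ENNReal.tsum_mul_right]
        gcongr
        exact tsum_modulus_le hω
    _ = _ := by ring

/-- Monotone functions are measurable; the argument is cut off at 0 because ω is controlled on [0,
∞) only. -/
theorem measurable_modulusWeight (hω : IsModulusOfContinuity ω) (ρ : ℝ) (hρ : 0 ≤ ρ) (x : Rd d) :
    Measurable fun y => modulusWeight ω ρ x y := by
  have hm : Monotone fun t => ω (max t 0) := fun s t h =>
    hω.mono _ _ (le_max_right _ _) (max_le_max_right _ h)
  have : (fun y : Rd d => modulusWeight ω ρ x y) = fun y =>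
      ENNReal.ofReal ((fun t => ω (max t 0)) (ρ / ‖x - y‖) * (1 / ‖x - y‖ ^ d)) := by
    funext y
    have : 0 ≤ ρ / ‖x - y‖ := by positivity
    simp only [modulusWeight, max_eq_left this]
  rw [this]
  have h1 : Measurable fun y : Rd d => ρ / ‖x - y‖ := by fun_prop
  have h2 : Measurable fun y : Rd d => 1 / ‖x - y‖ ^ d := by fun_prop
  exact ((hm.measurable.comp h1).mul h2).ennreal_ofReal

namespace IsCalderonZygmund

theorem size_const_nonneg (hT : IsCalderonZygmund ω CK K T) (hd : 0 < d) : 0 ≤ CK := by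
  have : Nonempty (Fin d) := ⟨⟨0, hd⟩⟩
  obtain ⟨x, hx⟩ := exists_ne (0 : Rd d)
  have h := (norm_nonneg _).trans (hT.size x 0 hx)
  have hp : 0 < ‖x - 0‖ ^ d := by
    rw [sub_zero]
    exact pow_pos (norm_pos_iff.2 hx) _
  by_contra! hcon
  exact absurd h (not_le.2 (div_neg_of_neg_of_pos hcon hp))

theorem enorm_sub_le (hT : IsCalderonZygmund ω CK K T) {x x' y : Rd d} {ρ : ℝ}
    (h : ‖x - x'‖ ≤ ρ) (hy : 2 * ρ < ‖x - y‖) :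
    ‖K x y - K x' y‖ₑ ≤ modulusWeight ω ρ x y ∧ ‖K y x - K y x'‖ₑ ≤ modulusWeight ω ρ x y := by
  rcases eq_or_ne x x' with rfl | hne
  · simp
  have h0 : 0 < ‖x - x'‖ := norm_pos_iff.2 (sub_ne_zero.2 hne)
  have hs := hT.smooth x x' y (by positivity) (by linarith)
  have hm : ω (‖x - x'‖ / ‖x - y‖) * (1 / ‖x - y‖ ^ d) ≤
      ω (ρ / ‖x - y‖) * (1 / ‖x - y‖ ^ d) := by
    refine mul_le_mul_of_nonneg_right (hT.modulus.mono _ _ (by positivity) ?_) (by positivity)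
    gcongr
  rw [modulusWeight, ← ofReal_norm, ← ofReal_norm]
  constructor <;> apply ENNReal.ofReal_le_ofReal
  · linarith [norm_nonneg (K y x - K y x')]
  · linarith [norm_nonneg (K x y - K x' y)]

/-- Convergence of the dyadic Dini sum forces ω(2^(-n)) → 0. The resulting continuity of the kernel
off the diagonal is the source of all measurability of K, which the definition does not postulate.
-/
theorem tendsto_kernel (hT : IsCalderonZygmund ω CK K T) (hω : diniNorm ω < ∞) {x y : Rd d}
    (hxy : y ≠ x) :
    Filter.Tendsto (fun y' => modulusWeight ω ‖y - y'‖ y x) (nhds y) (nhds 0) := by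
  have h0 : 0 < ‖y - x‖ := norm_pos_iff.2 (sub_ne_zero.2 hxy)
  have hlim : Filter.Tendsto (fun n : ℕ => ENNReal.ofReal (1 / ‖y - x‖ ^ d) *
      ENNReal.ofReal (ω ((1 / 2) ^ (n + 1)))) Filter.atTop (nhds 0) := by
    rw [← mul_zero (ENNReal.ofReal (1 / ‖y - x‖ ^ d))]
    refine ENNReal.Tendsto.const_mul ?_ (Or.inr ENNReal.ofReal_ne_top)
    exact ENNReal.tendsto_atTop_zero_of_tsum_ne_top
      ((tsum_modulus_le hT.modulus).trans_lt (ENNReal.mul_lt_top (by simp) hω)).ne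
  rw [ENNReal.tendsto_nhds_zero]
  intro ε hε
  obtain ⟨n, hn⟩ := ((ENNReal.tendsto_nhds_zero.1 hlim) ε hε).exists
  have hball : Metric.ball y ((1 / 2) ^ (n + 1) * ‖y - x‖) ∈ nhds y :=
    Metric.ball_mem_nhds _ (by positivity)
  filter_upwards [hball] with y' hy'
  refine le_trans ?_ hn
  rw [Metric.mem_ball, dist_comm, dist_eq_norm] at hy'
  rw [modulusWeight, ← ENNReal.ofReal_mul (by positivity), mul_comm (ω _)]
  refine ENNReal.ofReal_le_ofReal (mul_le_mul_of_nonneg_left ?_ (by positivity))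
  refine hT.modulus.mono _ _ (by positivity) ?_
  rw [div_le_iff₀ h0]
  exact hy'.le

theorem continuousAt_kernel (hT : IsCalderonZygmund ω CK K T) (hω : diniNorm ω < ∞) {x y : Rd d}
    (hxy : y ≠ x) :
    ContinuousAt (fun y' => K y' x) y ∧ ContinuousAt (fun y' => K x y') y := by
  have h0 : 0 < ‖y - x‖ := norm_pos_iff.2 (sub_ne_zero.2 hxy)
  have hball : Metric.ball y (‖y - x‖ / 2) ∈ nhds y := Metric.ball_mem_nhds _ (by positivity)
  have hlim := hT.tendsto_kernel hω hxy
  have key : ∀ᶠ y' in nhds y, ‖K y x - K y' x‖ₑ ≤ modulusWeight ω ‖y - y'‖ y x ∧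
      ‖K x y - K x y'‖ₑ ≤ modulusWeight ω ‖y - y'‖ y x := by
    filter_upwards [hball] with y' hy'
    rw [Metric.mem_ball, dist_comm, dist_eq_norm] at hy'
    exact hT.enorm_sub_le le_rfl (by linarith)
  constructor
  · rw [ContinuousAt, tendsto_iff_edist_tendsto_0]
    refine tendsto_of_tendsto_of_tendsto_of_le_of_le' tendsto_const_nhds hlim
      (Filter.Eventually.of_forall fun _ => bot_le) (key.mono fun y' h => ?_)
    rw [edist_comm, edist_eq_enorm_sub]
    exact h.1
  · rw [ContinuousAt, tendsto_iff_edist_tendsto_0]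
    refine tendsto_of_tendsto_of_tendsto_of_le_of_le' tendsto_const_nhds hlim
      (Filter.Eventually.of_forall fun _ => bot_le) (key.mono fun y' h => ?_)
    rw [edist_comm, edist_eq_enorm_sub]
    exact h.2

theorem norm_kernel_le (hT : IsCalderonZygmund ω CK K T) (hd : 0 < d) {x y : Rd d} {ε : ℝ}
    (hε : 0 < ε) (h : ε ≤ ‖x - y‖) : ‖K x y‖ ≤ CK / ε ^ d := by
  have hne : x ≠ y := by
    rintro rfl
    rw [sub_self, norm_zero] at h
    linarith
  refine (hT.size x y hne).trans ?_
  have := hT.size_const_nonneg hd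
  gcongr

theorem enorm_kernel_le (hT : IsCalderonZygmund ω CK K T) (hd : 0 < d) {x y : Rd d} {ε : ℝ}
    (hε : 0 < ε) (h : ε ≤ ‖x - y‖) :
    ‖K x y‖ₑ ≤ ENNReal.ofReal CK * ENNReal.ofReal ((ε ^ d)⁻¹) := by
  rw [← ENNReal.ofReal_mul (hT.size_const_nonneg hd), ← ofReal_norm]
  exact ENNReal.ofReal_le_ofReal (hT.norm_kernel_le hd hε h)

theorem integrableOn_kernel_mul (hT : IsCalderonZygmund ω CK K T) (hd : 0 < d)
    (hω : diniNorm ω < ∞) {f : Rd d → ℂ} (hf : Integrable f) {ε : ℝ} (hε : 0 < ε) {x : Rd d}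
    {s : Set (Rd d)} (hs : MeasurableSet s) (hsub : ∀ y ∈ s, ε ≤ ‖x - y‖) :
    IntegrableOn (fun y => K x y * f y) s := by
  have hc : ContinuousOn (fun y => K x y) s := by
    intro y hy
    refine (hT.continuousAt_kernel hω (x := x) ?_).2.continuousWithinAt
    rintro rfl
    have := hsub y hy
    rw [sub_self, norm_zero] at this
    linarith
  refine Integrable.mono' (g := fun y => CK / ε ^ d * ‖f y‖) (hf.norm.const_mul _).integrableOn
    ((hc.aestronglyMeasurable hs).mul hf.aestronglyMeasurable.restrict) ?_
  filter_upwards [ae_restrict_mem hs] with y hy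
  rw [norm_mul]
  exact mul_le_mul_of_nonneg_right (hT.norm_kernel_le hd hε (hsub y hy)) (norm_nonneg _)

end IsCalderonZygmund

theorem measurableSet_truncation (ε : ℝ) (x : Rd d) : MeasurableSet {y | ε < ‖x - y‖} :=
  measurableSet_lt (by fun_prop) (by fun_prop)

theorem enorm_truncation_le {ε : ℝ} (hε : 0 < ε) (f : Rd d → ℂ) (x : Rd d) :
    ‖truncation K ε f x‖ₑ ≤ maximalTruncation K f x :=
  le_iSup₂ (f := fun (ε : ℝ) (_ : 0 < ε) => ‖truncation K ε f x‖ₑ) ε hε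

theorem truncation_congr_ae {f g : Rd d → ℂ} (h : f =ᵐ[volume] g) (ε : ℝ) (x : Rd d) :
    truncation K ε f x = truncation K ε g x := by
  refine integral_congr_ae (ae_restrict_of_ae ?_)
  filter_upwards [h] with y hy
  rw [hy]

theorem maximalTruncation_congr_ae {f g : Rd d → ℂ} (h : f =ᵐ[volume] g) (x : Rd d) :
    maximalTruncation K f x = maximalTruncation K g x := by
  simp only [maximalTruncation, truncation_congr_ae h]

namespace IsCalderonZygmund

theorem integrableOn_truncation (hT : IsCalderonZygmund ω CK K T) (hd : 0 < d)
    (hω : diniNorm ω < ∞) {f : Rd d → ℂ} (hf : Integrable f) {ε : ℝ} (hε : 0 < ε) (x : Rd d) :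
    IntegrableOn (fun y => K x y * f y) {y | ε < ‖x - y‖} :=
  hT.integrableOn_kernel_mul hd hω hf hε (measurableSet_truncation ε x) fun _ hy => le_of_lt hy

theorem truncation_add (hT : IsCalderonZygmund ω CK K T) (hd : 0 < d)
    (hω : diniNorm ω < ∞) {f g : Rd d → ℂ} (hf : Integrable f) (hg : Integrable g) {ε : ℝ}
    (hε : 0 < ε) (x : Rd d) :
    truncation K ε (f + g) x = truncation K ε f x + truncation K ε g x := by
  rw [truncation, truncation, truncation, ← integral_add
    (hT.integrableOn_truncation hd hω hf hε x) (hT.integrableOn_truncation hd hω hg hε x)]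
  simp only [Pi.add_apply, mul_add]

theorem maximalTruncation_add_le (hT : IsCalderonZygmund ω CK K T) (hd : 0 < d)
    (hω : diniNorm ω < ∞) {f g : Rd d → ℂ} (hf : Integrable f) (hg : Integrable g) (x : Rd d) :
    maximalTruncation K (f + g) x ≤ maximalTruncation K f x + maximalTruncation K g x := by
  refine iSup₂_le fun ε hε => ?_
  rw [hT.truncation_add hd hω hf hg hε]
  exact (enorm_add_le _ _).trans
    (add_le_add (enorm_truncation_le hε f x) (enorm_truncation_le hε g x))

/-- Dominated convergence: the sharp cut-off is discontinuous only for y on a sphere, a null set.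
Consequently the superlevel sets of the maximal truncation are open, so small dyadic cubes about
their points fit inside them. -/
theorem continuous_truncation (hT : IsCalderonZygmund ω CK K T) (hd : 0 < d)
    (hω : diniNorm ω < ∞) {f : Rd d → ℂ} (hf : Integrable f) {ε : ℝ} (hε : 0 < ε) :
    Continuous fun x => truncation K ε f x := by
  have : Nonempty (Fin d) := ⟨⟨0, hd⟩⟩
  have heq : ∀ x, truncation K ε f x =
      ∫ y, {y | ε < ‖x - y‖}.indicator (fun y => K x y * f y) y := fun x =>
    (integral_indicator (measurableSet_truncation ε x)).symm
  simp only [heq]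
  rw [continuous_iff_continuousAt]
  intro x₀
  refine continuousAt_of_dominated (bound := fun y => CK / ε ^ d * ‖f y‖)
    (Filter.Eventually.of_forall fun x => ?_) (Filter.Eventually.of_forall fun x =>
    Filter.Eventually.of_forall fun y => ?_) (hf.norm.const_mul _) ?_
  · exact ((hT.integrableOn_truncation hd hω hf hε x).integrable_indicator
      (measurableSet_truncation ε x)).aestronglyMeasurable
  · have hCK := hT.size_const_nonneg hd
    by_cases h : ε < ‖x - y‖
    · rw [Set.indicator_of_mem (show y ∈ {y | ε < ‖x - y‖} from h), norm_mul]
      exact mul_le_mul_of_nonneg_right (hT.norm_kernel_le hd hε h.le) (norm_nonneg _)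
    · rw [Set.indicator_of_notMem (show y ∉ {y | ε < ‖x - y‖} from h), norm_zero]
      positivity
  · have hsph : ∀ᵐ y : Rd d, y ∉ Metric.sphere x₀ ε :=
      measure_eq_zero_iff_ae_notMem.1 (Measure.addHaar_sphere volume x₀ ε)
    filter_upwards [hsph] with y hy
    have hne : ‖x₀ - y‖ ≠ ε := fun h => hy (by
      rw [Metric.mem_sphere, dist_comm, dist_eq_norm]; exact h)
    have hcn : Continuous fun x : Rd d => ‖x - y‖ := by fun_prop
    rcases lt_or_gt_of_ne hne with h | h
    · have hev : ∀ᶠ x in nhds x₀, ‖x - y‖ < ε := hcn.continuousAt.eventually_lt_const h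
      refine (continuousAt_const (y := (0 : ℂ))).congr (hev.mono fun x hx => ?_)
      exact (Set.indicator_of_notMem (show y ∉ {y | ε < ‖x - y‖} from not_lt.2 hx.le) _).symm
    · have hev : ∀ᶠ x in nhds x₀, ε < ‖x - y‖ := hcn.continuousAt.eventually_const_lt h
      have hxy : x₀ ≠ y := by
        rintro rfl
        rw [sub_self, norm_zero] at h
        linarith
      refine (((hT.continuousAt_kernel hω hxy).1).mul
        (continuousAt_const (y := f y))).congr (hev.mono fun x hx => ?_)
      exact (Set.indicator_of_mem (show y ∈ {y | ε < ‖x - y‖} from hx) fun y => K x y * f y).symm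

theorem isOpen_lt_maximalTruncation (hT : IsCalderonZygmund ω CK K T) (hd : 0 < d)
    (hω : diniNorm ω < ∞) {f : Rd d → ℂ} (hf : Integrable f) (t : ℝ≥0∞) :
    IsOpen {x | t < maximalTruncation K f x} := by
  have : {x | t < maximalTruncation K f x} =
      ⋃ (ε : ℝ) (_ : 0 < ε), {x | t < ‖truncation K ε f x‖ₑ} := by
    ext x
    simp only [Set.mem_iUnion, Set.mem_ofPred_eq, maximalTruncation, lt_iSup_iff]
  rw [this]
  refine isOpen_iUnion fun ε => isOpen_iUnion fun hε => ?_
  exact isOpen_lt continuous_const (hT.continuous_truncation hd hω hf hε).enorm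

end IsCalderonZygmund

end

noncomputable section

/-! ### Maximal truncations of bounded functions -/

variable {d : ℕ} {ω : ℝ → ℝ} {CK : ℝ} {K : Rd d → Rd d → ℂ}
  {T : Lp ℂ 2 (volume : Measure (Rd d)) →L[ℂ] Lp ℂ 2 (volume : Measure (Rd d))}

theorem eLpNorm_two_sq (f : Rd d → ℂ) :
    eLpNorm f 2 volume ^ 2 = ∫⁻ x, ‖f x‖ₑ ^ 2 := by
  have h := eLpNorm_nnreal_pow_eq_lintegral (f := f) (μ := (volume : Measure (Rd d)))
    (p := 2) two_ne_zero
  have h2 : (((2 : ℝ≥0) : ℝ)) = ((2 : ℕ) : ℝ) := by norm_num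
  simpa only [h2, ENNReal.rpow_natCast, ENNReal.coe_ofNat] using h

theorem enorm_Lp_two_sq (F : Lp ℂ 2 (volume : Measure (Rd d))) :
    ‖F‖ₑ ^ 2 = ∫⁻ x, ‖F x‖ₑ ^ 2 := by
  rw [Lp.enorm_def, eLpNorm_two_sq]

theorem lintegral_enorm_sq_apply_le
    (T : Lp ℂ 2 (volume : Measure (Rd d)) →L[ℂ] Lp ℂ 2 (volume : Measure (Rd d)))
    {g : Rd d → ℂ} (hg : MemLp g 2 volume) :
    ∫⁻ x, ‖T (hg.toLp g) x‖ₑ ^ 2 ≤ ‖T‖ₑ ^ 2 * ∫⁻ x, ‖g x‖ₑ ^ 2 := by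
  rw [← enorm_Lp_two_sq, ← eLpNorm_two_sq, ← Lp.enorm_toLp hg, ← mul_pow]
  gcongr
  exact T.le_opENorm _

theorem memLp_two_of_bounded {g : Rd d → ℂ} (hg : Integrable g) {t : ℝ≥0∞} (ht : t ≠ ∞)
    (hb : ∀ᵐ y, ‖g y‖ₑ ≤ t) : MemLp g 2 volume := by
  refine ⟨hg.aestronglyMeasurable, ?_⟩
  have h : eLpNorm g 2 volume ^ 2 < ∞ := by
    rw [eLpNorm_two_sq]
    calc ∫⁻ x, ‖g x‖ₑ ^ 2 ≤ ∫⁻ x, t * ‖g x‖ₑ := by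
          refine lintegral_mono_ae (hb.mono fun x hx => ?_)
          rw [pow_two]
          gcongr
      _ = t * ∫⁻ x, ‖g x‖ₑ := lintegral_const_mul' _ _ ht
      _ < ∞ := ENNReal.mul_lt_top ht.lt_top hg.2
  exact (ENNReal.pow_lt_top_iff.1 h).resolve_right two_ne_zero

theorem add_three_sq_le (a b c : ℝ≥0∞) : (a + b + c) ^ 2 ≤ 9 * (a ^ 2 + b ^ 2 + c ^ 2) := by
  have h : a + b + c ≤ 3 * max a (max b c) := by
    calc a + b + c ≤ max a (max b c) + max a (max b c) + max a (max b c) := by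
          gcongr <;> simp
      _ = _ := by ring
  have h2 : (max a (max b c)) ^ 2 ≤ a ^ 2 + b ^ 2 + c ^ 2 := by
    rcases max_choice a (max b c) with e | e <;> rw [e]
    · exact le_add_right le_self_add
    · rcases max_choice b c with e' | e' <;> rw [e']
      · exact le_add_right le_add_self
      · exact le_add_self
  calc (a + b + c) ^ 2 ≤ (3 * max a (max b c)) ^ 2 := by gcongr
    _ = 9 * (max a (max b c)) ^ 2 := by rw [mul_pow]; norm_num
    _ ≤ _ := by gcongr

namespace IsCalderonZygmund

/-- Kernel oscillation integrated against a function away from a ball. -/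
theorem enorm_setIntegral_kernel_sub_le (hT : IsCalderonZygmund ω CK K T) {x x' : Rd d}
    {ρ : ℝ} (hρ : 0 < ρ) (h : ‖x - x'‖ ≤ ρ) (f : Rd d → ℂ) {s : Set (Rd d)}
    (hsub : ∀ y ∈ s, 2 * ρ < ‖x - y‖) :
    ‖∫ y in s, (K x y - K x' y) * f y‖ₑ ≤
      2 * 2 ^ d * diniNorm ω * maximalFn (fun y => ‖f y‖ₑ) x := by
  refine (enorm_integral_le_lintegral_enorm _).trans ?_
  refine (lintegral_mono_set (t := {y | 2 * ρ < ‖x - y‖}) hsub).trans ?_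
  refine le_trans ?_ (setLIntegral_modulusWeight_le hT.modulus x hρ _)
  refine setLIntegral_mono' (measurableSet_truncation _ x) fun y hy => ?_
  rw [enorm_mul]
  gcongr
  exact (hT.enorm_sub_le h hy).1

/-- Cotlar's inequality for bounded functions, before averaging. -/
theorem ae_enorm_truncation_le (hT : IsCalderonZygmund ω CK K T) (hd : 0 < d)
    (hω : diniNorm ω < ∞) {g : Rd d → ℂ} (hg : Integrable g) {t : ℝ≥0∞}
    (hb : ∀ᵐ y, ‖g y‖ₑ ≤ t) (hg2 : MemLp g 2 volume) {ε : ℝ} (hε : 0 < ε) (x : Rd d)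
    (h1 : MemLp ({y | ε < ‖x - y‖}ᶜ.indicator g) 2 volume) :
    ∀ᵐ z, z ∈ Metric.ball x (ε / 2) → ‖truncation K ε g x‖ₑ ≤
      2 * 2 ^ d * diniNorm ω * (unitBallVolume d * t) + ‖T (hg2.toLp g) z‖ₑ +
        ‖T (h1.toLp _) z‖ₑ := by
  set s : Set (Rd d) := {y | ε < ‖x - y‖} with hs
  have hsm : MeasurableSet s := measurableSet_truncation ε x
  have h2 : MemLp (s.indicator g) 2 volume := hg2.indicator hsm
  have hsum : hg2.toLp g = h2.toLp _ + h1.toLp _ := by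
    rw [← MemLp.toLp_add]
    congr 1
    exact (Set.indicator_self_add_compl s g).symm
  have hcoe := Lp.coeFn_add (T (h2.toLp _)) (T (h1.toLp _))
  filter_upwards [hT.repr (h2.toLp _), hcoe] with z hz hadd hzB
  rw [Metric.mem_ball, dist_comm, dist_eq_norm] at hzB
  -- The far part of g vanishes on the ε-ball about x, hence on the ball of radius ε/2 about z, so T
  -- acts on it at z through the kernel.
  have hsupp : z ∉ essSupport (h2.toLp _ : Rd d → ℂ) := by
    intro hmem
    refine hmem (ε / 2) (by positivity) ?_
    filter_upwards [h2.coeFn_toLp] with y hy hyB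
    rw [hy, Set.indicator_of_notMem]
    rw [Metric.mem_ball, dist_comm, dist_eq_norm] at hyB
    rw [hs, Set.mem_ofPred_eq, not_lt]
    have := norm_sub_le_norm_sub_add_norm_sub x z y
    linarith
  have hval : T (h2.toLp _) z = ∫ y in s, K z y * g y := by
    rw [hz hsupp, ← integral_indicator hsm]
    refine integral_congr_ae ?_
    filter_upwards [h2.coeFn_toLp] with y hy
    rw [hy]
    by_cases hys : y ∈ s
    · rw [Set.indicator_of_mem hys, Set.indicator_of_mem hys]
    · rw [Set.indicator_of_notMem hys, Set.indicator_of_notMem hys, mul_zero]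
  have hint : IntegrableOn (fun y => K z y * g y) s := by
    refine hT.integrableOn_kernel_mul hd hω hg (half_pos hε) hsm fun y hy => ?_
    have hy : ε < ‖x - y‖ := hy
    have := norm_sub_le_norm_sub_add_norm_sub x z y
    linarith
  have hdiff : truncation K ε g x - T (h2.toLp _) z = ∫ y in s, (K x y - K z y) * g y := by
    rw [hval, truncation, ← integral_sub (hT.integrableOn_truncation hd hω hg hε x) hint]
    simp only [hs, sub_mul]
  have hD : ‖truncation K ε g x - T (h2.toLp _) z‖ₑ ≤
      2 * 2 ^ d * diniNorm ω * (unitBallVolume d * t) := by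
    rw [hdiff]
    refine (hT.enorm_setIntegral_kernel_sub_le (half_pos hε) hzB.le g fun y hy => ?_).trans ?_
    · rw [mul_div_cancel₀ _ two_ne_zero]; exact hy
    · gcongr
      exact maximalFn_le_of_ae_le hb x
  have hTz : T (h2.toLp _) z = T (hg2.toLp g) z - T (h1.toLp _) z := by
    rw [hsum, map_add, hadd, Pi.add_apply, add_sub_cancel_right]
  calc ‖truncation K ε g x‖ₑ
      = ‖(truncation K ε g x - T (h2.toLp _) z) + (T (hg2.toLp g) z - T (h1.toLp _) z)‖ₑ := by
        rw [← hTz, sub_add_cancel]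
    _ ≤ _ := by
        refine (enorm_add_le _ _).trans ?_
        rw [add_assoc]
        exact add_le_add hD _root_.enorm_sub_le

/-- Cotlar's inequality for bounded functions. -/
theorem enorm_truncation_sq_le (hT : IsCalderonZygmund ω CK K T) (hd : 0 < d)
    (hω : diniNorm ω < ∞) {g : Rd d → ℂ} (hg : Integrable g) {t : ℝ≥0∞}
    (hb : ∀ᵐ y, ‖g y‖ₑ ≤ t) (hg2 : MemLp g 2 volume) {ε : ℝ} (hε : 0 < ε) (x : Rd d) :
    unitBallVolume d * ‖truncation K ε g x‖ₑ ^ 2 ≤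
      9 * (unitBallVolume d * (2 * 2 ^ d * diniNorm ω * (unitBallVolume d * t)) ^ 2 +
        maximalFn (fun y => ‖T (hg2.toLp g) y‖ₑ ^ 2) x +
        4 ^ d * unitBallVolume d * (‖T‖ₑ * t) ^ 2) := by
  set s : Set (Rd d) := {y | ε < ‖x - y‖} with hs
  have hsm : MeasurableSet s := measurableSet_truncation ε x
  have h1 : MemLp (sᶜ.indicator g) 2 volume := hg2.indicator hsm.compl
  set D := 2 * 2 ^ d * diniNorm ω * (unitBallVolume d * t)
  set v := unitBallVolume d
  set B := Metric.ball x (ε / 2)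
  set r := ENNReal.ofReal ((ε / 2) ^ d)
  have hr0 : r ≠ 0 := by
    simp only [r, ne_eq, ENNReal.ofReal_eq_zero, not_le]; positivity
  have hvB : volume B = r * v := volume_ball_eq x (by positivity)
  have hI1 : ∫⁻ z in B, ‖T (hg2.toLp g) z‖ₑ ^ 2 ≤
      r * maximalFn (fun y => ‖T (hg2.toLp g) y‖ₑ ^ 2) x :=
    setLIntegral_ball_le (fun y => ‖T (hg2.toLp g) y‖ₑ ^ 2) x (by positivity)
  -- The near part is bounded by t and vanishes off the ball of radius 2ε, four times the radius of
  -- B; hence 4^d.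
  have hI2 : ∫⁻ z in B, ‖T (h1.toLp _) z‖ₑ ^ 2 ≤ r * (4 ^ d * v * (‖T‖ₑ * t) ^ 2) := by
    calc ∫⁻ z in B, ‖T (h1.toLp _) z‖ₑ ^ 2 ≤ ∫⁻ z, ‖T (h1.toLp _) z‖ₑ ^ 2 :=
          setLIntegral_le_lintegral _ _
      _ ≤ ‖T‖ₑ ^ 2 * ∫⁻ z, ‖sᶜ.indicator g z‖ₑ ^ 2 := lintegral_enorm_sq_apply_le T h1
      _ ≤ ‖T‖ₑ ^ 2 * ∫⁻ z, (Metric.ball x (2 * ε)).indicator (fun _ => t ^ 2) z := by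
          gcongr ‖T‖ₑ ^ 2 * ?_
          refine lintegral_mono_ae (hb.mono fun z hz => ?_)
          by_cases hzs : z ∈ s
          · rw [Set.indicator_of_notMem (by simpa using hzs)]
            simp
          · have hzb : z ∈ Metric.ball x (2 * ε) := by
              rw [Metric.mem_ball, dist_comm, dist_eq_norm]
              have : ‖x - z‖ ≤ ε := not_lt.1 hzs
              linarith
            rw [Set.indicator_of_mem (by exact hzs), Set.indicator_of_mem hzb]
            gcongr
      _ = ‖T‖ₑ ^ 2 * (t ^ 2 * (ENNReal.ofReal ((2 * ε) ^ d) * v)) := by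
          rw [lintegral_indicator_const Metric.isOpen_ball.measurableSet,
            volume_ball_eq x (by positivity)]
      _ = _ := by
          have : (2 * ε) ^ d = 4 ^ d * (ε / 2) ^ d := by rw [← mul_pow]; ring
          rw [this, ENNReal.ofReal_mul (by positivity), ENNReal.ofReal_pow (by norm_num) d,
            ENNReal.ofReal_ofNat]
          ring
  have hmeas : ∀ F : Lp ℂ 2 (volume : Measure (Rd d)), AEMeasurable (fun z => ‖F z‖ₑ ^ 2)
      (volume.restrict B) := fun F =>
    ((Lp.aestronglyMeasurable F).enorm.pow_const 2).restrict
  -- The pointwise bound is squared and integrated over B, since T is controlled only in L².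
  have key : r * (v * ‖truncation K ε g x‖ₑ ^ 2) ≤ r * (9 * (v * D ^ 2 +
      maximalFn (fun y => ‖T (hg2.toLp g) y‖ₑ ^ 2) x + 4 ^ d * v * (‖T‖ₑ * t) ^ 2)) := by
    calc r * (v * ‖truncation K ε g x‖ₑ ^ 2)
        = ∫⁻ _ in B, ‖truncation K ε g x‖ₑ ^ 2 := by rw [setLIntegral_const, hvB]; ring
      _ ≤ ∫⁻ z in B, 9 * (D ^ 2 + ‖T (hg2.toLp g) z‖ₑ ^ 2 + ‖T (h1.toLp _) z‖ₑ ^ 2) := by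
          have hae := (ae_restrict_iff' Metric.isOpen_ball.measurableSet).2
            (hT.ae_enorm_truncation_le hd hω hg hb hg2 hε x h1)
          refine lintegral_mono_ae (hae.mono fun z hz => ?_)
          exact (pow_le_pow_left' hz 2).trans (add_three_sq_le _ _ _)
      _ = 9 * (D ^ 2 * (r * v) + (∫⁻ z in B, ‖T (hg2.toLp g) z‖ₑ ^ 2) +
            ∫⁻ z in B, ‖T (h1.toLp _) z‖ₑ ^ 2) := by
          rw [lintegral_const_mul' _ _ (by simp), lintegral_add_right' _ (hmeas _),
            lintegral_add_right' _ (hmeas _), setLIntegral_const, hvB]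
      _ ≤ 9 * (D ^ 2 * (r * v) + r * maximalFn (fun y => ‖T (hg2.toLp g) y‖ₑ ^ 2) x +
            r * (4 ^ d * v * (‖T‖ₑ * t) ^ 2)) := by gcongr
      _ = _ := by ring
  exact (ENNReal.mul_le_mul_iff_right hr0 ENNReal.ofReal_ne_top).1 key

end IsCalderonZygmund

/-- Weak type estimate for the maximal truncations of a bounded function. -/
theorem exists_mul_volume_maximalTruncation_bounded_le (hd : 0 < d) : ∃ C₁ C₂ : ℝ≥0,
    ∀ (ω : ℝ → ℝ) (CK : ℝ) (K : Rd d → Rd d → ℂ)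
      (T : Lp ℂ 2 (volume : Measure (Rd d)) →L[ℂ] Lp ℂ 2 (volume : Measure (Rd d))),
      IsCalderonZygmund ω CK K T → diniNorm ω < ∞ →
      ∀ A : ℝ≥0∞, ‖T‖ₑ ≤ A → diniNorm ω ≤ A → A ≠ 0 → A ≠ ∞ →
      ∀ (g : Rd d → ℂ) (t : ℝ≥0∞), Integrable g → (∀ᵐ y, ‖g y‖ₑ ≤ t) → t ≠ 0 → t ≠ ∞ →
        t * volume {x | C₁ * A * t < maximalTruncation K g x} ≤ C₂ * ∫⁻ y, ‖g y‖ₑ := by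
  obtain ⟨CM, hCM⟩ := exists_mul_volume_maximalFn_le hd
  set v := unitBallVolume d with hv
  have hv0 : v ≠ 0 := unitBallVolume_ne_zero
  have hvt : v ≠ ∞ := unitBallVolume_ne_top
  obtain ⟨w, hw⟩ : ∃ w : ℝ≥0, (w : ℝ≥0∞) = v := ⟨v.toNNReal, ENNReal.coe_toNNReal hvt⟩
  -- The 3 is the root of the 9 in Cotlar's inequality; the bracket adds the roots of the
  -- oscillation, near-part and maximal-function terms.
  refine ⟨3 * (2 * 2 ^ d * w + 2 ^ d + 1), CM / w, ?_⟩
  intro ω CK K T hT hω A hTA hωA hA0 hAt g t hg hb ht0 htt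
  have hw0 : w ≠ 0 := by rintro rfl; exact hv0 (by rw [← hw]; rfl)
  have hg2 := memLp_two_of_bounded hg htt hb
  -- Where the maximal function of |Tg|² is at most m, Cotlar's inequality keeps the maximal
  -- truncation below the threshold. Weak (1,1) for |Tg|² and ∫|g|² ≤ t∫|g| then give the estimate.
  set m : ℝ≥0∞ := v * (A * t) ^ 2
  have hsub : {x | ((3 * (2 * 2 ^ d * w + 2 ^ d + 1) : ℝ≥0) : ℝ≥0∞) * A * t <
      maximalTruncation K g x} ⊆
      {x | m < maximalFn (fun y => ‖T (hg2.toLp g) y‖ₑ ^ 2) x} := by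
    intro x hx
    rw [Set.mem_ofPred_eq, maximalTruncation, lt_iSup_iff] at hx
    obtain ⟨ε, hx⟩ := hx
    obtain ⟨hε, hx⟩ := lt_iSup_iff.1 hx
    have hsq := hT.enorm_truncation_sq_le hd hω hg hb hg2 hε x
    by_contra hcon
    rw [Set.mem_ofPred_eq, not_lt] at hcon
    have h1 : v * ‖truncation K ε g x‖ₑ ^ 2 ≤
        v * (((3 * (2 * 2 ^ d * w + 2 ^ d + 1) : ℝ≥0) : ℝ≥0∞) * A * t) ^ 2 := by
      refine hsq.trans ?_
      calc _ ≤ 9 * (v * (2 * 2 ^ d * A * (v * t)) ^ 2 + m + 4 ^ d * v * (A * t) ^ 2) := by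
            gcongr
        _ = v * (9 * ((2 * 2 ^ d * v) ^ 2 + 1 + (2 ^ d) ^ 2)) * (A * t) ^ 2 := by
            rw [show (4 : ℝ≥0∞) ^ d = (2 ^ d) ^ 2 by rw [← pow_mul, mul_comm d 2, pow_mul]; norm_num]
            ring
        _ ≤ v * (9 * (2 * 2 ^ d * v + 2 ^ d + 1) ^ 2) * (A * t) ^ 2 := by
            gcongr v * (9 * ?_) * _
            calc (2 * 2 ^ d * v) ^ 2 + 1 + (2 ^ d) ^ 2 ≤ (2 * 2 ^ d * v) ^ 2 + 1 + (2 ^ d) ^ 2 +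
                  (2 * (2 * 2 ^ d * v) * 2 ^ d + 2 * (2 * 2 ^ d * v) + 2 * 2 ^ d) := le_self_add
              _ = _ := by ring
        _ = _ := by
            rw [← hw]; push_cast; ring
    rw [ENNReal.mul_le_mul_iff_right hv0 hvt] at h1
    have h2 := lt_of_lt_of_le (ENNReal.pow_lt_pow_left two_ne_zero hx) h1
    exact lt_irrefl _ h2
  have hAt0 : v * A ^ 2 * t ≠ 0 := mul_ne_zero (mul_ne_zero hv0 (pow_ne_zero 2 hA0)) ht0
  have hAtt : v * A ^ 2 * t ≠ ∞ :=
    ENNReal.mul_ne_top (ENNReal.mul_ne_top hvt (ENNReal.pow_ne_top hAt)) htt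
  rw [← ENNReal.mul_le_mul_iff_right hAt0 hAtt]
  calc v * A ^ 2 * t * (t * volume _) = m * volume _ := by ring
    _ ≤ m * volume {x | m < maximalFn (fun y => ‖T (hg2.toLp g) y‖ₑ ^ 2) x} := by gcongr
    _ ≤ CM * ∫⁻ y, ‖T (hg2.toLp g) y‖ₑ ^ 2 := hCM _ _
    _ ≤ CM * (A ^ 2 * ∫⁻ y, t * ‖g y‖ₑ) := by
        gcongr
        refine (lintegral_enorm_sq_apply_le T hg2).trans (mul_le_mul' (pow_le_pow_left' hTA 2)
          (lintegral_mono_ae (hb.mono fun x hx => ?_)))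
        rw [pow_two]
        gcongr
    _ = v * A ^ 2 * t * (((CM / w : ℝ≥0) : ℝ≥0∞) * ∫⁻ y, ‖g y‖ₑ) := by
        rw [lintegral_const_mul' _ _ htt, ENNReal.coe_div hw0, ← hw]
        have : (w : ℝ≥0∞) * (CM / w) = CM := ENNReal.mul_div_cancel (by simpa using hw0) (by simp)
        calc _ = (CM : ℝ≥0∞) * (A ^ 2 * (t * ∫⁻ y, ‖g y‖ₑ)) := rfl
          _ = ((w : ℝ≥0∞) * (CM / w)) * (A ^ 2 * (t * ∫⁻ y, ‖g y‖ₑ)) := by rw [this]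
          _ = _ := by ring

end

noncomputable section

/-! ### Side lengths and parents of dyadic cubes -/

/-- The side length of a cube, read off from its volume. -/
def sideLength {d : ℕ} (Q : Set (Rd d)) : ℝ := (volume Q).toReal ^ ((1 : ℝ) / d)

variable {d : ℕ} {α : Fin d → Fin 3}

theorem sideLength_cubeAt (hd : 0 < d) (k : ℤ) (x : Rd d) :
    sideLength (cubeAt α k x) = 2 ^ (-k) := by
  rw [sideLength, volume_cubeAt, ENNReal.toReal_ofReal (by positivity), one_div]
  exact Real.pow_rpow_inv_natCast (by positivity) hd.ne'

theorem sideLength_pos (hd : 0 < d) {Q : Set (Rd d)} (hQ : Q ∈ dyadicSystem α) :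
    0 < sideLength Q := by
  obtain ⟨x, hx⟩ := nonempty_of_mem_dyadicSystem hQ
  obtain ⟨k, rfl⟩ := exists_eq_cubeAt hQ hx
  rw [sideLength_cubeAt hd]
  positivity

theorem volume_eq_sideLength (hd : 0 < d) {Q : Set (Rd d)} (hQ : Q ∈ dyadicSystem α) :
    volume Q = ENNReal.ofReal (sideLength Q ^ d) := by
  obtain ⟨x, hx⟩ := nonempty_of_mem_dyadicSystem hQ
  obtain ⟨k, rfl⟩ := exists_eq_cubeAt hQ hx
  rw [sideLength_cubeAt hd, volume_cubeAt]

theorem norm_sub_le_sideLength (hd : 0 < d) {Q : Set (Rd d)} (hQ : Q ∈ dyadicSystem α)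
    {x y : Rd d} (hx : x ∈ Q) (hy : y ∈ Q) : ‖x - y‖ ≤ d * sideLength Q := by
  obtain ⟨k, rfl⟩ := exists_eq_cubeAt hQ hx
  rw [sideLength_cubeAt hd]
  exact norm_sub_le_of_mem_cubeAt hy

theorem exists_dyadic_parent (hd : 0 < d) {Q : Set (Rd d)} (hQ : Q ∈ dyadicSystem α) :
    ∃ R ∈ dyadicSystem α, Q ⊂ R ∧ sideLength R = 2 * sideLength Q ∧
      ∀ P ∈ dyadicSystem α, Q ⊂ P → R ⊆ P := by
  obtain ⟨x, hx⟩ := nonempty_of_mem_dyadicSystem hQ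
  obtain ⟨k, rfl⟩ := exists_eq_cubeAt hQ hx
  refine ⟨cubeAt α (k - 1) x, cubeAt_mem_dyadicSystem, ⟨cubeAt_anti (by omega), fun h => ?_⟩,
    ?_, fun P hP hQP => ?_⟩
  · have := (cubeAt_subset_iff hd).1 h
    omega
  · rw [sideLength_cubeAt hd, sideLength_cubeAt hd, neg_sub, sub_eq_add_neg,
      zpow_add₀ (by norm_num)]
    norm_num
  · obtain ⟨l, rfl⟩ := exists_eq_cubeAt hP (hQP.subset hx)
    refine cubeAt_anti ?_
    have h1 := (cubeAt_subset_iff hd).1 hQP.subset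
    have h2 : l ≠ k := by
      rintro rfl
      exact hQP.ne rfl
    omega

/-! ### The Calderón–Zygmund decomposition -/

/-- An open set of finite measure is the disjoint union of maximal dyadic cubes. -/
theorem exists_maximal_cubes (hd : 0 < d) (α : Fin d → Fin 3) {Ω : Set (Rd d)} (hΩ : IsOpen Ω)
    (hfin : volume Ω ≠ ∞) : ∃ J ⊆ dyadicSystem α, J.PairwiseDisjoint (fun Q => Q) ∧
      ⋃ Q ∈ J, Q = Ω ∧ ∀ Q ∈ J, ∃ z, z ∉ Ω ∧ ∀ y ∈ Q, ‖z - y‖ ≤ 2 * d * sideLength Q := by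
  set S := {Q | Q ∈ dyadicSystem α ∧ Q ⊆ Ω}
  have hS : S ⊆ dyadicSystem α := fun Q hQ => hQ.1
  have hF : IsForest S := isForest_of_volume_le hd hS hfin fun Q hQ => measure_mono hQ.2
  refine ⟨{Q | Q ∈ S ∧ ∀ R ∈ S, ¬ Q ⊂ R}, fun Q hQ => hS hQ.1, ?_, ?_, ?_⟩
  · intro Q hQ R hR hne
    rcases hF.nested Q hQ.1 R hR.1 with h | h | h
    · exact absurd (h.ssubset_of_ne hne) (hQ.2 R hR.1)
    · exact absurd (h.ssubset_of_ne hne.symm) (hR.2 Q hQ.1)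
    · exact h
  · refine subset_antisymm (Set.iUnion₂_subset fun Q hQ => hQ.1.2) fun x hx => ?_
    obtain ⟨k, -, hk⟩ := exists_cubeAt_subset hΩ hx α 0
    obtain ⟨P, hP, hsub, hmax⟩ := hF.exists_maximal subset_rfl
      (show cubeAt α k x ∈ S from ⟨cubeAt_mem_dyadicSystem, hk⟩)
    exact Set.mem_biUnion (show P ∈ {Q | Q ∈ S ∧ ∀ R ∈ S, ¬ Q ⊂ R} from ⟨hP, hmax⟩)
      (hsub mem_cubeAt_self)
  · intro Q hQ
    -- By maximality of Q its dyadic parent leaves Ω, which yields a point outside Ω within twice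
    -- the diameter bound.
    obtain ⟨R, hR, hQR, hside, -⟩ := exists_dyadic_parent hd (hS hQ.1)
    have hRΩ : ¬ R ⊆ Ω := fun h => hQ.2 R ⟨hR, h⟩ hQR
    obtain ⟨z, hzR, hz⟩ := Set.not_subset.1 hRΩ
    refine ⟨z, hz, fun y hy => ?_⟩
    have := norm_sub_le_sideLength hd hR hzR (hQR.subset hy)
    rw [hside] at this
    linarith

/-- The function equal to the constant `a Q` on each member `Q` of a disjoint family. -/
def stepFn {d : ℕ} (J : Set (Set (Rd d))) (a : Set (Rd d) → ℂ) (x : Rd d) : ℂ :=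
  open Classical in if h : ∃ Q ∈ J, x ∈ Q then a h.choose else 0

theorem stepFn_of_mem {J : Set (Set (Rd d))} (hJ : J.PairwiseDisjoint fun Q => Q)
    (a : Set (Rd d) → ℂ) {Q : Set (Rd d)} (hQ : Q ∈ J) {x : Rd d} (hx : x ∈ Q) :
    stepFn J a x = a Q := by
  have h : ∃ Q ∈ J, x ∈ Q := ⟨Q, hQ, hx⟩
  rw [stepFn, dif_pos h]
  congr 1
  by_contra hne
  exact Set.disjoint_left.1 (hJ h.choose_spec.1 hQ hne) h.choose_spec.2 hx

theorem stepFn_of_notMem {J : Set (Set (Rd d))} (a : Set (Rd d) → ℂ) {x : Rd d}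
    (hx : x ∉ ⋃ Q ∈ J, Q) : stepFn J a x = 0 := by
  rw [stepFn, dif_neg]
  rintro ⟨Q, hQ, h⟩
  exact hx (Set.mem_biUnion hQ h)

theorem measurable_stepFn {J : Set (Set (Rd d))} (hJ : J.PairwiseDisjoint fun Q => Q)
    (hc : J.Countable) (hm : ∀ Q ∈ J, MeasurableSet Q) (a : Set (Rd d) → ℂ) :
    Measurable (stepFn J a) := by
  intro s _
  have : stepFn J a ⁻¹' s = (⋃ Q ∈ {Q | Q ∈ J ∧ a Q ∈ s}, Q) ∪
      ((⋃ Q ∈ J, Q)ᶜ ∩ {_x | (0 : ℂ) ∈ s}) := by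
    ext x
    by_cases hx : ∃ Q ∈ J, x ∈ Q
    · obtain ⟨Q, hQ, hxQ⟩ := hx
      have hmem : x ∈ ⋃ Q ∈ J, Q := Set.mem_biUnion hQ hxQ
      rw [Set.mem_preimage, stepFn_of_mem hJ a hQ hxQ]
      constructor
      · exact fun h => Or.inl (Set.mem_biUnion (show Q ∈ {Q | Q ∈ J ∧ a Q ∈ s} from ⟨hQ, h⟩) hxQ)
      · rintro (h | h)
        · obtain ⟨R, hR, hxR⟩ := Set.mem_iUnion₂.1 h
          have hRQ : R = Q := by
            by_contra hne
            exact Set.disjoint_left.1 (hJ hR.1 hQ hne) hxR hxQ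
          exact hRQ ▸ hR.2
        · exact absurd hmem h.1
    · have hmem : x ∉ ⋃ Q ∈ J, Q := fun h => by
        obtain ⟨R, hR, hxR⟩ := Set.mem_iUnion₂.1 h
        exact hx ⟨R, hR, hxR⟩
      rw [Set.mem_preimage, stepFn_of_notMem a hmem]
      constructor
      · exact fun h => Or.inr ⟨hmem, h⟩
      · rintro (h | h)
        · obtain ⟨R, hR, hxR⟩ := Set.mem_iUnion₂.1 h
          exact absurd ⟨R, hR.1, hxR⟩ hx
        · exact h.2
  rw [this]
  exact (MeasurableSet.biUnion (hc.mono fun _ h => h.1) fun Q hQ => hm Q hQ.1).union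
    ((MeasurableSet.biUnion hc hm).compl.inter (MeasurableSet.const _))

/-- The Calderón–Zygmund decomposition of an integrable function `f` at height `t`, with good
part `g` and with the cubes `J` carrying the bad part `f - g`. -/
theorem exists_calderonZygmund_decomposition (hd : 0 < d) : ∃ C : ℝ≥0, 1 ≤ C ∧
    ∀ (f : Rd d → ℂ) (t : ℝ≥0∞), Integrable f → t ≠ 0 → t ≠ ∞ →
      ∃ (J : Set (Set (Rd d))) (g : Rd d → ℂ), J ⊆ dyadicSystem (fun _ : Fin d => 0) ∧
        J.PairwiseDisjoint (fun Q => Q) ∧ Integrable g ∧ (∀ᵐ y, ‖g y‖ₑ ≤ C * t) ∧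
        ∫⁻ y, ‖g y‖ₑ ≤ ∫⁻ y, ‖f y‖ₑ ∧
        t * ∑' Q : J, volume (Q : Set (Rd d)) ≤ C * ∫⁻ y, ‖f y‖ₑ ∧
        (∀ x ∉ ⋃ Q ∈ J, Q, f x = g x ∧ maximalFn (fun y => ‖f y‖ₑ) x ≤ t) ∧
        ∀ Q ∈ J, ∫ y in Q, (f y - g y) = 0 ∧
          ∫⁻ y in Q, ‖f y - g y‖ₑ ≤ 2 * ∫⁻ y in Q, ‖f y‖ₑ := by
  obtain ⟨CM, hCM⟩ := exists_mul_volume_maximalFn_le hd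
  obtain ⟨CL, hCL⟩ := exists_ae_le_mul_maximalFn d
  refine ⟨CM + CL + (3 * d) ^ d + 1, le_add_self, fun f t hf ht0 htt => ?_⟩
  -- Decomposing a level set of the maximal function gives Mf ≤ t off the cubes, which later
  -- controls the cubes cut by the boundary of a truncation.
  set Ω := {x | t < maximalFn (fun y => ‖f y‖ₑ) x} with hΩdef
  have hΩ : IsOpen Ω := isOpen_lt_maximalFn _ t
  have hvolΩ : t * volume Ω ≤ CM * ∫⁻ y, ‖f y‖ₑ := hCM _ t
  have hΩfin : volume Ω ≠ ∞ := by
    intro h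
    rw [h, ENNReal.mul_top ht0] at hvolΩ
    exact absurd (top_le_iff.1 hvolΩ) (ENNReal.mul_ne_top (by simp) hf.2.ne)
  obtain ⟨J, hJ, hdisj, hU, hz⟩ := exists_maximal_cubes hd (fun _ => 0) hΩ hΩfin
  have hc : J.Countable := (countable_dyadicSystem _).mono hJ
  have hm : ∀ Q ∈ J, MeasurableSet Q := fun Q hQ => measurableSet_of_mem_dyadicSystem (hJ hQ)
  -- Q lies in the open ball of radius 3d times its side about a point where the maximal function is
  -- at most t.
  have hmean : ∀ Q ∈ J, meanNorm f Q ≤ (3 * d) ^ d * t := by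
    intro Q hQ
    obtain ⟨z, hzΩ, hzQ⟩ := hz Q hQ
    have hs := sideLength_pos hd (hJ hQ)
    have hzt : maximalFn (fun y => ‖f y‖ₑ) z ≤ t := not_lt.1 hzΩ
    have hd' : (0 : ℝ) < d := by exact_mod_cast hd
    rw [meanNorm, mul_comm, ← div_eq_mul_inv]
    refine ENNReal.div_le_of_le_mul ?_
    have h1 : ∫⁻ y in Q, ‖f y‖ₑ ≤ ENNReal.ofReal ((3 * d * sideLength Q) ^ d) *
        maximalFn (fun y => ‖f y‖ₑ) z := by
      refine setLIntegral_le_maximalFn _ (by positivity) fun y hy => ?_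
      rw [Metric.mem_ball, dist_comm, dist_eq_norm]
      refine (hzQ y hy).trans_lt ?_
      have : 0 < d * sideLength Q := by positivity
      nlinarith
    refine h1.trans ?_
    rw [volume_eq_sideLength hd (hJ hQ), mul_pow, ENNReal.ofReal_mul (by positivity),
      ENNReal.ofReal_pow (by positivity), ENNReal.ofReal_mul (by norm_num),
      ENNReal.ofReal_ofNat, ENNReal.ofReal_natCast, mul_right_comm]
    gcongr
  set a : Set (Rd d) → ℂ := fun Q => (volume Q).toReal⁻¹ • ∫ y in Q, f y with ha
  have haQ : ∀ Q ∈ J, ‖a Q‖ₑ ≤ meanNorm f Q := by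
    intro Q hQ
    have h0 := volume_pos_of_mem_dyadicSystem (hJ hQ)
    have h1 := volume_ne_top_of_mem_dyadicSystem (hJ hQ)
    rw [ha, meanNorm]
    simp only []
    rw [enorm_smul, Real.enorm_eq_ofReal (by positivity),
      ENNReal.ofReal_inv_of_pos (ENNReal.toReal_pos h0 h1), ENNReal.ofReal_toReal h1]
    gcongr
    exact enorm_integral_le_lintegral_enorm _
  set G := stepFn J a
  have hGm : Measurable G := measurable_stepFn hdisj hc hm a
  set g : Rd d → ℂ := fun x => Ωᶜ.indicator f x + G x with hg
  have hgQ : ∀ Q ∈ J, ∀ x ∈ Q, g x = a Q := by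
    intro Q hQ x hx
    have hxΩ : x ∈ Ω := hU ▸ Set.mem_biUnion hQ hx
    rw [hg]
    simp only []
    rw [Set.indicator_of_notMem (show x ∉ Ωᶜ from fun h => h hxΩ), zero_add]
    exact stepFn_of_mem hdisj a hQ hx
  have hgΩ : ∀ x ∉ Ω, g x = f x := by
    intro x hx
    rw [hg]
    simp only []
    rw [Set.indicator_of_mem (show x ∈ Ωᶜ from hx),
      show G x = 0 from stepFn_of_notMem a (hU ▸ hx), add_zero]
  have hgm : AEStronglyMeasurable g volume :=
    (hf.aestronglyMeasurable.indicator hΩ.measurableSet.compl).add hGm.aestronglyMeasurable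
  have hQint : ∀ Q ∈ J, ∫⁻ y in Q, ‖g y‖ₑ ≤ ∫⁻ y in Q, ‖f y‖ₑ := by
    intro Q hQ
    rw [setLIntegral_congr_fun (hm Q hQ) (g := fun _ => ‖a Q‖ₑ)
      (fun x hx => by simp only [hgQ Q hQ x hx]), setLIntegral_const,
      ← meanNorm_mul_volume (hJ hQ)]
    gcongr
    exact haQ Q hQ
  have hsplit : ∀ h : Rd d → ℂ, ∫⁻ y, ‖h y‖ₑ =
      ∑' Q : J, (∫⁻ y in Q, ‖h y‖ₑ) + ∫⁻ y in Ωᶜ, ‖h y‖ₑ := by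
    intro h
    rw [← lintegral_add_compl _ hΩ.measurableSet]
    congr 1
    rw [← hU, lintegral_biUnion hc hm hdisj]
  have hgf : ∫⁻ y, ‖g y‖ₑ ≤ ∫⁻ y, ‖f y‖ₑ := by
    rw [hsplit g, hsplit f]
    refine add_le_add (ENNReal.tsum_le_tsum fun Q => hQint Q Q.2) (le_of_eq ?_)
    exact setLIntegral_congr_fun hΩ.measurableSet.compl fun x hx => by simp only [hgΩ x hx]
  have hgi : Integrable g := ⟨hgm, hgf.trans_lt hf.2⟩
  refine ⟨J, g, hJ, hdisj, hgi, ?_, hgf, ?_, ?_, ?_⟩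
  · filter_upwards [hCL (fun y => ‖f y‖ₑ) hf.aestronglyMeasurable.enorm hf.2.ne] with x hx
    by_cases hxΩ : x ∈ Ω
    · rw [← hU] at hxΩ
      obtain ⟨Q, hQ, hxQ⟩ := Set.mem_iUnion₂.1 hxΩ
      rw [hgQ Q hQ x hxQ]
      refine ((haQ Q hQ).trans (hmean Q hQ)).trans ?_
      gcongr
      push_cast
      exact le_add_right le_add_self
    · rw [hgΩ x hxΩ]
      refine hx.trans ?_
      gcongr
      · rw [add_assoc, add_assoc]
        exact le_add_left le_self_add
      · exact not_lt.1 hxΩ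
  · have : Countable J := hc.to_subtype
    have hvol : ∑' Q : J, volume (Q : Set (Rd d)) = volume Ω := by
      rw [← hU, measure_biUnion hc hdisj hm]
    rw [hvol]
    refine hvolΩ.trans ?_
    gcongr
    rw [add_assoc, add_assoc]
    exact le_self_add
  · intro x hx
    rw [hU] at hx
    exact ⟨(hgΩ x hx).symm, not_lt.1 hx⟩
  · intro Q hQ
    have h0 := volume_pos_of_mem_dyadicSystem (hJ hQ)
    have h1 := volume_ne_top_of_mem_dyadicSystem (hJ hQ)
    constructor
    · rw [integral_sub hf.integrableOn hgi.integrableOn,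
        setIntegral_congr_fun (hm Q hQ) (g := fun _ => a Q) (hgQ Q hQ), setIntegral_const, ha,
        measureReal_def, smul_smul, mul_inv_cancel₀ (ENNReal.toReal_pos h0 h1).ne', one_smul,
        sub_self]
    · calc ∫⁻ y in Q, ‖f y - g y‖ₑ ≤ ∫⁻ y in Q, (‖f y‖ₑ + ‖g y‖ₑ) :=
            lintegral_mono fun y => enorm_sub_le
        _ = (∫⁻ y in Q, ‖f y‖ₑ) + ∫⁻ y in Q, ‖g y‖ₑ :=
            lintegral_add_left' hf.aestronglyMeasurable.enorm.restrict _
        _ ≤ (∫⁻ y in Q, ‖f y‖ₑ) + ∫⁻ y in Q, ‖f y‖ₑ :=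
            add_le_add le_rfl (hQint Q hQ)
        _ = _ := (two_mul _).symm

end

noncomputable section

/-! ### Weak type (1,1) of the maximal truncations -/

variable {d : ℕ} {ω : ℝ → ℝ} {CK : ℝ} {K : Rd d → Rd d → ℂ}
  {T : Lp ℂ 2 (volume : Measure (Rd d)) →L[ℂ] Lp ℂ 2 (volume : Measure (Rd d))}

namespace IsCalderonZygmund

/-- The contribution to a truncation of a function with mean zero on a set, seen from afar. -/
theorem enorm_setIntegral_atom_le (hT : IsCalderonZygmund ω CK K T) (hd : 0 < d)
    (hω : diniNorm ω < ∞) {b : Rd d → ℂ} (hb : Integrable b) {Q : Set (Rd d)}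
    (hQ : MeasurableSet Q) (hmean : ∫ y in Q, b y = 0) {c x : Rd d} {ρ : ℝ} (hcQ : c ∈ Q)
    (hdiam : ∀ y ∈ Q, ∀ z ∈ Q, ‖y - z‖ ≤ ρ) (hx : 2 * ρ < ‖c - x‖) {ε : ℝ} (hε : 0 < ε) :
    ‖∫ y in {y | ε < ‖x - y‖} ∩ Q, K x y * b y‖ₑ ≤
      modulusWeight ω ρ c x * (∫⁻ y in Q, ‖b y‖ₑ) +
      ENNReal.ofReal CK * ENNReal.ofReal ((ε ^ d)⁻¹) *
        ∫⁻ y in Q ∩ Metric.ball x (2 * ε), ‖b y‖ₑ := by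
  have hρ : 0 ≤ ρ := (norm_nonneg _).trans (hdiam c hcQ c hcQ)
  set s : Set (Rd d) := {y | ε < ‖x - y‖} with hs
  by_cases hQs : Q ⊆ s
  · refine le_add_right ?_
    rw [Set.inter_eq_right.2 hQs]
    have hint : IntegrableOn (fun y => K x y * b y) Q :=
      (hT.integrableOn_truncation hd hω hb hε x).mono_set hQs
    have heq : ∫ y in Q, K x y * b y = ∫ y in Q, (K x y - K x c) * b y := by
      simp only [sub_mul]
      rw [integral_sub hint (hb.integrableOn.const_mul _), integral_const_mul, hmean, mul_zero,
        sub_zero]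
    rw [heq, ← lintegral_const_mul' (modulusWeight ω ρ c x) _ ENNReal.ofReal_ne_top]
    refine (enorm_integral_le_lintegral_enorm _).trans (setLIntegral_mono' hQ fun y hy => ?_)
    rw [enorm_mul, ← enorm_neg, neg_sub]
    gcongr
    exact (hT.enorm_sub_le (hdiam c hcQ y hy) hx).2
  -- Here Q meets the closed ball of radius ε about x. As x is more than 2ρ from the centre of Q,
  -- this forces ρ < ε and puts Q inside the ball of radius 2ε, where the size bound suffices.
  · refine le_add_left ?_
    obtain ⟨z, hzQ, hz⟩ := Set.not_subset.1 hQs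
    have hz : ‖x - z‖ ≤ ε := not_lt.1 hz
    have h1 := hdiam c hcQ z hzQ
    have h2 : ‖c - x‖ ≤ ‖c - z‖ + ‖x - z‖ := by
      rw [norm_sub_rev x z]; exact norm_sub_le_norm_sub_add_norm_sub c z x
    have hsub : s ∩ Q ⊆ Q ∩ Metric.ball x (2 * ε) := by
      intro y hy
      refine ⟨hy.2, ?_⟩
      rw [Metric.mem_ball, dist_comm, dist_eq_norm]
      have h3 := hdiam z hzQ y hy.2
      have h4 := norm_sub_le_norm_sub_add_norm_sub x z y
      linarith
    refine le_trans ?_ (mul_le_mul' le_rfl (lintegral_mono_set hsub))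
    rw [← lintegral_const_mul' _ _ (ENNReal.mul_ne_top ENNReal.ofReal_ne_top ENNReal.ofReal_ne_top)]
    refine (enorm_integral_le_lintegral_enorm _).trans
      (setLIntegral_mono' ((measurableSet_truncation ε x).inter hQ) fun y hy => ?_)
    rw [enorm_mul]
    gcongr
    exact hT.enorm_kernel_le hd hε (le_of_lt hy.1)

end IsCalderonZygmund

set_option maxHeartbeats 2000000 in
/-- The maximal truncation is of weak type (1,1). -/
theorem exists_mul_volume_maximalTruncation_le (hd : 0 < d) : ∃ C₁ C₂ : ℝ≥0,
    ∀ (ω : ℝ → ℝ) (CK : ℝ) (K : Rd d → Rd d → ℂ)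
      (T : Lp ℂ 2 (volume : Measure (Rd d)) →L[ℂ] Lp ℂ 2 (volume : Measure (Rd d))),
      IsCalderonZygmund ω CK K T → diniNorm ω < ∞ →
      ∀ A : ℝ≥0∞, ‖T‖ₑ ≤ A → diniNorm ω ≤ A → ENNReal.ofReal CK ≤ A → A ≠ 0 → A ≠ ∞ →
      ∀ (f : Rd d → ℂ) (t : ℝ≥0∞), Integrable f → t ≠ 0 → t ≠ ∞ →
        t * volume {x | C₁ * A * t < maximalTruncation K f x} ≤ C₂ * ∫⁻ y, ‖f y‖ₑ := by
  obtain ⟨Cg, Cg', hCg⟩ := exists_mul_volume_maximalTruncation_bounded_le hd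
  obtain ⟨C, hC1, hCZ⟩ := exists_calderonZygmund_decomposition hd
  set v := unitBallVolume d with hv
  have hv0 : v ≠ 0 := unitBallVolume_ne_zero
  have hvt : v ≠ ∞ := unitBallVolume_ne_top
  obtain ⟨w, hw⟩ : ∃ w : ℝ≥0, (w : ℝ≥0∞) = v := ⟨v.toNNReal, ENNReal.coe_toNNReal hvt⟩
  -- In the threshold: the good part at height Ct, the function H below, and the cubes cut by the
  -- truncation. In the measure: the good part, the enlarged cubes, and the integral of H.
  refine ⟨Cg * C + 1 + 2 ^ d * (1 + w * C), Cg' + (3 * d) ^ d * w * C + 4 * 2 ^ d * w, ?_⟩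
  intro ω CK K T hT hω A hTA hωA hKA hA0 hAt f t hf ht0 htt
  obtain ⟨J, g, hJ, hdisj, hgi, hgb, hgf, hvol, hoff, hatom⟩ := hCZ f t hf ht0 htt
  have hc : J.Countable := (countable_dyadicSystem _).mono hJ
  have : Countable J := hc.to_subtype
  have hm : ∀ Q : J, MeasurableSet (Q : Set (Rd d)) := fun Q =>
    measurableSet_of_mem_dyadicSystem (hJ Q.2)
  have hne : ∀ Q : J, (Q : Set (Rd d)).Nonempty := fun Q => nonempty_of_mem_dyadicSystem (hJ Q.2)
  choose c hcQ using hne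
  set ρ : J → ℝ := fun Q => d * sideLength (Q : Set (Rd d)) with hρdef
  have hd' : (0 : ℝ) < d := by exact_mod_cast hd
  have hρ : ∀ Q, 0 < ρ Q := fun Q => mul_pos hd' (sideLength_pos hd (hJ Q.2))
  have hdiam : ∀ Q : J, ∀ y ∈ (Q : Set (Rd d)), ∀ z ∈ (Q : Set (Rd d)), ‖y - z‖ ≤ ρ Q :=
    fun Q y hy z hz => norm_sub_le_sideLength hd (hJ Q.2) hy hz
  set b : Rd d → ℂ := fun y => f y - g y with hb
  have hbi : Integrable b := hf.sub hgi
  have hfgb : f = g + b := by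
    funext y
    simp [hb]
  set E : Set (Rd d) := ⋃ Q : J, Metric.ball (c Q) (3 * ρ Q) with hE
  set I : J → ℝ≥0∞ := fun Q => ∫⁻ y in (Q : Set (Rd d)), ‖b y‖ₑ with hI
  set F : J → Set (Rd d) := fun Q => {x | 2 * ρ Q < ‖c Q - x‖} with hF
  have hFm : ∀ Q, MeasurableSet (F Q) := fun Q => measurableSet_truncation _ _
  -- H collects the cancellation estimates of all the cubes. It does not depend on ε, so it bounds
  -- the supremum over truncations.
  set H : Rd d → ℝ≥0∞ := fun x =>
    ∑' Q : J, (F Q).indicator (fun x => modulusWeight ω (ρ Q) (c Q) x * I Q) x with hH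
  have hHterm : ∀ Q : J,
      Measurable ((F Q).indicator (fun x => modulusWeight ω (ρ Q) (c Q) x * I Q)) := fun Q =>
    ((measurable_modulusWeight hT.modulus _ (hρ Q).le _).mul_const _).indicator (hFm Q)
  have hHm : Measurable H := Measurable.tsum hHterm
  have hIsum : ∑' Q, I Q ≤ 2 * ∫⁻ y, ‖f y‖ₑ := by
    calc ∑' Q, I Q ≤ ∑' Q : J, 2 * ∫⁻ y in (Q : Set (Rd d)), ‖f y‖ₑ :=
          ENNReal.tsum_le_tsum fun Q => (hatom Q Q.2).2
      _ = 2 * ∫⁻ y in ⋃ Q : J, (Q : Set (Rd d)), ‖f y‖ₑ := by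
          rw [ENNReal.tsum_mul_left, lintegral_iUnion hm]
          intro Q R hne
          exact hdisj Q.2 R.2 fun h => hne (Subtype.ext h)
      _ ≤ _ := mul_le_mul' le_rfl (setLIntegral_le_lintegral _ _)
  have hHint : ∫⁻ x, H x ≤ 4 * 2 ^ d * v * A * ∫⁻ y, ‖f y‖ₑ := by
    rw [lintegral_tsum fun Q => (hHterm Q).aemeasurable]
    calc ∑' Q : J, ∫⁻ x, (F Q).indicator (fun x => modulusWeight ω (ρ Q) (c Q) x * I Q) x
        ≤ ∑' Q : J, 2 * 2 ^ d * A * v * I Q := by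
          refine ENNReal.tsum_le_tsum fun Q => ?_
          rw [lintegral_indicator (hFm Q), lintegral_mul_const'' _
            (measurable_modulusWeight hT.modulus _ (hρ Q).le _).aemeasurable]
          gcongr
          have h1 := setLIntegral_modulusWeight_le hT.modulus (c Q) (hρ Q) (fun _ => 1)
          simp only [mul_one] at h1
          refine h1.trans (mul_le_mul' (mul_le_mul' le_rfl hωA) ?_)
          have h2 := maximalFn_le_of_ae_le (g := fun _ : Rd d => (1 : ℝ≥0∞)) (t := 1)
            (Filter.Eventually.of_forall fun _ => le_rfl) (c Q)
          rwa [mul_one] at h2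
      _ = 2 * 2 ^ d * A * v * ∑' Q, I Q := ENNReal.tsum_mul_left
      _ ≤ 2 * 2 ^ d * A * v * (2 * ∫⁻ y, ‖f y‖ₑ) := by gcongr
      _ = _ := by ring
  have hEvol : t * volume E ≤ (3 * d) ^ d * v * C * ∫⁻ y, ‖f y‖ₑ := by
    calc t * volume E ≤ t * ∑' Q : J, (3 * d) ^ d * v * volume (Q : Set (Rd d)) := by
          gcongr
          refine (measure_iUnion_le _).trans (ENNReal.tsum_le_tsum fun Q => le_of_eq ?_)
          rw [volume_ball_eq _ (by have := hρ Q; positivity), volume_eq_sideLength hd (hJ Q.2),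
            hρdef]
          simp only []
          rw [← mul_assoc, mul_pow, ENNReal.ofReal_mul (by positivity),
            ENNReal.ofReal_pow (by positivity), ENNReal.ofReal_mul (by norm_num),
            ENNReal.ofReal_ofNat, ENNReal.ofReal_natCast, mul_right_comm]
      _ = (3 * d) ^ d * v * (t * ∑' Q : J, volume (Q : Set (Rd d))) := by
          rw [ENNReal.tsum_mul_left]; ring
      _ ≤ (3 * d) ^ d * v * (C * ∫⁻ y, ‖f y‖ₑ) := by gcongr
      _ = _ := by ring
  -- Off the enlarged cubes the bad part is controlled by `H`.
  have hbad : ∀ x ∉ E, maximalTruncation K b x ≤ H x + A * (2 ^ d * (1 + v * C)) * t := by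
    intro x hx
    have hxF : ∀ Q, x ∈ F Q := by
      intro Q
      by_contra hcon
      have hcon : ‖c Q - x‖ ≤ 2 * ρ Q := not_lt.1 hcon
      refine hx (Set.mem_iUnion.2 ⟨Q, ?_⟩)
      rw [Metric.mem_ball, dist_comm, dist_eq_norm]
      have := hρ Q
      linarith
    have hxJ : x ∉ ⋃ Q ∈ J, Q := by
      intro h
      obtain ⟨Q, hQ, hxQ⟩ := Set.mem_iUnion₂.1 h
      have h1 : 2 * ρ ⟨Q, hQ⟩ < ‖c ⟨Q, hQ⟩ - x‖ := hxF ⟨Q, hQ⟩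
      have h2 := hdiam ⟨Q, hQ⟩ _ (hcQ ⟨Q, hQ⟩) x hxQ
      have h3 := hρ ⟨Q, hQ⟩
      linarith
    refine iSup₂_le fun ε hε => ?_
    set s : Set (Rd d) := {y | ε < ‖x - y‖} with hs
    have hsm : MeasurableSet s := measurableSet_truncation ε x
    have hint : IntegrableOn (fun y => K x y * b y) s := hT.integrableOn_truncation hd hω hbi hε x
    have hdisj' : Pairwise (Function.onFun Disjoint fun Q : J => s ∩ (Q : Set (Rd d))) := by
      intro Q R hne
      exact (hdisj Q.2 R.2 fun h => hne (Subtype.ext h)).mono inter_subset_right inter_subset_right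
    have htr : truncation K ε b x = ∑' Q : J, ∫ y in s ∩ (Q : Set (Rd d)), K x y * b y := by
      rw [← integral_iUnion (fun Q => hsm.inter (hm Q)) hdisj'
        (hint.mono_set (Set.iUnion_subset fun Q => inter_subset_left)), ← Set.inter_iUnion]
      rw [truncation, ← setIntegral_eq_of_subset_of_forall_sdiff_eq_zero hsm inter_subset_left]
      intro y hy
      have hyJ : y ∉ ⋃ Q ∈ J, Q := by
        intro h
        rw [Set.biUnion_eq_iUnion] at h
        exact hy.2 ⟨hy.1, h⟩
      rw [hb]
      simp only []
      rw [(hoff y hyJ).1, sub_self, mul_zero]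
    -- The mass of b near x is controlled because Mf(x) ≤ t off the cubes and |g| ≤ Ct almost
    -- everywhere.
    have hballb : ∫⁻ y in Metric.ball x (2 * ε), ‖b y‖ₑ ≤
        ENNReal.ofReal ((2 * ε) ^ d) * ((1 + v * C) * t) := by
      calc ∫⁻ y in Metric.ball x (2 * ε), ‖b y‖ₑ
          ≤ ∫⁻ y in Metric.ball x (2 * ε), (‖f y‖ₑ + ‖g y‖ₑ) :=
            lintegral_mono fun y => enorm_sub_le
        _ = (∫⁻ y in Metric.ball x (2 * ε), ‖f y‖ₑ) +
              ∫⁻ y in Metric.ball x (2 * ε), ‖g y‖ₑ :=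
            lintegral_add_left' hf.aestronglyMeasurable.enorm.restrict _
        _ ≤ ENNReal.ofReal ((2 * ε) ^ d) * t +
              ENNReal.ofReal ((2 * ε) ^ d) * (v * (C * t)) := by
            refine add_le_add ((setLIntegral_ball_le (fun y => ‖f y‖ₑ) x (by positivity)).trans
              (mul_le_mul' le_rfl (hoff x hxJ).2))
              ((setLIntegral_ball_le (fun y => ‖g y‖ₑ) x (by positivity)).trans
              (mul_le_mul' le_rfl (maximalFn_le_of_ae_le hgb x)))
        _ = _ := by ring
    calc ‖truncation K ε b x‖ₑ
        ≤ ∑' Q : J, ‖∫ y in s ∩ (Q : Set (Rd d)), K x y * b y‖ₑ := by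
          rw [htr]
          exact enorm_tsum_le_tsum_enorm
      _ ≤ ∑' Q : J, (modulusWeight ω (ρ Q) (c Q) x * I Q +
            ENNReal.ofReal CK * ENNReal.ofReal ((ε ^ d)⁻¹) *
              ∫⁻ y in (Q : Set (Rd d)) ∩ Metric.ball x (2 * ε), ‖b y‖ₑ) :=
          ENNReal.tsum_le_tsum fun Q => hT.enorm_setIntegral_atom_le hd hω hbi (hm Q)
            (hatom Q Q.2).1 (hcQ Q) (hdiam Q) (hxF Q) hε
      _ = H x + ENNReal.ofReal CK * ENNReal.ofReal ((ε ^ d)⁻¹) *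
            ∫⁻ y in ⋃ Q : J, (Q : Set (Rd d)) ∩ Metric.ball x (2 * ε), ‖b y‖ₑ := by
          rw [ENNReal.tsum_add, ENNReal.tsum_mul_left, lintegral_iUnion
            (fun Q => (hm Q).inter Metric.isOpen_ball.measurableSet)]
          · congr 1
            refine tsum_congr fun Q => ?_
            rw [Set.indicator_of_mem (hxF Q)]
          · intro Q R hne
            exact (hdisj Q.2 R.2 fun h => hne (Subtype.ext h)).mono inter_subset_left
              inter_subset_left
      _ ≤ H x + A * ENNReal.ofReal ((ε ^ d)⁻¹) *
            (ENNReal.ofReal ((2 * ε) ^ d) * ((1 + v * C) * t)) := by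
          refine add_le_add le_rfl (mul_le_mul' (mul_le_mul' hKA le_rfl) (le_trans ?_ hballb))
          exact lintegral_mono_set (Set.iUnion_subset fun Q => inter_subset_right)
      _ = _ := by
          have h1 : ENNReal.ofReal ((ε ^ d)⁻¹) * ENNReal.ofReal ((2 * ε) ^ d) = 2 ^ d := by
            rw [← ENNReal.ofReal_mul (by positivity), mul_pow, mul_left_comm,
              inv_mul_cancel₀ (by positivity), mul_one, ENNReal.ofReal_pow (by norm_num),
              ENNReal.ofReal_ofNat]
          calc _ = H x + A * (ENNReal.ofReal ((ε ^ d)⁻¹) * ENNReal.ofReal ((2 * ε) ^ d)) *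
                ((1 + v * C) * t) := by ring
            _ = _ := by rw [h1]; ring
  have hC0 : (C : ℝ≥0∞) * t ≠ 0 :=
    mul_ne_zero (by exact_mod_cast (zero_lt_one.trans_le hC1).ne') ht0
  have hCt : (C : ℝ≥0∞) * t ≠ ∞ := ENNReal.mul_ne_top (by simp) htt
  have hgood := hCg ω CK K T hT hω A hTA hωA hA0 hAt g (C * t) hgi hgb hC0 hCt
  have hcover : {x | ((Cg * C + 1 + 2 ^ d * (1 + w * C) : ℝ≥0) : ℝ≥0∞) * A * t <
      maximalTruncation K f x} ⊆
      {x | Cg * A * (C * t) < maximalTruncation K g x} ∪ (E ∪ {x | A * t ≤ H x}) := by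
    intro x hx
    by_contra hcon
    simp only [Set.mem_union, not_or] at hcon
    obtain ⟨h1, h2, h3⟩ := hcon
    rw [Set.mem_ofPred_eq, not_lt] at h1
    rw [Set.mem_ofPred_eq, not_le] at h3
    rw [Set.mem_ofPred_eq] at hx
    refine absurd hx (not_lt.2 ?_)
    calc maximalTruncation K f x ≤ maximalTruncation K g x + maximalTruncation K b x := by
          conv_lhs => rw [hfgb]
          exact hT.maximalTruncation_add_le hd hω hgi hbi x
      _ ≤ Cg * A * (C * t) + (A * t + A * (2 ^ d * (1 + v * C)) * t) :=
          add_le_add h1 ((hbad x h2).trans (add_le_add h3.le le_rfl))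
      _ = _ := by rw [← hw]; push_cast; ring
  have hHvol : t * volume {x | A * t ≤ H x} ≤ 4 * 2 ^ d * v * ∫⁻ y, ‖f y‖ₑ := by
    rw [← ENNReal.mul_le_mul_iff_right hA0 hAt]
    calc A * (t * volume {x | A * t ≤ H x}) = A * t * volume {x | A * t ≤ H x} := by ring
      _ ≤ ∫⁻ x, H x := mul_meas_ge_le_lintegral hHm _
      _ ≤ _ := hHint
      _ = _ := by ring
  calc t * volume _ ≤ t * (volume {x | Cg * A * (C * t) < maximalTruncation K g x} +
        (volume E + volume {x | A * t ≤ H x})) := by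
        gcongr
        exact (measure_mono hcover).trans ((measure_union_le _ _).trans
          (add_le_add le_rfl (measure_union_le _ _)))
    _ = t * volume {x | Cg * A * (C * t) < maximalTruncation K g x} +
        (t * volume E + t * volume {x | A * t ≤ H x}) := by ring
    _ ≤ Cg' * (∫⁻ y, ‖f y‖ₑ) + ((3 * d) ^ d * v * C * (∫⁻ y, ‖f y‖ₑ) +
          4 * 2 ^ d * v * ∫⁻ y, ‖f y‖ₑ) := by
        refine add_le_add ?_ (add_le_add hEvol hHvol)
        refine le_trans ?_ (hgood.trans (mul_le_mul' le_rfl hgf))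
        refine mul_le_mul' (le_mul_of_one_le_left' ?_) le_rfl
        exact_mod_cast hC1
    _ = _ := by rw [← hw]; push_cast; ring

end

noncomputable section

/-! ### Sparse domination on a cube -/

/-- The neighbourhood of a cube whose width is the side length. -/
def dilate {d : ℕ} (Q : Set (Rd d)) : Set (Rd d) := Metric.thickening (sideLength Q) Q

/-- The mass of `f` on the neighbourhood of a cube, relative to the volume of the cube. -/
def dilatedMean {d : ℕ} (f : Rd d → ℂ) (Q : Set (Rd d)) : ℝ≥0∞ :=
  (volume Q)⁻¹ * ∫⁻ y in dilate Q, ‖f y‖ₑ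

/-- The restriction of `f` to the neighbourhood of a cube. -/
def localize {d : ℕ} (f : Rd d → ℂ) (Q : Set (Rd d)) : Rd d → ℂ := (dilate Q).indicator f

variable {d : ℕ} {ω : ℝ → ℝ} {CK : ℝ} {K : Rd d → Rd d → ℂ} {α : Fin d → Fin 3}
  {T : Lp ℂ 2 (volume : Measure (Rd d)) →L[ℂ] Lp ℂ 2 (volume : Measure (Rd d))}

theorem measurableSet_dilate (Q : Set (Rd d)) : MeasurableSet (dilate Q) :=
  Metric.isOpen_thickening.measurableSet

theorem mem_dilate_iff {Q : Set (Rd d)} {y : Rd d} :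
    y ∈ dilate Q ↔ ∃ z ∈ Q, ‖z - y‖ < sideLength Q := by
  rw [dilate, Metric.mem_thickening_iff]
  simp only [dist_comm y, dist_eq_norm]

theorem dilate_mono {P Q : Set (Rd d)} (hP : volume P ≠ ∞) (h : Q ⊆ P) : dilate Q ⊆ dilate P := by
  refine (Metric.thickening_subset_of_subset _ h).trans (Metric.thickening_mono ?_ _)
  exact Real.rpow_le_rpow ENNReal.toReal_nonneg (ENNReal.toReal_mono hP (measure_mono h))
    (by positivity)

theorem integrable_localize {f : Rd d → ℂ} (hf : Integrable f) (Q : Set (Rd d)) :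
    Integrable (localize f Q) := hf.indicator (measurableSet_dilate Q)

theorem lintegral_localize {Q : Set (Rd d)} (hQ : volume Q ≠ 0) (hQ' : volume Q ≠ ∞) (f : Rd d → ℂ) :
    ∫⁻ y, ‖localize f Q y‖ₑ = dilatedMean f Q * volume Q := by
  simp only [localize, enorm_indicator_eq_indicator_enorm]
  rw [lintegral_indicator (measurableSet_dilate Q), dilatedMean, mul_comm, ← mul_assoc,
    ENNReal.mul_inv_cancel hQ hQ', one_mul]

theorem dilatedMean_ne_top {f : Rd d → ℂ} (hf : Integrable f) {Q : Set (Rd d)}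
    (hQ : volume Q ≠ 0) : dilatedMean f Q ≠ ∞ :=
  ENNReal.mul_ne_top (ENNReal.inv_ne_top.2 hQ)
    ((setLIntegral_le_lintegral _ _).trans_lt hf.2).ne

namespace IsCalderonZygmund

theorem enorm_setIntegral_kernel_le (hT : IsCalderonZygmund ω CK K T) (hd : 0 < d)
    {h : Rd d → ℂ} {s : Set (Rd d)} (hs : MeasurableSet s) {x z : Rd d} {r : ℝ} (hr : 0 < r)
    {c : ℝ} (hc : 0 < c) (hx : ∀ y ∈ s, r / c ≤ ‖x - y‖) (hz : ∀ y ∈ s, ‖z - y‖ < 2 * r) :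
    ‖∫ y in s, K x y * h y‖ₑ ≤
      ENNReal.ofReal CK * ENNReal.ofReal ((2 * c) ^ d) * maximalFn (fun y => ‖h y‖ₑ) z := by
  calc ‖∫ y in s, K x y * h y‖ₑ ≤ ∫⁻ y in s, ‖K x y * h y‖ₑ := enorm_integral_le_lintegral_enorm _
    _ ≤ ∫⁻ y in s, ENNReal.ofReal CK * ENNReal.ofReal (((r / c) ^ d)⁻¹) * ‖h y‖ₑ := by
        refine setLIntegral_mono' hs fun y hy => ?_
        rw [enorm_mul]
        gcongr
        exact hT.enorm_kernel_le hd (by positivity) (hx y hy)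
    _ = ENNReal.ofReal CK * ENNReal.ofReal (((r / c) ^ d)⁻¹) * ∫⁻ y in s, ‖h y‖ₑ :=
        lintegral_const_mul' _ _
          (ENNReal.mul_ne_top ENNReal.ofReal_ne_top ENNReal.ofReal_ne_top)
    _ ≤ ENNReal.ofReal CK * ENNReal.ofReal (((r / c) ^ d)⁻¹) *
          (ENNReal.ofReal ((2 * r) ^ d) * maximalFn (fun y => ‖h y‖ₑ) z) := by
        refine mul_le_mul' le_rfl (setLIntegral_le_maximalFn _ (by positivity) fun y hy => ?_)
        rw [Metric.mem_ball, dist_comm, dist_eq_norm]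
        exact hz y hy
    _ = _ := by
        rw [← mul_assoc, mul_assoc (ENNReal.ofReal CK), ← ENNReal.ofReal_mul (by positivity)]
        congr 3
        rw [← inv_pow, ← mul_pow]
        congr 1
        field_simp

/-- Comparison of the maximal truncations at nearby points, for a function supported away from
a cube. -/
theorem maximalTruncation_away_le (hT : IsCalderonZygmund ω CK K T) (hd : 0 < d)
    (hω : diniNorm ω < ∞) {A : ℝ≥0∞} (hωA : diniNorm ω ≤ A) (hKA : ENNReal.ofReal CK ≤ A)
    {Q R : Set (Rd d)} (hQ : Q ∈ dyadicSystem α) (hR : R ∈ dyadicSystem α) (hQR : Q ⊆ R)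
    (hside : sideLength R = 2 * sideLength Q) {h : Rd d → ℂ} (hh : Integrable h) {x z : Rd d}
    (hx : x ∈ Q) (hz : z ∈ R) :
    maximalTruncation K ((dilate Q)ᶜ.indicator h) x ≤ maximalTruncation K h z +
      (2 * 2 ^ d + 2 * (8 * d) ^ d) * A * maximalFn (fun y => ‖h y‖ₑ) z := by
  refine iSup₂_le fun ε hε => ?_
  set ℓ := sideLength Q with hℓ
  have hℓ0 : 0 < ℓ := sideLength_pos hd hQ
  have hd1 : (1 : ℝ) ≤ d := by exact_mod_cast hd
  have hdℓ : ℓ ≤ d * ℓ := le_mul_of_one_le_left hℓ0.le hd1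
  set ρ := 2 * d * ℓ with hρ
  have hρ0 : 0 < ρ := by positivity
  -- With this radius the points at distance more than r from z lie outside the neighbourhood of Q,
  -- and x is within r/2 of z.
  set r := max ε (2 * ρ) with hr
  have hr0 : 0 < r := lt_max_of_lt_left hε
  have hrε : ε ≤ r := le_max_left _ _
  have hrρ : 2 * ρ ≤ r := le_max_right _ _
  have hzR : ∀ y ∈ Q, ‖z - y‖ ≤ ρ := by
    intro y hy
    have := norm_sub_le_sideLength hd hR hz (hQR hy)
    rw [hside] at this
    linarith
  have hzx := hzR x hx
  set s : Set (Rd d) := {y | ε < ‖x - y‖} with hs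
  set s' : Set (Rd d) := {y | r < ‖z - y‖} with hs'
  set U := (dilate Q)ᶜ with hU
  have hsm : MeasurableSet s := measurableSet_truncation ε x
  have hsm' : MeasurableSet s' := measurableSet_truncation r z
  have hUm : MeasurableSet U := (measurableSet_dilate Q).compl
  have hsU : s' ⊆ U := by
    intro y hy hyQ
    obtain ⟨w, hw, hwy⟩ := mem_dilate_iff.1 hyQ
    have h1 := norm_sub_le_norm_sub_add_norm_sub z w y
    have h2 := hzR w hw
    have h3 : r < ‖z - y‖ := hy
    linarith
  have hxfar : ∀ y ∈ s', r / 2 ≤ ‖x - y‖ := by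
    intro y hy
    have h1 := norm_sub_le_norm_sub_add_norm_sub z x y
    have h3 : r < ‖z - y‖ := hy
    linarith
  have hint : IntegrableOn (fun y => K x y * h y) (s ∩ U) :=
    (hT.integrableOn_truncation hd hω hh hε x).mono_set inter_subset_left
  have hint' : IntegrableOn (fun y => K x y * h y) s' :=
    hT.integrableOn_kernel_mul hd hω hh (half_pos hr0) hsm' hxfar
  have hintz : IntegrableOn (fun y => K z y * h y) s' := hT.integrableOn_truncation hd hω hh hr0 z
  have htr : truncation K ε (U.indicator h) x = ∫ y in s ∩ U, K x y * h y := by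
    rw [truncation, ← setIntegral_indicator hUm]
    refine integral_congr_ae (Filter.Eventually.of_forall fun y => ?_)
    by_cases hy : y ∈ U
    · simp only [Set.indicator_of_mem hy]
    · simp only [Set.indicator_of_notMem hy, mul_zero]
  -- The integral at x differs from the truncation at z by a kernel oscillation over the common far
  -- region and by two pieces lying within 2r of z and at distance at least r/(4d) from x, where the
  -- size condition is enough.
  have hdecomp : truncation K ε (U.indicator h) x = truncation K r h z -
      (∫ y in s', (K z y - K x y) * h y) + (∫ y in (s ∩ U) \ s', K x y * h y) -
      ∫ y in s' \ s, K x y * h y := by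
    have e1 : ∫ y in s ∩ U, K x y * h y =
        (∫ y in s ∩ U ∩ s', K x y * h y) + ∫ y in (s ∩ U) \ s', K x y * h y :=
      (integral_inter_add_sdiff hsm' hint).symm
    have e2 : ∫ y in s', K x y * h y =
        (∫ y in s' ∩ s, K x y * h y) + ∫ y in s' \ s, K x y * h y :=
      (integral_inter_add_sdiff hsm hint').symm
    have e3 : s ∩ U ∩ s' = s' ∩ s := by
      rw [Set.inter_assoc, Set.inter_eq_right.2 hsU, Set.inter_comm]
    have e4 : ∫ y in s', (K z y - K x y) * h y =
        truncation K r h z - ∫ y in s', K x y * h y := by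
      rw [truncation, ← integral_sub hintz hint']
      simp only [sub_mul, hs']
    rw [htr, e1, e3, e4, e2]
    ring
  have b1 : ‖∫ y in s', (K z y - K x y) * h y‖ₑ ≤
      2 * 2 ^ d * A * maximalFn (fun y => ‖h y‖ₑ) z := by
    refine (hT.enorm_setIntegral_kernel_sub_le hρ0 hzx h
      fun y hy => lt_of_le_of_lt hrρ hy).trans ?_
    gcongr
  have hconst : ENNReal.ofReal ((2 * (4 * d)) ^ d) = (8 * d) ^ d := by
    rw [ENNReal.ofReal_pow (by positivity), ← mul_assoc, ENNReal.ofReal_mul (by norm_num),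
      ENNReal.ofReal_natCast]
    norm_num
  have hr4 : r / (4 * d) ≤ r / 2 := div_le_div_of_nonneg_left hr0.le two_pos (by linarith)
  have b2 : ‖∫ y in (s ∩ U) \ s', K x y * h y‖ₑ ≤
      A * (8 * d) ^ d * maximalFn (fun y => ‖h y‖ₑ) z := by
    refine (hT.enorm_setIntegral_kernel_le hd (z := z) ((hsm.inter hUm).diff hsm') hr0
      (c := 4 * d) (by positivity) (fun y hy => ?_) fun y hy => ?_).trans ?_
    · have h1 : ε < ‖x - y‖ := hy.1.1
      have h2 : ℓ ≤ ‖x - y‖ := by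
        by_contra! hcon
        exact hy.1.2 (mem_dilate_iff.2 ⟨x, hx, hcon⟩)
      rw [div_le_iff₀ (by positivity)]
      refine max_le ?_ ?_
      · nlinarith [norm_nonneg (x - y)]
      · rw [hρ]; nlinarith
    · have h1 : ‖z - y‖ ≤ r := not_lt.1 hy.2
      linarith
    · rw [hconst]
      gcongr
  have b3 : ‖∫ y in s' \ s, K x y * h y‖ₑ ≤
      A * (8 * d) ^ d * maximalFn (fun y => ‖h y‖ₑ) z := by
    refine (hT.enorm_setIntegral_kernel_le hd (z := z) (hsm'.diff hsm) hr0
      (c := 4 * d) (by positivity) (fun y hy => hr4.trans (hxfar y hy.1)) fun y hy => ?_).trans ?_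
    · have h1 : ‖x - y‖ ≤ ε := not_lt.1 hy.2
      have h2 := norm_sub_le_norm_sub_add_norm_sub z x y
      linarith
    · rw [hconst]
      gcongr
  rw [hdecomp]
  calc _ ≤ ‖truncation K r h z‖ₑ + ‖∫ y in s', (K z y - K x y) * h y‖ₑ +
        ‖∫ y in (s ∩ U) \ s', K x y * h y‖ₑ + ‖∫ y in s' \ s, K x y * h y‖ₑ := by
        refine _root_.enorm_sub_le.trans (add_le_add ((enorm_add_le _ _).trans
          (add_le_add _root_.enorm_sub_le le_rfl)) le_rfl)
    _ ≤ maximalTruncation K h z + 2 * 2 ^ d * A * maximalFn (fun y => ‖h y‖ₑ) z +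
        A * (8 * d) ^ d * maximalFn (fun y => ‖h y‖ₑ) z +
        A * (8 * d) ^ d * maximalFn (fun y => ‖h y‖ₑ) z :=
        add_le_add (add_le_add (add_le_add (enorm_truncation_le hr0 h z) b1) b2) b3
    _ = _ := by ring

end IsCalderonZygmund

theorem localize_eq_add {f : Rd d → ℂ} {P Q : Set (Rd d)} (h : dilate Q ⊆ dilate P) :
    localize f P = localize f Q + (dilate Q)ᶜ.indicator (localize f P) := by
  conv_lhs => rw [← Set.indicator_self_add_compl (dilate Q) (localize f P)]
  congr 1
  rw [localize, localize, Set.indicator_indicator, Set.inter_eq_left.2 h]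

set_option maxHeartbeats 2000000 in
/-- Sparse domination of the maximal truncation of a localized function on a cube. -/
theorem exists_isSparse_localize_le (hd : 0 < d) : ∃ C : ℝ≥0,
    ∀ (ω : ℝ → ℝ) (CK : ℝ) (K : Rd d → Rd d → ℂ)
      (T : Lp ℂ 2 (volume : Measure (Rd d)) →L[ℂ] Lp ℂ 2 (volume : Measure (Rd d))),
      IsCalderonZygmund ω CK K T → diniNorm ω < ∞ →
      ∀ A : ℝ≥0∞, ‖T‖ₑ ≤ A → diniNorm ω ≤ A → ENNReal.ofReal CK ≤ A → A ≠ 0 → A ≠ ∞ →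
      ∀ (α : Fin d → Fin 3) (Q₀ : Set (Rd d)) (f : Rd d → ℂ), Q₀ ∈ dyadicSystem α →
        Integrable f → ∃ S ⊆ {Q | Q ∈ dyadicSystem α ∧ Q ⊆ Q₀}, IsSparse S ∧
          ∀ᵐ x, x ∈ Q₀ → maximalTruncation K (localize f Q₀) x ≤
            C * A * ∑' Q : S, (Q : Set (Rd d)).indicator (fun _ => dilatedMean f Q) x := by
  obtain ⟨C₁, C₂, hweak⟩ := exists_mul_volume_maximalTruncation_le hd
  obtain ⟨CM, hCM⟩ := exists_mul_volume_maximalFn_le hd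
  -- Twice the sum of the weak-type constants makes the exceptional set at most half of P; the added
  -- 1 keeps N nonzero.
  set N : ℝ≥0 := 2 * (C₂ + CM) + 1 with hN
  have hN0 : (N : ℝ≥0∞) ≠ 0 := by simp [hN]
  refine ⟨C₁ * N + (2 * 2 ^ d + 2 * (8 * d) ^ d) * N, ?_⟩
  intro ω CK K T hT hω A hTA hωA hKA hA0 hAt α Q₀ f hQ₀ hf
  set 𝒟 := {Q | Q ∈ dyadicSystem α ∧ Q ⊆ Q₀} with h𝒟
  have h𝒟sub : 𝒟 ⊆ dyadicSystem α := fun Q hQ => hQ.1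
  have hF : IsForest 𝒟 := isForest_of_volume_le hd h𝒟sub
    (volume_ne_top_of_mem_dyadicSystem hQ₀) fun Q hQ => measure_mono hQ.2
  set E : Set (Rd d) → Set (Rd d) := fun P =>
    {x | C₁ * A * (N * dilatedMean f P) < maximalTruncation K (localize f P) x} ∪
      {x | N * dilatedMean f P < maximalFn (fun y => ‖localize f P y‖ₑ) x} with hE
  have hEo : ∀ P, IsOpen (E P) := fun P =>
    (hT.isOpen_lt_maximalTruncation hd hω (integrable_localize hf P) _).union
      (isOpen_lt_maximalFn _ _)
  have hv0 : ∀ P ∈ 𝒟, volume P ≠ 0 := fun P hP => volume_pos_of_mem_dyadicSystem hP.1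
  have hvt : ∀ P ∈ 𝒟, volume P ≠ ∞ := fun P hP => volume_ne_top_of_mem_dyadicSystem hP.1
  have hEvol : ∀ P ∈ 𝒟, volume (E P) ≤ 1 / 2 * volume P := by
    intro P hP
    have hmass := lintegral_localize (hv0 P hP) (hvt P hP) f
    have hat : dilatedMean f P ≠ ∞ := dilatedMean_ne_top hf (hv0 P hP)
    -- The weak-type bound needs a positive height. With zero mean the localized function vanishes
    -- almost everywhere and the exceptional set is empty.
    rcases eq_or_ne (dilatedMean f P) 0 with ha | ha
    · rw [ha, zero_mul] at hmass
      have hzero : localize f P =ᵐ[volume] 0 := by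
        have := (lintegral_eq_zero_iff'
          (integrable_localize hf P).aestronglyMeasurable.enorm).1 hmass
        filter_upwards [this] with y hy
        simpa using hy
      have hempty : E P = ∅ := by
        refine Set.eq_empty_of_forall_notMem fun x hx => ?_
        rcases hx with hx | hx
        · rw [Set.mem_ofPred_eq, maximalTruncation_congr_ae hzero] at hx
          have : maximalTruncation K (0 : Rd d → ℂ) x = 0 := by
            simp [maximalTruncation, truncation]
          rw [this] at hx
          exact not_lt_bot hx
        · have h0 : maximalFn (fun y => ‖localize f P y‖ₑ) x ≤ unitBallVolume d * 0 :=
            maximalFn_le_of_ae_le (hzero.mono fun y hy => by simp [hy]) x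
          rw [mul_zero] at h0
          exact not_lt_bot (lt_of_lt_of_le hx h0)
      rw [hempty]
      simp
    · have ht0 : (N : ℝ≥0∞) * dilatedMean f P ≠ 0 := mul_ne_zero hN0 ha
      have htt : (N : ℝ≥0∞) * dilatedMean f P ≠ ∞ := ENNReal.mul_ne_top (by simp) hat
      have h1 := hweak ω CK K T hT hω A hTA hωA hKA hA0 hAt (localize f P) _
        (integrable_localize hf P) ht0 htt
      have h2 := hCM (fun y => ‖localize f P y‖ₑ) (N * dilatedMean f P)
      rw [hmass] at h1 h2
      have h3 : N * dilatedMean f P * volume (E P) ≤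
          (C₂ + CM) * (dilatedMean f P * volume P) := by
        calc _ ≤ N * dilatedMean f P *
              (volume {x | C₁ * A * (N * dilatedMean f P) <
                maximalTruncation K (localize f P) x} +
              volume {x | N * dilatedMean f P < maximalFn (fun y => ‖localize f P y‖ₑ) x}) := by
              gcongr
              exact measure_union_le _ _
          _ ≤ _ := by
              rw [mul_add, add_mul]
              exact add_le_add h1 h2
      have h4 : (N : ℝ≥0∞) * volume (E P) ≤ (C₂ + CM) * volume P := by
        rw [← ENNReal.mul_le_mul_iff_right ha hat]
        calc _ = N * dilatedMean f P * volume (E P) := by ring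
          _ ≤ _ := h3
          _ = _ := by ring
      rw [← ENNReal.mul_le_mul_iff_right hN0 (by simp)]
      refine h4.trans ?_
      rw [← mul_assoc]
      gcongr
      rw [one_div, ← div_eq_mul_inv, ENNReal.le_div_iff_mul_le (by simp) (by simp), hN]
      push_cast
      rw [mul_comm]
      exact le_self_add
  have hnotsub : ∀ P ∈ 𝒟, ¬ P ⊆ E P := by
    intro P hP hsub
    have h1 := (measure_mono hsub).trans (hEvol P hP)
    have h2 : (1 / 2 : ℝ≥0∞) * volume P < 1 * volume P :=
      ENNReal.mul_lt_mul_left (hv0 P hP) (hvt P hP) (by simp)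
    rw [one_mul] at h2
    exact absurd h1 (not_le.2 h2)
  set bad : Set (Rd d) → Set (Rd d) → Prop := fun P Q => Q ⊆ E P with hbad
  set S := {Q | Selected 𝒟 bad Q} with hS
  have hS𝒟 : S ⊆ 𝒟 := fun Q hQ => Selected.mem hQ
  have hsparse : IsSparse S := by
    refine isSparse_selected hF fun P hP => (measure_mono ?_).trans (hEvol P hP.mem)
    exact Set.iUnion₂_subset fun Q hQ => hQ.2.2
  refine ⟨S, hS𝒟, hsparse, ?_⟩
  set c : ℝ≥0∞ := C₁ * N + (2 * 2 ^ d + 2 * (8 * d) ^ d) * N with hc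
  have hstep : ∀ P ∈ S, ∀ x ∈ P,
      maximalTruncation K (localize f P) x ≤ c * A * dilatedMean f P ∨
      ∃ Q ∈ S, Q ⊂ P ∧ x ∈ Q ∧ maximalTruncation K (localize f P) x ≤
        c * A * dilatedMean f P + maximalTruncation K (localize f Q) x := by
    intro P hP x hxP
    by_cases hxE : x ∈ E P
    · right
      obtain ⟨k₀, hk₀⟩ := exists_eq_cubeAt (hS𝒟 hP).1 hxP
      obtain ⟨k, hk, hkE⟩ := exists_cubeAt_subset (hEo P) hxE α k₀
      have hkP : cubeAt α k x ⊆ P := hk₀ ▸ cubeAt_anti hk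
      have hk𝒟 : cubeAt α k x ∈ 𝒟 := ⟨cubeAt_mem_dyadicSystem, hkP.trans (hS𝒟 hP).2⟩
      have hkss : cubeAt α k x ⊂ P :=
        hkP.ssubset_of_ne fun h => hnotsub P (hS𝒟 hP) (h ▸ hkE)
      obtain ⟨Q, hQ, hkQ, hQP, -, hmax⟩ := hF.exists_selected_child hP hk𝒟 hkss hkE
      have hxQ : x ∈ Q := hkQ mem_cubeAt_self
      obtain ⟨R, hR, hQR, hside, hmin⟩ := exists_dyadic_parent hd (hS𝒟 hQ).1
      have hRP : R ⊆ P := hmin P (hS𝒟 hP).1 hQP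
      -- Either the parent R is P itself, too large to lie in its exceptional set, or R is strictly
      -- inside P and excluded by the maximality of Q.
      have hRE : ¬ R ⊆ E P := by
        by_cases h : R = P
        · exact h ▸ hnotsub P (hS𝒟 hP)
        · exact hmax R ⟨hR, hRP.trans (hS𝒟 hP).2⟩ hQR (hRP.ssubset_of_ne h)
      obtain ⟨z, hzR, hzE⟩ := Set.not_subset.1 hRE
      refine ⟨Q, hQ, hQP, hxQ, ?_⟩
      have hz1 : maximalTruncation K (localize f P) z ≤ C₁ * A * (N * dilatedMean f P) :=
        not_lt.1 fun h => hzE (Or.inl h)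
      have hz2 : maximalFn (fun y => ‖localize f P y‖ₑ) z ≤ N * dilatedMean f P :=
        not_lt.1 fun h => hzE (Or.inr h)
      have hPi := integrable_localize hf P
      calc maximalTruncation K (localize f P) x
          ≤ maximalTruncation K (localize f Q) x +
            maximalTruncation K ((dilate Q)ᶜ.indicator (localize f P)) x := by
            conv_lhs => rw [localize_eq_add (f := f) (dilate_mono (hvt P (hS𝒟 hP)) hQP.subset)]
            exact hT.maximalTruncation_add_le hd hω (integrable_localize hf Q)
              (hPi.indicator (measurableSet_dilate Q).compl) x
        _ ≤ maximalTruncation K (localize f Q) x + (C₁ * A * (N * dilatedMean f P) +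
            (2 * 2 ^ d + 2 * (8 * d) ^ d) * A * (N * dilatedMean f P)) := by
            refine add_le_add le_rfl ((hT.maximalTruncation_away_le hd hω hωA hKA (hS𝒟 hQ).1 hR
              hQR.subset hside hPi hxQ hzR).trans ?_)
            gcongr
        _ = _ := by rw [hc]; ring
    · left
      have h1 : maximalTruncation K (localize f P) x ≤ C₁ * A * (N * dilatedMean f P) :=
        not_lt.1 fun h => hxE (Or.inl h)
      refine h1.trans ?_
      rw [hc]
      calc C₁ * A * (N * dilatedMean f P) = C₁ * N * A * dilatedMean f P := by ring
        _ ≤ _ := by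
          gcongr
          exact le_self_add
  have hQ₀S : Q₀ ∈ S := Selected.top Q₀ ⟨hQ₀, subset_rfl⟩ fun R hR h => h.2 hR.2
  have hsum : ∑' Q : S, volume (Q : Set (Rd d)) ≠ ∞ := by
    have h1 := hsparse.tsum_volume_le (hS𝒟.trans h𝒟sub) Q₀
    have h2 : {Q | Q ∈ S ∧ Q ⊆ Q₀} = S := by
      ext Q
      exact ⟨fun h => h.1, fun h => ⟨h, (hS𝒟 h).2⟩⟩
    rw [h2] at h1
    exact (h1.trans_lt (ENNReal.mul_lt_top (by simp)
      (volume_ne_top_of_mem_dyadicSystem hQ₀).lt_top)).ne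
  have : Countable S := ((countable_dyadicSystem α).mono (hS𝒟.trans h𝒟sub)).to_subtype
  -- Borel–Cantelli: the volumes of the selected cubes are summable, so almost every x lies in
  -- finitely many of them and the recursion stops.
  filter_upwards [ae_finite_setOfPred_mem hsum] with x hxfin hxQ₀
  have hfin : {Q | Q ∈ S ∧ x ∈ Q}.Finite := by
    refine (hxfin.image fun Q : S => (Q : Set (Rd d))).subset ?_
    rintro Q ⟨hQ, hxQ⟩
    exact ⟨⟨Q, hQ⟩, hxQ, rfl⟩
  classical
  -- Induction on the number of selected cubes through x inside P, which drops on passing to a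
  -- child.
  have hind : ∀ n : ℕ, ∀ P ∈ S, x ∈ P → (hfin.toFinset.filter fun Q => Q ⊆ P).card = n →
      maximalTruncation K (localize f P) x ≤
        ∑ Q ∈ hfin.toFinset.filter fun Q => Q ⊆ P, c * A * dilatedMean f Q := by
    intro n
    induction n using Nat.strong_induction_on with
    | _ n ih =>
      intro P hP hxP hn
      have hPmem : P ∈ hfin.toFinset.filter fun Q => Q ⊆ P :=
        Finset.mem_filter.2 ⟨hfin.mem_toFinset.2 ⟨hP, hxP⟩, subset_rfl⟩
      rcases hstep P hP x hxP with h | ⟨Q, hQ, hQP, hxQ, h⟩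
      · exact h.trans (Finset.single_le_sum (f := fun Q => c * A * dilatedMean f Q)
          (fun _ _ => bot_le) hPmem)
      · have hPnot : P ∉ hfin.toFinset.filter fun R => R ⊆ Q := fun h' =>
          hQP.2 (Finset.mem_filter.1 h').2
        have hins : insert P (hfin.toFinset.filter fun R => R ⊆ Q) ⊆
            hfin.toFinset.filter fun R => R ⊆ P := by
          refine Finset.insert_subset hPmem fun R hR => ?_
          rw [Finset.mem_filter] at hR ⊢
          exact ⟨hR.1, hR.2.trans hQP.subset⟩
        have hlt : (hfin.toFinset.filter fun R => R ⊆ Q).card < n := by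
          rw [← hn]
          refine lt_of_lt_of_le ?_ (Finset.card_le_card hins)
          rw [Finset.card_insert_of_notMem hPnot]
          exact Nat.lt_succ_self _
        calc maximalTruncation K (localize f P) x
            ≤ c * A * dilatedMean f P +
              ∑ R ∈ hfin.toFinset.filter fun R => R ⊆ Q, c * A * dilatedMean f R :=
              h.trans (add_le_add le_rfl (ih _ hlt Q hQ hxQ rfl))
          _ = ∑ R ∈ insert P (hfin.toFinset.filter fun R => R ⊆ Q), c * A * dilatedMean f R :=
              (Finset.sum_insert (f := fun R => c * A * dilatedMean f R) hPnot).symm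
          _ ≤ _ := Finset.sum_le_sum_of_subset hins
  refine (hind _ Q₀ hQ₀S hxQ₀ rfl).trans ?_
  rw [← Finset.mul_sum]
  have hcc : ((C₁ * N + (2 * 2 ^ d + 2 * (8 * d) ^ d) * N : ℝ≥0) : ℝ≥0∞) = c := by
    rw [hc]; push_cast; ring
  rw [hcc]
  gcongr c * A * ?_
  rw [← Finset.sum_subtype_of_mem (p := fun Q => Q ∈ S) (fun Q => dilatedMean f Q)
    fun Q hQ => (hfin.mem_toFinset.1 (Finset.mem_filter.1 hQ).1).1]
  refine le_trans (le_of_eq (Finset.sum_congr rfl fun Q hQ => ?_)) (ENNReal.sum_le_tsum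
    ((hfin.toFinset.filter fun Q => Q ⊆ Q₀).subtype fun Q => Q ∈ S))
  have hxQ := (hfin.mem_toFinset.1 (Finset.mem_filter.1 (Finset.mem_subtype.1 hQ)).1).2
  rw [Set.indicator_of_mem hxQ]

end

noncomputable section

/-! ### Global sparse domination -/

variable {d : ℕ} {ω : ℝ → ℝ} {CK : ℝ} {K : Rd d → Rd d → ℂ} {α β : Fin d → Fin 3}
  {T : Lp ℂ 2 (volume : Measure (Rd d)) →L[ℂ] Lp ℂ 2 (volume : Measure (Rd d))}

/-- Off the essential support f vanishes almost everywhere only locally; a locally null set is null.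
-/
theorem ae_mem_essSupport (f : Rd d → ℂ) : ∀ᵐ y, f y ≠ 0 → y ∈ essSupport f := by
  have h : volume {y | y ∉ essSupport f ∧ f y ≠ 0} = 0 := by
    refine measure_null_of_locally_null _ fun x hx => ?_
    have hx1 : ∃ r : ℝ, 0 < r ∧ ∀ᵐ y, y ∈ Metric.ball x r → f y = 0 := by
      by_contra hcon
      exact hx.1 fun r hr h => hcon ⟨r, hr, h⟩
    obtain ⟨r, hr, hae⟩ := hx1
    refine ⟨Metric.ball x r ∩ {y | f y ≠ 0}, ?_, ?_⟩
    · rw [mem_nhdsWithin]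
      exact ⟨_, Metric.isOpen_ball, Metric.mem_ball_self hr, fun y hy => ⟨hy.1, hy.2.2⟩⟩
    · refine measure_mono_null (fun y hy => ?_) hae
      exact fun h => hy.2 (h hy.1)
  filter_upwards [measure_eq_zero_iff_ae_notMem.1 h] with y hy h0
  by_contra hcon
  exact hy ⟨hcon, h0⟩

theorem exists_ae_norm_le {f : Rd d → ℂ} (h : IsCompact (essSupport f)) :
    ∃ r : ℝ, 0 < r ∧ ∀ᵐ y, f y ≠ 0 → ‖y‖ ≤ r := by
  obtain ⟨r, hr, hsub⟩ := h.isBounded.subset_closedBall_lt 0 0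
  refine ⟨r, hr, (ae_mem_essSupport f).mono fun y hy h0 => ?_⟩
  have := hsub (hy h0)
  rwa [mem_closedBall_zero_iff] at this

theorem subset_dilate (hd : 0 < d) {Q : Set (Rd d)} (hQ : Q ∈ dyadicSystem α) : Q ⊆ dilate Q :=
  Metric.self_subset_thickening (sideLength_pos hd hQ) Q

/-- The ratio of the volumes of a cube and of a cube of an adjacent grid containing its
neighbourhood. -/
def coverRatio (d : ℕ) : ℝ≥0 := (2 ^ (6 * (d + 1))) ^ d

theorem exists_cover (hd : 0 < d) {Q : Set (Rd d)} (hQ : Q ∈ dyadicSystem β) :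
    ∃ (α : Fin d → Fin 3) (R : Set (Rd d)), (∀ i, α i ≠ 2) ∧ R ∈ dyadicSystem α ∧
      dilate Q ⊆ R ∧ volume R = coverRatio d * volume Q := by
  obtain ⟨x, hx⟩ := nonempty_of_mem_dyadicSystem hQ
  obtain ⟨k, rfl⟩ := exists_eq_cubeAt hQ hx
  -- The neighbourhood of Q lies within (d+1) side lengths of x, and the one-third trick needs this
  -- radius below 1/6 of the new side; 2^n > 6(d+1) ensures it. The same n for every Q fixes the
  -- volume ratio.
  set n : ℕ := 6 * (d + 1) with hn
  have h2k : (0 : ℝ) < 2 ^ k := by positivity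
  have h2n : (6 : ℝ) * (d + 1) < 2 ^ n := by exact_mod_cast Nat.lt_two_pow_self (n := n)
  have hshift : (2 : ℝ) ^ (k - n) = 2 ^ k / 2 ^ n := by
    rw [zpow_sub₀ (by norm_num), zpow_natCast]
  obtain ⟨α, hα, hsub⟩ := exists_cubeAt_superset_closedBall (k - n) x
    (r := (d + 1) * 2 ^ (-k)) (by
      rw [hshift, zpow_neg, mul_assoc, mul_div_assoc', inv_mul_cancel₀ h2k.ne', mul_one_div,
        div_lt_div_iff₀ (by positivity) (by norm_num)]
      linarith)
  refine ⟨α, _, hα, cubeAt_mem_dyadicSystem, fun y hy => hsub ?_, ?_⟩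
  · obtain ⟨z, hz, hzy⟩ := mem_dilate_iff.1 hy
    rw [sideLength_cubeAt hd] at hzy
    rw [Metric.mem_closedBall, dist_comm, dist_eq_norm]
    have h1 := norm_sub_le_of_mem_cubeAt hz
    have h2 := norm_sub_le_norm_sub_add_norm_sub x z y
    linarith
  · rw [volume_cubeAt, volume_cubeAt, coverRatio, zpow_neg, hshift, inv_div, div_eq_mul_inv,
      mul_pow, ENNReal.ofReal_mul (by positivity), ENNReal.ofReal_pow (by positivity),
      ENNReal.ofReal_pow (by norm_num), ENNReal.ofReal_ofNat, zpow_neg]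
    push_cast
    rfl

theorem coverRatio_ne_zero : (coverRatio d : ℝ≥0∞) ≠ 0 := by
  simp [coverRatio]

theorem dilatedMean_le_meanNorm {Q R : Set (Rd d)} (hsub : dilate Q ⊆ R)
    (hvol : volume R = coverRatio d * volume Q) (f : Rd d → ℂ) :
    dilatedMean f Q ≤ coverRatio d * meanNorm f R := by
  have h : (volume Q)⁻¹ = coverRatio d * (volume R)⁻¹ := by
    rw [hvol, ENNReal.mul_inv (Or.inl coverRatio_ne_zero) (Or.inl ENNReal.coe_ne_top), ← mul_assoc,
      ENNReal.mul_inv_cancel coverRatio_ne_zero ENNReal.coe_ne_top, one_mul]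
  rw [dilatedMean, meanNorm, h, mul_assoc]
  exact mul_le_mul' le_rfl (mul_le_mul' le_rfl (lintegral_mono_set hsub))

/-- Sums of dilated means over a sparse family are dominated by sparse operators of the adjacent
grids whose shifts avoid `2`. -/
theorem exists_isSparse_tsum_dilatedMean_le (hd : 0 < d) : ∃ C : ℝ≥0,
    ∀ (β : Fin d → Fin 3) (S : Set (Set (Rd d))) (f : Rd d → ℂ) (V : ℝ≥0∞),
      S ⊆ dyadicSystem β → IsSparse S → V ≠ ∞ → (∀ Q ∈ S, volume Q ≤ V) → Integrable f →
      ∃ S' : (Fin d → Fin 3) → Set (Set (Rd d)),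
        (∀ α, S' α ⊆ dyadicSystem α ∧ IsSparse (S' α)) ∧ S' (fun _ => 2) = ∅ ∧
        ∀ x, ∑' Q : S, (Q : Set (Rd d)).indicator (fun _ => dilatedMean f Q) x ≤
          C * ∑ α, sparseOperator (S' α) f x := by
  set M : ℝ≥0∞ := ((coverRatio d : ℝ≥0) : ℝ≥0∞) with hM
  have hMt : M ≠ ∞ := ENNReal.coe_ne_top
  obtain ⟨N, hN⟩ := exists_isSparse_sparseOperator_le hd (C := M * 2) (ENNReal.mul_ne_top hMt
    (by simp))
  refine ⟨coverRatio d * N, fun β S f V hS hsp hV hSV hf => ?_⟩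
  choose a R haR hR hsub hvol using fun Q : S => exists_cover hd (hS Q.2)
  have hQR : ∀ Q : S, (Q : Set (Rd d)) ⊆ R Q := fun Q => (subset_dilate hd (hS Q.2)).trans (hsub Q)
  set S₁ : (Fin d → Fin 3) → Set (Set (Rd d)) := fun α => {P | ∃ Q : S, a Q = α ∧ R Q = P} with hS₁
  have hS₁sub : ∀ α, S₁ α ⊆ dyadicSystem α := by
    rintro _ P ⟨Q, rfl, rfl⟩
    exact hR Q
  have hS₁F : ∀ α, IsForest (S₁ α) := fun α =>
    isForest_of_volume_le hd (hS₁sub α) (C := M * V) (ENNReal.mul_ne_top hMt hV) (by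
      rintro P ⟨Q, -, rfl⟩
      rw [hvol]
      gcongr
      exact hSV Q Q.2)
  have hCar : ∀ α, ∀ P ∈ S₁ α, ∑' Q : {Q | Q ∈ S₁ α ∧ Q ⊆ P}, volume (Q : Set (Rd d)) ≤
      M * 2 * volume P := by
    intro α P _
    -- Choosing one original cube for each covering cube is injective and stays inside P, so the
    -- Carleson condition of S transfers with the volume ratio as an extra factor.
    choose q hq hq' using fun Q : {Q | Q ∈ S₁ α ∧ Q ⊆ P} => Q.2.1
    set φ : {Q | Q ∈ S₁ α ∧ Q ⊆ P} → {Q | Q ∈ S ∧ Q ⊆ P} := fun Q =>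
      ⟨q Q, (q Q).2, (hQR (q Q)).trans (by rw [hq' Q]; exact Q.2.2)⟩ with hφ
    have hφi : Function.Injective φ := by
      intro Q Q' h
      have h1 : q Q = q Q' := Subtype.ext (congrArg
        (fun z : {Q | Q ∈ S ∧ Q ⊆ P} => (z : Set (Rd d))) h)
      exact Subtype.ext (by rw [← hq' Q, ← hq' Q', h1])
    calc ∑' Q : {Q | Q ∈ S₁ α ∧ Q ⊆ P}, volume (Q : Set (Rd d))
        = ∑' Q, M * volume ((φ Q : {Q | Q ∈ S ∧ Q ⊆ P}) : Set (Rd d)) := by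
          refine tsum_congr fun Q => ?_
          rw [← hq' Q, hvol]
      _ = M * ∑' Q, volume ((φ Q : {Q | Q ∈ S ∧ Q ⊆ P}) : Set (Rd d)) := ENNReal.tsum_mul_left
      _ ≤ M * ∑' Q : {Q | Q ∈ S ∧ Q ⊆ P}, volume (Q : Set (Rd d)) := by
          gcongr
          exact ENNReal.tsum_comp_le_tsum_of_injective hφi
            fun Q : {Q | Q ∈ S ∧ Q ⊆ P} => volume (Q : Set (Rd d))
      _ ≤ M * (2 * volume P) := by
          gcongr
          exact hsp.tsum_volume_le hS P
      _ = _ := by ring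
  choose S' hS'sub hS'sp hS'le using fun α => hN α (S₁ α) (hS₁sub α) (hS₁F α) (hCar α) f hf
  refine ⟨S', fun α => ⟨(hS'sub α).trans (hS₁sub α), hS'sp α⟩, ?_, fun x => ?_⟩
  · refine Set.eq_empty_of_forall_notMem fun P hP => ?_
    obtain ⟨Q, hQ, -⟩ := hS'sub _ hP
    exact haR Q ⟨0, hd⟩ (by rw [hQ])
  · set F : Set S := {Q | x ∈ (Q : Set (Rd d))} with hF
    set ψ : F → Σ α, S₁ α := fun Q => ⟨a Q.1, ⟨R Q.1, Q.1, rfl, rfl⟩⟩ with hψ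
    -- Distinct cubes may share a cover, but not if both contain x: equal covers force equal
    -- volumes, and two cubes of one grid with the same volume and a common point coincide.
    have hψi : Function.Injective ψ := by
      intro Q Q' h
      have h1 : R Q.1 = R Q'.1 := congrArg (fun p : Σ α, S₁ α => (p.2 : Set (Rd d))) h
      have h2 : volume (Q.1 : Set (Rd d)) = volume (Q'.1 : Set (Rd d)) := by
        have h3 := hvol Q.1
        rw [h1, hvol] at h3
        exact ((ENNReal.mul_right_inj coverRatio_ne_zero hMt).1 h3).symm
      exact Subtype.ext (Subtype.ext (eq_of_mem_of_volume_eq hd (hS Q.1.2) (hS Q'.1.2) Q.2 Q'.2 h2))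
    set w : (Σ α, S₁ α) → ℝ≥0∞ := fun p =>
      (p.2 : Set (Rd d)).indicator (fun _ => meanNorm f p.2) x with hw
    calc ∑' Q : S, (Q : Set (Rd d)).indicator (fun _ => dilatedMean f Q) x
        = ∑' Q : S, F.indicator (fun Q => dilatedMean f (Q : Set (Rd d))) Q := by
          refine tsum_congr fun Q => ?_
          by_cases h : x ∈ (Q : Set (Rd d))
          · rw [Set.indicator_of_mem h, Set.indicator_of_mem (show Q ∈ F from h)]
          · rw [Set.indicator_of_notMem h, Set.indicator_of_notMem (show Q ∉ F from h)]
      _ = ∑' Q : F, dilatedMean f (Q.1 : Set (Rd d)) :=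
          (tsum_subtype F fun Q : S => dilatedMean f (Q : Set (Rd d))).symm
      _ ≤ ∑' Q : F, M * w (ψ Q) := by
          refine ENNReal.tsum_le_tsum fun Q => ?_
          have hx : x ∈ R Q.1 := hQR Q.1 Q.2
          simp only [hw, hψ]
          rw [Set.indicator_of_mem hx]
          exact dilatedMean_le_meanNorm (hsub Q.1) (hvol Q.1) f
      _ = M * ∑' Q : F, w (ψ Q) := ENNReal.tsum_mul_left
      _ ≤ M * ∑' p, w p := by
          gcongr
          exact ENNReal.tsum_comp_le_tsum_of_injective hψi w
      _ = M * ∑ α, sparseOperator (S₁ α) f x := by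
          rw [ENNReal.tsum_sigma', tsum_fintype]
          rfl
      _ ≤ M * ∑ α, (N * sparseOperator (S' α) f x) := by
          gcongr with α
          exact hS'le α x
      _ = _ := by
          rw [← Finset.mul_sum, ← mul_assoc]
          push_cast
          rfl

/-- The cubes around the origin form a sparse collection. -/
theorem isSparse_range_cubeAt (hd : 0 < d) (α : Fin d → Fin 3) (κ : ℕ → ℤ) :
    IsSparse (Set.range fun j => cubeAt α (κ j) (0 : Rd d)) := by
  rintro _ ⟨j, rfl⟩
  have hsub : (⋃ Q' ∈ {Q' | Q' ∈ (Set.range fun j => cubeAt α (κ j) (0 : Rd d)) ∧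
      -- All smaller members lie in the next-generation cube around the origin, whose share of the
      -- volume is 2^(-d) ≤ 1/2.
      Q' ⊂ cubeAt α (κ j) 0}, Q') ⊆ cubeAt α (κ j + 1) 0 := by
    refine Set.iUnion₂_subset fun Q hQ => ?_
    obtain ⟨⟨i, rfl⟩, hss⟩ := hQ
    refine cubeAt_anti ?_
    have h1 := (cubeAt_subset_iff hd).1 hss.subset
    have h2 : κ i ≠ κ j := fun h => hss.ne (by simp only [h])
    omega
  refine (measure_mono hsub).trans ?_
  rw [volume_cubeAt, volume_cubeAt, neg_add, zpow_add₀ (by norm_num), mul_pow,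
    ENNReal.ofReal_mul (by positivity), mul_comm]
  gcongr
  rw [zpow_neg_one, ENNReal.ofReal_pow (by norm_num), ENNReal.ofReal_inv_of_pos (by norm_num),
    ENNReal.ofReal_ofNat, one_div]
  exact pow_le_of_le_one bot_le (by norm_num) hd.ne'

/-- Pointwise bound for the maximal truncation far away from the support. -/
theorem IsCalderonZygmund.maximalTruncation_le_of_far (hT : IsCalderonZygmund ω CK K T)
    (hd : 0 < d) {f : Rd d → ℂ} {x : Rd d} {δ : ℝ} (hδ : 0 < δ)
    (h : ∀ᵐ y, f y ≠ 0 → δ ≤ ‖x - y‖) :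
    maximalTruncation K f x ≤
      ENNReal.ofReal CK * ENNReal.ofReal ((δ ^ d)⁻¹) * ∫⁻ y, ‖f y‖ₑ := by
  refine iSup₂_le fun ε hε => ?_
  rw [← lintegral_const_mul' _ _ (ENNReal.mul_ne_top ENNReal.ofReal_ne_top ENNReal.ofReal_ne_top)]
  refine (enorm_integral_le_lintegral_enorm _).trans ((setLIntegral_le_lintegral _ _).trans
    (lintegral_mono_ae (h.mono fun y hy => ?_)))
  rw [enorm_mul]
  by_cases h0 : f y = 0
  · simp [h0]
  · gcongr
    exact hT.enorm_kernel_le hd hδ (hy h0)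

/-- This serves the degenerate case A = 0, which the weak-type estimates exclude: the kernel then
vanishes off the diagonal. -/
theorem IsCalderonZygmund.maximalTruncation_eq_zero (hT : IsCalderonZygmund ω CK K T)
    (hCK : CK ≤ 0) (f : Rd d → ℂ) (x : Rd d) : maximalTruncation K f x = 0 := by
  refine le_antisymm (iSup₂_le fun ε hε => ?_) bot_le
  have : truncation K ε f x = 0 := by
    refine setIntegral_eq_zero_of_forall_eq_zero fun y hy => ?_
    have hy : ε < ‖x - y‖ := hy
    have hne : x ≠ y := by
      rintro rfl
      rw [sub_self, norm_zero] at hy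
      linarith
    have h1 : ‖K x y‖ ≤ 0 :=
      (hT.size x y hne).trans (div_nonpos_of_nonpos_of_nonneg hCK (by positivity))
    rw [norm_le_zero_iff.1 h1, zero_mul]
  simp [this]

end

/-! ### The main theorem: the local estimate joined to the far field -/

set_option maxHeartbeats 1000000 in
theorem theorem2p5 (d : ℕ) (hd : 0 < d) :
    ∃ c : ℝ≥0, ∀ (ω : ℝ → ℝ) (CK : ℝ) (K : Rd d → Rd d → ℂ)
      (T : Lp ℂ 2 (volume : Measure (Rd d)) →L[ℂ] Lp ℂ 2 (volume : Measure (Rd d))),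
      IsCalderonZygmund ω CK K T → diniNorm ω < ∞ →
      ∀ f : Rd d → ℂ, Integrable f (volume : Measure (Rd d)) → IsCompact (essSupport f) →
        ∃ S : (Fin d → Fin 3) → Set (Set (Rd d)),
          (∀ α, S α ⊆ dyadicSystem α ∧ IsSparse (S α)) ∧
          ∀ᵐ x ∂(volume : Measure (Rd d)),
            maximalTruncation K f x ≤
              (c : ℝ≥0∞) * (‖T‖ₑ + ENNReal.ofReal CK + diniNorm ω) *
                ∑ α : Fin d → Fin 3, sparseOperator (S α) f x := by
  obtain ⟨C, hC⟩ := exists_isSparse_localize_le hd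
  obtain ⟨C', hC'⟩ := exists_isSparse_tsum_dilatedMean_le hd
  refine ⟨C * C' + 12 ^ d, fun ω CK K T hT hω f hf hcpt => ?_⟩
  set A := ‖T‖ₑ + ENNReal.ofReal CK + diniNorm ω with hA
  have hTA : ‖T‖ₑ ≤ A := le_add_right le_self_add
  have hKA : ENNReal.ofReal CK ≤ A := le_add_right le_add_self
  have hωA : diniNorm ω ≤ A := le_add_self
  have hAt : A ≠ ∞ :=
    ENNReal.add_ne_top.2 ⟨ENNReal.add_ne_top.2 ⟨enorm_ne_top, ENNReal.ofReal_ne_top⟩, hω.ne⟩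
  by_cases hA0 : A = 0
  · refine ⟨fun _ => ∅, fun α => ⟨Set.empty_subset _, fun Q hQ => absurd hQ (by simp)⟩,
      Filter.Eventually.of_forall fun x => ?_⟩
    rw [hA0] at hKA
    rw [hT.maximalTruncation_eq_zero (ENNReal.ofReal_eq_zero.1 (le_antisymm hKA bot_le))]
    exact bot_le
  obtain ⟨r, hr, hsupp⟩ := exists_ae_norm_le hcpt
  -- The support radius is below 2^n/6: within the radius 2^n/3 that guarantees membership in Q 0,
  -- and leaving a distance to points outside Q 0.
  obtain ⟨n, hn⟩ := pow_unbounded_of_one_lt (6 * r) (one_lt_two : (1 : ℝ) < 2)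
  set β : Fin d → Fin 3 := fun _ => 2 with hβ
  set κ : ℕ → ℤ := fun j => -(n + j : ℕ) with hκ
  set Q : ℕ → Set (Rd d) := fun j => cubeAt β (κ j) 0 with hQ
  have hQball : ∀ (j : ℕ) (x : Rd d), 3 * ‖x‖ < 2 ^ (n + j) → x ∈ Q j := by
    intro j x hx
    refine closedBall_subset_cubeAt_zero (κ j) (r := ‖x‖) ?_ (mem_closedBall_zero_iff.2 le_rfl)
    rw [hκ, zpow_neg, zpow_natCast, ← div_eq_mul_inv, div_lt_div_iff₀ (by positivity) (by norm_num)]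
    linarith
  have hsuppQ : ∀ j, ∀ᵐ y, f y ≠ 0 → y ∈ Q j := by
    intro j
    filter_upwards [hsupp] with y hy h0
    refine hQball j y ?_
    have h1 : (2 : ℝ) ^ n ≤ 2 ^ (n + j) := pow_le_pow_right₀ (by norm_num) (by omega)
    linarith [hy h0]
  have hQ0 : Q 0 ∈ dyadicSystem β := cubeAt_mem_dyadicSystem
  obtain ⟨S₀, hS₀, hS₀sp, hS₀le⟩ := hC ω CK K T hT hω A hTA hωA hKA hA0 hAt β (Q 0) f hQ0 hf
  obtain ⟨S', hS', hS'β, hS'le⟩ := hC' β S₀ f (volume (Q 0)) (fun P hP => (hS₀ hP).1) hS₀sp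
    (volume_ne_top_of_mem_dyadicSystem hQ0) (fun P hP => measure_mono (hS₀ hP).2) hf
  classical
  -- The local estimate uses nothing from the grid β, so its slot can hold the cubes around the
  -- origin.
  set S : (Fin d → Fin 3) → Set (Set (Rd d)) := fun α =>
    if α = β then Set.range Q else S' α with hS
  have hSβ : S β = Set.range Q := if_pos rfl
  refine ⟨S, fun α => ?_, ?_⟩
  · by_cases h : α = β
    · subst h
      rw [hSβ]
      refine ⟨?_, isSparse_range_cubeAt hd β κ⟩
      rintro _ ⟨j, rfl⟩
      exact cubeAt_mem_dyadicSystem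
    · rw [hS]
      simp only [if_neg h]
      exact hS' α
  have hS'S : ∀ α x, sparseOperator (S' α) f x ≤ sparseOperator (S α) f x := by
    intro α x
    by_cases h : α = β
    · rw [h, hS'β, sparseOperator_eq]
      simp
    · rw [hS]
      simp only [if_neg h]
      exact le_rfl
  have hloc : localize f (Q 0) =ᵐ[volume] f := by
    filter_upwards [hsuppQ 0] with y hy
    by_cases h0 : f y = 0
    · rw [localize, Set.indicator_apply_eq_self.2 fun _ => h0]
    · rw [localize, Set.indicator_of_mem (subset_dilate hd hQ0 (hy h0))]
  filter_upwards [hS₀le] with x hx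
  by_cases hxQ : x ∈ Q 0
  · rw [← maximalTruncation_congr_ae hloc]
    calc maximalTruncation K (localize f (Q 0)) x
        ≤ C * A * (C' * ∑ α, sparseOperator (S' α) f x) := by
          refine (hx hxQ).trans ?_
          gcongr
          exact hS'le x
      _ ≤ C * A * (C' * ∑ α, sparseOperator (S α) f x) := by
          gcongr with α
          exact hS'S α x
      _ = ((C * C' : ℝ≥0) : ℝ≥0∞) * A * ∑ α, sparseOperator (S α) f x := by push_cast; ring
      _ ≤ _ := by
          gcongr
          exact le_self_add
  · have hex : ∃ j, x ∈ Q j := by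
      obtain ⟨j, hj⟩ := pow_unbounded_of_one_lt (3 * ‖x‖) (one_lt_two : (1 : ℝ) < 2)
      exact ⟨j, hQball j x (hj.trans_le (pow_le_pow_right₀ (by norm_num) (by omega)))⟩
    -- Take the first cube containing x. Missing the previous one gives |x| ≥ 2^(n+j)/3, so x is at
    -- least 2^(n+j)/6 from the support, while the side of the first cube is 2·2^(n+j). The ratio of
    -- these lengths is 12, whence 12^d.
    obtain ⟨j, hj⟩ : ∃ j, Nat.find hex = j + 1 :=
      Nat.exists_eq_succ_of_ne_zero fun h => hxQ (h ▸ Nat.find_spec hex)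
    have hxj : x ∈ Q (j + 1) := hj ▸ Nat.find_spec hex
    have hxj' : x ∉ Q j := Nat.find_min hex (by omega)
    have hnorm : (2 : ℝ) ^ (n + j) ≤ 3 * ‖x‖ := not_lt.1 fun h => hxj' (hQball j x h)
    have hfar : ∀ᵐ y, f y ≠ 0 → (2 : ℝ) ^ (n + j) / 6 ≤ ‖x - y‖ := by
      filter_upwards [hsupp] with y hy h0
      have h1 := hy h0
      have h2 : (2 : ℝ) ^ n ≤ 2 ^ (n + j) := pow_le_pow_right₀ (by norm_num) (by omega)
      have h3 := norm_sub_norm_le x y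
      linarith
    have hmass : ∫⁻ y, ‖f y‖ₑ = meanNorm f (Q (j + 1)) * volume (Q (j + 1)) := by
      rw [meanNorm_mul_volume (α := β) cubeAt_mem_dyadicSystem,
        ← lintegral_indicator (measurableSet_of_mem_dyadicSystem (α := β) cubeAt_mem_dyadicSystem)]
      refine lintegral_congr_ae ((hsuppQ (j + 1)).mono fun y hy => ?_)
      rw [Set.indicator_apply]
      split_ifs with h
      · rfl
      · exact enorm_eq_zero.2 (not_not.1 fun h0 => h (hy h0))
    have hvolj : volume (Q (j + 1)) = ENNReal.ofReal ((2 * 2 ^ (n + j)) ^ d) := by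
      rw [hQ, volume_cubeAt, hκ, neg_neg, zpow_natCast, ← add_assoc, pow_succ']
    have hterm : meanNorm f (Q (j + 1)) ≤ sparseOperator (S β) f x := by
      rw [hSβ, sparseOperator_eq]
      refine le_trans ?_ (ENNReal.le_tsum (⟨Q (j + 1), j + 1, rfl⟩ : Set.range Q))
      rw [Set.indicator_of_mem hxj]
    calc maximalTruncation K f x
        ≤ ENNReal.ofReal CK * ENNReal.ofReal ((((2 : ℝ) ^ (n + j) / 6) ^ d)⁻¹) *
          ∫⁻ y, ‖f y‖ₑ := hT.maximalTruncation_le_of_far hd (by positivity) hfar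
      _ = 12 ^ d * ENNReal.ofReal CK * meanNorm f (Q (j + 1)) := by
          rw [hmass, hvolj]
          have h1 : ENNReal.ofReal ((((2 : ℝ) ^ (n + j) / 6) ^ d)⁻¹) *
              ENNReal.ofReal ((2 * 2 ^ (n + j)) ^ d) = 12 ^ d := by
            rw [← ENNReal.ofReal_mul (by positivity), ← inv_pow, ← mul_pow, inv_div,
              ENNReal.ofReal_pow (by positivity)]
            congr 1
            rw [← ENNReal.ofReal_ofNat 12]
            congr 1
            field_simp
            norm_num
          calc _ = ENNReal.ofReal ((((2 : ℝ) ^ (n + j) / 6) ^ d)⁻¹) *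
              ENNReal.ofReal ((2 * 2 ^ (n + j)) ^ d) * ENNReal.ofReal CK *
              meanNorm f (Q (j + 1)) := by ring
            _ = _ := by rw [h1]
      _ ≤ 12 ^ d * A * ∑ α, sparseOperator (S α) f x := by
          gcongr
          exact hterm.trans (Finset.single_le_sum (f := fun α => sparseOperator (S α) f x)
            (fun _ _ => bot_le) (Finset.mem_univ β))
      _ ≤ _ := by
          gcongr
          push_cast
          exact le_add_self
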